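/- Let $n\in\{1,2\}$, $a>0$, $\mu>0$, $\lambda+\frac{2}{n}\mu>0$ and let $m>2$ be a real number. Consider the Cauchy problem for the isothermal compressible Navier–Stokes system $$\partial_t\rho+\operatorname{div}(\rho u)=0,\qquad \partial_t(\rho u)+\operatorname{div}(\rho u\otimes u)-\mu\Delta u-(\lambda+\mu)\nabla\operatorname{div}u+\nabla P(\rho)=0,\qquad P(\rho)=a\rho,$$ on $\mathbb{R}^n$ with initial data $\rho(\cdot,0)=\rho_0$, $u(\cdot,0)=u_0$, where $\rho_0\ge 0$ has compact support and is not (almost everywhere) zero. Assume that one of the following holds: (i) $n=1$; (ii) $n=2$ and the initial data are spherically symmetric, i.e. $\rho_0(x)=r(|x|)$ and $u_0(x)=v(|x|)\,x/|x|$ for some functions $r,v$ of one variable. Then every solution $(\rho,u)\in C^1([0,T],H^m(\mathbb{R}^n))$ blows up in finite time, in the following sense. There is a finite $T^*>0$ (depending only on $n,a,\mu,\lambda,m$ and $(\rho_0,u_0)$) such that every solution $(\rho,u)\in C^1([0,T],H^m(\mathbb{R}^n))$ on a time interval $[0,T]$ with these initial data has $T<T^*$. In particular, there is no global solution, i.e.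 no $(\rho,u)$ on $[0,\infty)$ which for every $T>0$ is a solution in $C^1([0,T],H^m(\mathbb{R}^n))$ with these initial data. (Solutions are understood in the sense of distributions in $x$ for every $t\in(0,T)$.) -/

import Mathlib

open MeasureTheory Set
open scoped ContDiff SchwartzMap

namespace IsothermalNS

noncomputable section

/-- `ℝⁿ` with its Euclidean norm. -/
abbrev Space (n : ℕ) : Type := EuclideanSpace ℝ (Fin n)

/-- The partial derivative `∂ᵢ φ` of a scalar function on `ℝⁿ`. It is only applied to smooth
functions. -/
def pd {n : ℕ} (i : Fin n) (φ : Space n → ℝ) (x : Space n) : ℝ :=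
  fderiv ℝ φ x (EuclideanSpace.single i 1)

/-- Test functions: smooth, real-valued and compactly supported on `ℝⁿ`. -/
def IsTest {n : ℕ} (φ : Space n → ℝ) : Prop :=
  ContDiff ℝ ∞ φ ∧ HasCompactSupport φ

/-- `f ∈ C¹([0,T], H^s(ℝⁿ))` for a real-valued function `f` of `(t,x)` (and real `s ≥ 0`).

`H^s(ℝⁿ)` is the Bessel potential space: the functions `g ∈ L²` such that
`J^s g = 𝓕⁻¹((1 + |ξ|²)^{s/2} 𝓕 g)` is in `L²`, with the norm `‖g‖_{H^s} = ‖J^s g‖_{L²}`.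
As `J^s` is an isometric isomorphism from `H^s` onto `L²`, a map `t ↦ f(t)` is of class `C¹`
on `[0,T]` (one-sided at the end points) with values in `H^s` if and only if `t ↦ J^s f(t)` is
of class `C¹` on `[0,T]` with values in `L²`. -/
def IsC1Sobolev {n : ℕ} (s T : ℝ) (f : ℝ → Space n → ℝ) : Prop :=
  ∃ G : ℝ → Lp ℂ 2 (volume : Measure (Space n)),
    ContDiffOn ℝ 1 G (Icc 0 T) ∧
    ∀ t ∈ Icc (0 : ℝ) T, ∃ hf : MemLp (fun x => (f t x : ℂ)) 2 (volume : Measure (Space n)),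
      TemperedDistribution.besselPotential (Space n) ℂ s
        (hf.toLp (fun x => (f t x : ℂ)) : 𝓢'(Space n, ℂ)) = (G t : 𝓢'(Space n, ℂ))

/-- The continuity equation `∂ₜρ + div(ρu) = 0` on `(0,T) × ℝⁿ`, in the sense of distributions
on `ℝⁿ` for every `t ∈ (0,T)`. -/
def ContinuityEq {n : ℕ} (T : ℝ) (ρ : ℝ → Space n → ℝ) (u : ℝ → Space n → Space n) : Prop :=
  ∀ φ : Space n → ℝ, IsTest φ → ∀ t ∈ Ioo (0 : ℝ) T,
    HasDerivAt (fun τ => ∫ x, ρ τ x * φ x)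
      (∫ x, ∑ j, ρ t x * u t x j * pd j φ x) t

/-- The momentum equation
`∂ₜ(ρu) + div(ρu ⊗ u) - μ Δu - (lam+μ) ∇ div u + ∇P(ρ) = 0` with `P(ρ) = aρ`
on `(0,T) × ℝⁿ`, component by component, in the sense of distributions on `ℝⁿ` for every
`t ∈ (0,T)`. -/
def MomentumEq {n : ℕ} (a μ lam T : ℝ) (ρ : ℝ → Space n → ℝ) (u : ℝ → Space n → Space n) :
    Prop :=
  ∀ i : Fin n, ∀ φ : Space n → ℝ, IsTest φ → ∀ t ∈ Ioo (0 : ℝ) T,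
    HasDerivAt (fun τ => ∫ x, ρ τ x * u τ x i * φ x)
      (∫ x, ((∑ j, ρ t x * u t x i * u t x j * pd j φ x)
        + μ * u t x i * (∑ j, pd j (pd j φ) x)
        + (lam + μ) * (∑ j, u t x j * pd i (pd j φ) x)
        + a * ρ t x * pd i φ x)) t

/-- `(ρ,u) ∈ C¹([0,T], H^m(ℝⁿ))` solves the isothermal compressible Navier–Stokes system on
`[0,T]` with initial data `(ρ₀,u₀)`. At each time the functions matter only up to null sets. -/
structure IsSolution {n : ℕ} (a μ lam m T : ℝ) (ρ₀ : Space n → ℝ) (u₀ : Space n → Space n)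
    (ρ : ℝ → Space n → ℝ) (u : ℝ → Space n → Space n) : Prop where
  density_regular : IsC1Sobolev m T ρ
  velocity_regular : ∀ i, IsC1Sobolev m T (fun t x => u t x i)
  continuity_eq : ContinuityEq T ρ u
  momentum_eq : MomentumEq a μ lam T ρ u
  density_initial : ρ 0 =ᵐ[volume] ρ₀
  velocity_initial : u 0 =ᵐ[volume] u₀

/-- The initial data are spherically symmetric: `ρ₀(x) = r(|x|)` and `u₀(x) = v(|x|) x/|x|`. -/
def SphericallySymmetric {n : ℕ} (ρ₀ : Space n → ℝ) (u₀ : Space n → Space n) : Prop :=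
  ∃ r v : ℝ → ℝ, (∀ᵐ x, ρ₀ x = r ‖x‖) ∧ (∀ᵐ x, u₀ x = (v ‖x‖ / ‖x‖) • x)

end

end IsothermalNS

namespace IsothermalNS

noncomputable section

set_option linter.unusedSectionVars false

/-! ### Sobolev embedding: evaluation and gradient of `H^s` functions on the Fourier side -/

section Sobolev

open scoped FourierTransform InnerProductSpace ENNReal

variable {V : Type*} [NormedAddCommGroup V] [InnerProductSpace ℝ V] [FiniteDimensional ℝ V]
  [MeasurableSpace V] [BorelSpace V]

/-! The gas stays in a fixed ball, while its second moment is forced to grow quadratically in time;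
both are possible only for a bounded time.

The growth is a virial argument. If the gas and the velocity are confined to the ball of radius `R`,
then I(t) = ∫ρ|x|² has I'' = 2∫ρ|u|² + 2naM with M the conserved mass. The pressure, paired with the
field x, contributes naM because P = aρ, and the viscous terms contribute only multiples of ∫ div u
= 0. So I'' ≥ 2naM > 0, but I ≤ R²M (`StrongSolution.integral_density_mul_matDeriv`,
`StrongSolution.time_bound`).

The confinement is the real issue. In the vacuum the momentum equation degenerates to the stationary
Lamé system μΔu + (λ+μ)∇div u = 0. On a half-line, or for a radial field in an exterior planar
domain, integrating it once shows that div u is constant, and u ∈ H¹ forces that constant to be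
zero. A second integration gives u constant, respectively u = d x/|x|², and neither is in L² unless
it vanishes (`ExteriorLame.eq_zero_one`, `ExteriorLame.eq_zero_two`). So u = 0 outside every ball
that contains the gas throughout [0,T]. Since u is Lipschitz in x and vanishes beyond the largest
radius reached by the gas, particles starting inside a smaller ball stay a definite distance away
from that radius. Hence the gas never leaves its initial ball
(`StrongSolution.density_eq_zero_of_exterior`).

In the plane this requires u to be radial at later times, although only the data are assumed
symmetric. The system commutes with linear isometries, so symmetry follows from uniqueness of the
velocity (`StrongSolution.velocity_unique`). Uniqueness comes from Grönwall's inequality for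
∫ρ₁|u₁-u₂|² + ∫(ρ₁-ρ₂)². This energy does not see the velocity in the vacuum; a Poincaré inequality
weighted by the density, together with the viscous dissipation, supplies the missing control.

These arguments are classical, so the distributional solutions are first replaced by representatives
that are jointly C¹, with velocity and velocity gradient bounded and in L²
(`IsC1Sobolev.exists_contDiff`, `IsSolution.exists_strongSolution`). The momentum equation is kept
in weak form, with one derivative on the test field, since u need not be C². -/

theorem integral_mul_norm_le {A : V → ℝ} (hA : MemLp A 2) (h : Lp ℂ 2 (volume : Measure V)) :
    ∫ ξ, A ξ * ‖h ξ‖ ≤ ‖hA.toLp A‖ * ‖h‖ := by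
  have hn : MemLp (fun ξ => ‖h ξ‖) 2 (volume : Measure V) := (Lp.memLp h).norm
  have h1 : ⟪hA.toLp A, hn.toLp _⟫_ℝ = ∫ ξ, A ξ * ‖h ξ‖ := by
    rw [L2.inner_def]
    refine integral_congr_ae ?_
    filter_upwards [hA.coeFn_toLp, hn.coeFn_toLp] with ξ h1 h2
    rw [h1, h2]
    simp [mul_comm]
  have h2 : ‖hn.toLp _‖ = ‖h‖ := by
    rw [Lp.norm_toLp, Lp.norm_def, eLpNorm_norm]
  rw [← h1, ← h2]
  exact real_inner_le_norm _ _

theorem memLp_of_norm_bound {A : V → ℝ} (hA : Continuous A) {s : ℝ}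
    (hs : (Module.finrank ℝ V : ℝ) < s) (hb : ∀ ξ, A ξ ^ 2 ≤ (1 + ‖ξ‖ ^ 2) ^ (-s / 2)) :
    MemLp A 2 := by
  rw [memLp_two_iff_integrable_sq hA.aestronglyMeasurable]
  refine (integrable_rpow_neg_one_add_norm_sq (μ := volume) hs).mono'
    (hA.pow 2).aestronglyMeasurable (Filter.Eventually.of_forall fun ξ => ?_)
  rw [Real.norm_of_nonneg (sq_nonneg _)]
  exact hb ξ

/-- The symbol of the Bessel potential of order `-s`. -/
def besselSymbol (s : ℝ) (ξ : V) : ℝ := (1 + ‖ξ‖ ^ 2) ^ (-s / 2)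

theorem besselSymbol_pos (s : ℝ) (ξ : V) : 0 < besselSymbol s ξ := by
  unfold besselSymbol; positivity

theorem continuous_besselSymbol (s : ℝ) : Continuous (besselSymbol s : V → ℝ) := by
  unfold besselSymbol
  refine Continuous.rpow_const (by fun_prop) fun ξ => Or.inl (by positivity)

theorem memLp_besselSymbol {s : ℝ} (hs : (Module.finrank ℝ V : ℝ) < 2 * s) :
    MemLp (besselSymbol s : V → ℝ) 2 := by
  refine memLp_of_norm_bound (continuous_besselSymbol s) hs fun ξ => ?_
  rw [besselSymbol, ← Real.rpow_natCast, ← Real.rpow_mul (by positivity)]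
  apply le_of_eq; congr 1; push_cast; ring

/-- One power of `‖ξ‖` costs one unit of `s`, because `‖ξ‖ ^ 2 ≤ 1 + ‖ξ‖ ^ 2`. This produces the
threshold s > 1 + n/2 for a continuous gradient. -/
theorem memLp_norm_mul_besselSymbol {s : ℝ} (hs : (Module.finrank ℝ V : ℝ) < 2 * (s - 1)) :
    MemLp (fun ξ : V => ‖ξ‖ * besselSymbol s ξ) 2 := by
  refine memLp_of_norm_bound (continuous_norm.mul (continuous_besselSymbol s)) hs fun ξ => ?_
  have h1 : (1 + ‖ξ‖ ^ 2) ^ (-(2 * (s - 1)) / 2) = (1 + ‖ξ‖ ^ 2) * (besselSymbol s ξ) ^ 2 := by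
    have h2 : besselSymbol s ξ ^ 2 = (1 + ‖ξ‖ ^ 2) ^ (-s) := by
      rw [besselSymbol, ← Real.rpow_natCast (_ ^ (-s / 2)), ← Real.rpow_mul (by positivity)]
      congr 1; push_cast; ring
    rw [h2, ← Real.rpow_one_add' (by positivity) (by
      have : (0 : ℝ) ≤ Module.finrank ℝ V := by positivity
      intro h; linarith)]
    congr 1; ring
  rw [h1, mul_pow]
  gcongr
  linarith

theorem besselSymbol_mul_rpow (s : ℝ) (ξ : V) :
    besselSymbol s ξ * (1 + ‖ξ‖ ^ 2) ^ (s / 2) = 1 := by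
  rw [besselSymbol, ← Real.rpow_add (by positivity)]
  simp [neg_div]

/-- The pairing of the frequency variable with the space variable used by `𝓕⁻`. -/
abbrev negInner : V →L[ℝ] V →L[ℝ] ℝ := -innerSL ℝ

theorem norm_negInner_le : ‖(negInner : V →L[ℝ] V →L[ℝ] ℝ)‖ ≤ 1 := by
  exact (norm_neg (innerSL ℝ : V →L[ℝ] V →L[ℝ] ℝ)).trans_le (norm_innerSL_le ℝ)

theorem fourierInv_eq_fourierIntegral (g : V → ℂ) :
    𝓕⁻ g = VectorFourier.fourierIntegral 𝐞 volume (negInner : V →L[ℝ] V →L[ℝ] ℝ).toLinearMap₁₂ g := by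
  rfl

/-- The inverse Fourier transform of an integrable function agrees almost everywhere with its
`L²` inverse Fourier transform. -/
theorem fourierInv_ae_eq (h : Lp ℂ 2 (volume : Measure V)) (hi : Integrable (h : V → ℂ)) :
    (𝓕⁻ h : Lp ℂ 2 (volume : Measure V)) =ᵐ[volume] 𝓕⁻ (h : V → ℂ) := by
  have hc : Continuous (𝓕⁻ (h : V → ℂ)) := by
    rw [fourierInv_eq_fourierIntegral]
    exact VectorFourier.fourierIntegral_continuous Real.continuous_fourierChar
      (by apply (negInner : V →L[ℝ] V →L[ℝ] ℝ).continuous₂) hi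
  have hl : LocallyIntegrable ((𝓕⁻ h : Lp ℂ 2 (volume : Measure V)) : V → ℂ) :=
    (Lp.memLp _).locallyIntegrable (by norm_num)
  rw [← sub_ae_eq_zero]
  -- Both transforms, paired with a test function Φ, equal the pairing of `h` with the inverse
  -- transform of Φ. For the L² transform this is duality of tempered distributions; for the
  -- pointwise one it is Fubini with a symmetric kernel.
  refine ae_eq_zero_of_integral_contDiff_smul_eq_zero (hl.sub hc.locallyIntegrable) ?_
  intro φ hφ hφc
  have hg₁ : HasCompactSupport (Complex.ofRealCLM ∘ φ) := hφc.comp_left rfl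
  have hg₂ : ContDiff ℝ ∞ (Complex.ofRealCLM ∘ φ) := by fun_prop
  set Φ : 𝓢(V, ℂ) := hg₁.toSchwartzMap hg₂ with hΦ
  have e1 : ∫ x, φ x • (𝓕⁻ h : Lp ℂ 2 (volume : Measure V)) x = ∫ ξ, (𝓕⁻ Φ) ξ • h ξ := by
    have := congrArg (fun T : 𝓢'(V, ℂ) => T Φ) (Lp.fourierInv_toTemperedDistribution_eq h)
    simp only [TemperedDistribution.fourierInv_apply, Lp.toTemperedDistribution_apply] at this
    rw [this]; rfl
  have e2 : ∫ x, φ x • (𝓕⁻ (h : V → ℂ)) x = ∫ ξ, (𝓕⁻ Φ) ξ • h ξ := by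
    have := VectorFourier.integral_fourierIntegral_smul_eq_flip (μ := volume) (ν := volume)
      (L := (negInner : V →L[ℝ] V →L[ℝ] ℝ).toLinearMap₁₂) (f := fun x => (φ x : ℂ)) (g := (h : V → ℂ))
      Real.continuous_fourierChar (by apply (negInner : V →L[ℝ] V →L[ℝ] ℝ).continuous₂) Φ.integrable hi
    have hflip : (negInner : V →L[ℝ] V →L[ℝ] ℝ).toLinearMap₁₂.flip
        = (negInner : V →L[ℝ] V →L[ℝ] ℝ).toLinearMap₁₂ := by
      ext x y
      exact congrArg Neg.neg (real_inner_comm x y)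
    rw [hflip] at this
    rw [SchwartzMap.fourierInv_coe]
    exact this.symm
  have i1 : Integrable (fun x => φ x • (𝓕⁻ h : Lp ℂ 2 (volume : Measure V)) x) :=
    hl.integrable_smul_left_of_hasCompactSupport hφ.continuous hφc
  have i2 : Integrable (fun x => φ x • (𝓕⁻ (h : V → ℂ)) x) :=
    (hφ.continuous.smul hc).integrable_of_hasCompactSupport hφc.smul_right
  simp only [Pi.sub_apply, smul_sub]
  rw [integral_sub i1 i2, e1, e2, sub_self]

/-- The `L²` function representing evaluation at `x` of functions in `H^s`. -/
theorem memLp_evalKernel {s : ℝ} (hs : (Module.finrank ℝ V : ℝ) < 2 * s) (x : V) :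
    MemLp (fun ξ : V => 𝐞 (-⟪ξ, x⟫_ℝ) • (besselSymbol s ξ : ℂ)) 2 := by
  refine (memLp_besselSymbol hs).of_le ?_ (Filter.Eventually.of_forall fun ξ => ?_)
  · have : Continuous fun ξ : V => 𝐞 (-⟪ξ, x⟫_ℝ) • (besselSymbol s ξ : ℂ) := by
      have := continuous_besselSymbol (V := V) s
      have h2 : Continuous fun ξ : V => 𝐞 (-⟪ξ, x⟫_ℝ) :=
        Real.continuous_fourierChar.comp (by fun_prop)
      exact h2.smul (Complex.continuous_ofReal.comp this)
    exact this.aestronglyMeasurable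
  · rw [Circle.norm_smul]; simp

/-- Evaluation at `x` of the function in `H^s` whose Bessel potential of order `s` has the given
Fourier transform. -/
def evalCLM {s : ℝ} (hs : (Module.finrank ℝ V : ℝ) < 2 * s) (x : V) :
    Lp ℂ 2 (volume : Measure V) →L[ℝ] ℂ :=
  (innerSL ℂ ((memLp_evalKernel hs x).toLp _)).restrictScalars ℝ

theorem evalCLM_apply {s : ℝ} (hs : (Module.finrank ℝ V : ℝ) < 2 * s) (x : V)
    (h : Lp ℂ 2 (volume : Measure V)) :
    evalCLM hs x h = 𝓕⁻ (fun ξ => (besselSymbol s ξ : ℂ) * h ξ) x := by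
  rw [Real.fourierInv_eq]
  have : evalCLM hs x h = ⟪(memLp_evalKernel hs x).toLp _, h⟫_ℂ := rfl
  rw [this, L2.inner_def]
  refine integral_congr_ae ?_
  filter_upwards [(memLp_evalKernel hs x).coeFn_toLp] with ξ h1
  rw [h1]
  simp only [RCLike.inner_apply, Circle.smul_def, smul_eq_mul, map_mul, Complex.conj_ofReal]
  have : (starRingEnd ℂ) (𝐞 (-⟪ξ, x⟫_ℝ) : ℂ) = (𝐞 ⟪ξ, x⟫_ℝ : ℂ) := by
    rw [← Circle.coe_inv_eq_conj, AddChar.map_neg_eq_inv, inv_inv]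
  rw [this]; ring

/-- Cauchy–Schwarz: the evaluation kernel has modulus `besselSymbol s`, so the bound does not depend
on `x`. -/
theorem norm_evalCLM_apply_le {s : ℝ} (hs : (Module.finrank ℝ V : ℝ) < 2 * s) (x : V)
    (h : Lp ℂ 2 (volume : Measure V)) :
    ‖evalCLM hs x h‖ ≤ ‖(memLp_besselSymbol hs).toLp (besselSymbol s : V → ℝ)‖ * ‖h‖ := by
  refine le_trans ?_ (integral_mul_norm_le _ h)
  rw [evalCLM_apply, fourierInv_eq_fourierIntegral]
  refine (VectorFourier.norm_fourierIntegral_le_integral_norm _ _ _ _ _).trans_eq ?_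
  simp [abs_of_pos (besselSymbol_pos s _)]

/-- The derivative in `x` of `evalCLM hs x h`. -/
def evalDeriv (s : ℝ) (h : Lp ℂ 2 (volume : Measure V)) (x : V) : V →L[ℝ] ℂ :=
  VectorFourier.fourierIntegral 𝐞 volume (negInner : V →L[ℝ] V →L[ℝ] ℝ).toLinearMap₁₂
    (VectorFourier.fourierSMulRight negInner fun ξ => (besselSymbol s ξ : ℂ) * h ξ) x

theorem integrable_mul_Lp {A : V → ℝ} (hA : MemLp A 2) (h : Lp ℂ 2 (volume : Measure V)) :
    Integrable (fun ξ => (A ξ : ℂ) * h ξ) :=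
  hA.ofReal.integrable_mul (Lp.memLp h)

theorem integrable_norm_mul_besselSymbol {s : ℝ} (hs : (Module.finrank ℝ V : ℝ) < 2 * (s - 1))
    (h : Lp ℂ 2 (volume : Measure V)) :
    Integrable (fun ξ => ‖ξ‖ * ‖(besselSymbol s ξ : ℂ) * h ξ‖) := by
  refine (integrable_mul_Lp (memLp_norm_mul_besselSymbol hs) h).norm.congr
    (Filter.Eventually.of_forall fun ξ => ?_)
  simp [mul_assoc]

theorem finrank_lt_of_lt_sub_one {s : ℝ} (hs : (Module.finrank ℝ V : ℝ) < 2 * (s - 1)) :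
    (Module.finrank ℝ V : ℝ) < 2 * s := by linarith

/-- Differentiation under the Fourier integral; the threshold on `s` makes the integrand times `‖ξ‖`
integrable. -/
theorem hasFDerivAt_evalCLM {s : ℝ} (hs : (Module.finrank ℝ V : ℝ) < 2 * (s - 1))
    (h : Lp ℂ 2 (volume : Measure V)) (x : V) :
    HasFDerivAt (fun y => evalCLM (finrank_lt_of_lt_sub_one hs) y h) (evalDeriv s h x) x := by
  simp_rw [evalCLM_apply, fourierInv_eq_fourierIntegral]
  exact VectorFourier.hasFDerivAt_fourierIntegral negInner
    (integrable_mul_Lp (memLp_besselSymbol (finrank_lt_of_lt_sub_one hs)) h)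
    (integrable_norm_mul_besselSymbol hs h) x

theorem integrable_fourierSMulRight {s : ℝ} (hs : (Module.finrank ℝ V : ℝ) < 2 * (s - 1))
    (h : Lp ℂ 2 (volume : Measure V)) :
    Integrable (VectorFourier.fourierSMulRight (negInner : V →L[ℝ] V →L[ℝ] ℝ)
      fun ξ => (besselSymbol s ξ : ℂ) * h ξ) := by
  refine ((integrable_norm_mul_besselSymbol hs h).const_mul
    (2 * Real.pi * ‖(negInner : V →L[ℝ] V →L[ℝ] ℝ)‖)).mono'
    (AEStronglyMeasurable.fourierSMulRight
      (integrable_mul_Lp (memLp_besselSymbol (finrank_lt_of_lt_sub_one hs)) h).1)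
    (Filter.Eventually.of_forall fun ξ => ?_)
  refine (VectorFourier.norm_fourierSMulRight_le _ _ _).trans_eq (by ring)

theorem norm_evalDeriv_le {s : ℝ} (hs : (Module.finrank ℝ V : ℝ) < 2 * (s - 1))
    (h : Lp ℂ 2 (volume : Measure V)) (x : V) :
    ‖evalDeriv s h x‖ ≤ 2 * Real.pi * ‖(memLp_norm_mul_besselSymbol hs).toLp
      (fun ξ : V => ‖ξ‖ * besselSymbol s ξ)‖ * ‖h‖ := by
  refine (VectorFourier.norm_fourierIntegral_le_integral_norm _ _ _ _ _).trans ?_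
  rw [mul_assoc]
  refine le_trans ?_ (mul_le_mul_of_nonneg_left
    (integral_mul_norm_le (memLp_norm_mul_besselSymbol hs) h) Real.two_pi_pos.le)
  rw [← integral_const_mul]
  have hi := (integrable_norm_mul_besselSymbol hs h).const_mul (2 * Real.pi)
  simp only [norm_mul, Complex.norm_real, Real.norm_of_nonneg (besselSymbol_pos s _).le,
    ← mul_assoc] at hi
  refine integral_mono (integrable_fourierSMulRight hs h).norm (by simpa only [mul_assoc] using hi)
    fun ξ => ?_
  refine (VectorFourier.norm_fourierSMulRight_le _ _ _).trans ?_
  rw [norm_mul, Complex.norm_real, Real.norm_of_nonneg (besselSymbol_pos s _).le]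
  have := norm_negInner_le (V := V)
  have h0 : 0 ≤ ‖ξ‖ * (besselSymbol s ξ * ‖h ξ‖) := by
    have := (besselSymbol_pos s ξ).le; positivity
  nlinarith [Real.two_pi_pos, mul_nonneg (mul_nonneg Real.two_pi_pos.le (sub_nonneg.2 this)) h0]

theorem continuous_evalDeriv {s : ℝ} (hs : (Module.finrank ℝ V : ℝ) < 2 * (s - 1))
    (h : Lp ℂ 2 (volume : Measure V)) : Continuous (evalDeriv s h) :=
  VectorFourier.fourierIntegral_continuous Real.continuous_fourierChar
    (by apply (negInner : V →L[ℝ] V →L[ℝ] ℝ).continuous₂) (integrable_fourierSMulRight hs h)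

/-- A function of two variables that is linear in the first and differentiable in the second one,
with a locally uniformly bounded derivative, is jointly continuously differentiable. -/
theorem contDiff_uncurry_of_linear {X W F : Type*} [NormedAddCommGroup X] [NormedSpace ℝ X]
    [NormedAddCommGroup W] [NormedSpace ℝ W] [NormedAddCommGroup F] [NormedSpace ℝ F]
    {Λ : W → X →L[ℝ] F} {D : X → W → W →L[ℝ] F} {C : ℝ}
    (hD : ∀ h x, HasFDerivAt (fun y => Λ y h) (D h x) x) (hb : ∀ h x, ‖D h x‖ ≤ C * ‖h‖)
    (hc : ∀ h, Continuous (D h)) : ContDiff ℝ 1 (fun p : X × W => Λ p.2 p.1) := by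
  have hsub : ∀ h h' x, D (h - h') x = D h x - D h' x := fun h h' x =>
    (hD (h - h') x).unique (by simpa only [map_sub] using (hD h x).fun_sub (hD h' x))
  have hC : ∀ h x, ‖D h x‖ ≤ |C| * ‖h‖ := fun h x => (hb h x).trans
    (mul_le_mul_of_nonneg_right (le_abs_self C) (norm_nonneg h))
  -- By the mean value inequality the bound on `D` makes `Λ` Lipschitz in operator norm, which is
  -- stronger than continuity for each fixed `h`.
  have hΛ : Continuous Λ := by
    have : LipschitzWith (Real.nnabs C) Λ := by
      refine LipschitzWith.of_dist_le_mul fun x y => ?_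
      rw [dist_eq_norm, dist_eq_norm, Real.coe_nnabs]
      refine ContinuousLinearMap.opNorm_le_bound _ (by positivity) fun h => ?_
      have := convex_univ.norm_image_sub_le_of_norm_hasFDerivWithin_le (𝕜 := ℝ)
        (fun z _ => (hD h z).hasFDerivWithinAt) (fun z _ => hC h z) (mem_univ y) (mem_univ x)
      rw [sub_apply]
      linarith
    exact this.continuous
  -- `D` is linear in `h`, so it is Lipschitz in `h` uniformly in `x`; with continuity in `x` this
  -- gives joint continuity.
  have hDc : Continuous (fun p : X × W => D p.1 p.2) := by
    refine continuous_prod_of_continuous_lipschitzWith _ (Real.nnabs C) hc fun x => ?_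
    refine LipschitzWith.of_dist_le_mul fun h h' => ?_
    rw [dist_eq_norm, dist_eq_norm, Real.coe_nnabs, ← hsub]
    exact hC _ _
  rw [contDiff_one_iff_hasFDerivAt]
  refine ⟨fun p => (Λ p.2).coprod (D p.1 p.2), ?_, fun p => ?_⟩
  · exact (hΛ.comp continuous_snd).continuousLinearMapCoprod hDc
  · exact (hasStrictFDerivAt_uncurry_coprod (f := fun h x => Λ x h) (f₁ := fun _ x => Λ x)
      (f₂ := fun h x => D h x) (Filter.Eventually.of_forall fun v => (Λ v.2).hasFDerivAt)
      (Filter.Eventually.of_forall fun v => hD v.1 v.2) (hΛ.comp continuous_snd).continuousAt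
      hDc.continuousAt).hasFDerivAt

end Sobolev

/-! ### Extension of C¹ curves beyond a compact time interval -/

section Extension

variable {X : Type*} [NormedAddCommGroup X] [NormedSpace ℝ X] [CompleteSpace X]

/-- A `C¹` curve on a compact interval extends to a `C¹` curve on the line. -/
theorem exists_contDiff_extension {T : ℝ} (hT : 0 < T) {G : ℝ → X}
    (hG : ContDiffOn ℝ 1 G (Icc 0 T)) :
    ∃ H : ℝ → X, ContDiff ℝ 1 H ∧ ∀ t ∈ Icc 0 T, H t = G t := by
  -- The derivative is frozen at its end-point values outside [0,T]; the extension is its primitive.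
  set g : ℝ → X := fun s => derivWithin G (Icc 0 T) (projIcc 0 T hT.le s) with hg
  have hud := uniqueDiffOn_Icc hT
  have hgc : Continuous g := by
    have h1 : ContinuousOn (derivWithin G (Icc 0 T)) (Icc 0 T) :=
      hG.continuousOn_derivWithin hud le_rfl
    exact (continuousOn_iff_continuous_domRestrict.1 h1).comp continuous_projIcc
  refine ⟨fun t => G 0 + ∫ s in (0 : ℝ)..t, g s, ?_, fun t ht => ?_⟩
  · refine contDiff_const.add (contDiff_one_iff_deriv.2 ⟨fun t => ?_, ?_⟩)
    · exact (intervalIntegral.integral_hasDerivAt_right (hgc.intervalIntegrable _ _)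
        (hgc.stronglyMeasurableAtFilter _ _) hgc.continuousAt).differentiableAt
    · have : deriv (fun t => ∫ s in (0 : ℝ)..t, g s) = g := funext fun t =>
        hgc.deriv_integral _ _ _
      rw [this]; exact hgc
  · have h1 : ∫ s in (0 : ℝ)..t, g s = G t - G 0 := by
      refine intervalIntegral.integral_eq_sub_of_hasDerivAt_of_le ht.1
        (hG.continuousOn.mono (Icc_subset_Icc_right ht.2)) (fun s hs => ?_)
        (hgc.intervalIntegrable _ _)
      have hs' : s ∈ Ioo 0 T := ⟨hs.1, hs.2.trans_le ht.2⟩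
      have hd := ((hG.differentiableOn one_ne_zero) s (Ioo_subset_Icc_self hs')).hasDerivWithinAt
      have : g s = derivWithin G (Icc 0 T) s := by
        simp [hg, projIcc_of_mem hT.le (Ioo_subset_Icc_self hs')]
      rw [this]
      exact hd.hasDerivAt (Icc_mem_nhds hs'.1 hs'.2)
    simp [h1]

end Extension

/-! ### Square integrability and the jointly C¹ representative -/

section Sobolev

open scoped FourierTransform InnerProductSpace ENNReal

variable {V : Type*} [NormedAddCommGroup V] [InnerProductSpace ℝ V] [FiniteDimensional ℝ V]
  [MeasurableSpace V] [BorelSpace V]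

theorem memLp_fourierInv {g : V → ℂ} (hg : Integrable g) (hg2 : MemLp g 2) :
    MemLp (𝓕⁻ g) 2 := by
  have hae := hg2.coeFn_toLp
  have h1 := fourierInv_ae_eq (hg2.toLp g) (hg.congr hae.symm)
  have h2 : 𝓕⁻ (hg2.toLp g : V → ℂ) = 𝓕⁻ g := funext fun x => Real.fourierInv_congr_ae hae x
  rw [h2] at h1
  exact (memLp_congr_ae h1).1 (Lp.memLp _)

theorem memLp_of_bounded_mul {A : V → ℂ} (hA : Continuous A) {C : ℝ} (hb : ∀ ξ, ‖A ξ‖ ≤ C)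
    (h : Lp ℂ 2 (volume : Measure V)) : MemLp (fun ξ => A ξ * h ξ) 2 := by
  refine (Lp.memLp h).of_le_mul (c := C) (hA.aestronglyMeasurable.mul (Lp.memLp h).1)
    (Filter.Eventually.of_forall fun ξ => ?_)
  rw [norm_mul]
  exact mul_le_mul_of_nonneg_right (hb ξ) (norm_nonneg _)

theorem besselSymbol_le_one {s : ℝ} (hs : 0 ≤ s) (ξ : V) : besselSymbol s ξ ≤ 1 := by
  refine Real.rpow_le_one_of_one_le_of_nonpos ?_ (by linarith)
  nlinarith [sq_nonneg ‖ξ‖]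

theorem norm_mul_besselSymbol_le_one {s : ℝ} (hs : 1 ≤ s) (ξ : V) :
    ‖ξ‖ * besselSymbol s ξ ≤ 1 := by
  have h1 : besselSymbol s ξ ≤ besselSymbol 1 ξ :=
    Real.rpow_le_rpow_of_exponent_le (by nlinarith [sq_nonneg ‖ξ‖]) (by linarith)
  have h2 : besselSymbol 1 ξ = (Real.sqrt (1 + ‖ξ‖ ^ 2))⁻¹ := by
    rw [besselSymbol, Real.sqrt_eq_rpow, ← Real.rpow_neg (by positivity)]; norm_num
  have h3 : ‖ξ‖ ≤ Real.sqrt (1 + ‖ξ‖ ^ 2) := Real.le_sqrt_of_sq_le (by linarith)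
  calc ‖ξ‖ * besselSymbol s ξ ≤ Real.sqrt (1 + ‖ξ‖ ^ 2) * (Real.sqrt (1 + ‖ξ‖ ^ 2))⁻¹ := by
        rw [← h2]
        exact mul_le_mul h3 h1 (besselSymbol_pos s ξ).le (Real.sqrt_nonneg _)
    _ = 1 := mul_inv_cancel₀ (by positivity)

theorem memLp_evalCLM {s : ℝ} (hs : (Module.finrank ℝ V : ℝ) < 2 * s)
    (h : Lp ℂ 2 (volume : Measure V)) : MemLp (fun x => evalCLM hs x h) 2 := by
  have hs0 : (0 : ℝ) ≤ Module.finrank ℝ V := by positivity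
  simp_rw [evalCLM_apply]
  refine memLp_fourierInv (integrable_mul_Lp (memLp_besselSymbol hs) h)
    (memLp_of_bounded_mul (C := 1) (Complex.continuous_ofReal.comp (continuous_besselSymbol s))
      (fun ξ => ?_) h)
  simpa [abs_of_pos (besselSymbol_pos s ξ)] using besselSymbol_le_one (by linarith) ξ

/-- A directional derivative is the inverse transform of `h` times 2πi⟪ξ,v⟫(1+|ξ|²)^{-s/2}. This
multiplier is bounded when s ≥ 1, so Plancherel applies. -/
theorem memLp_evalDeriv_apply {s : ℝ} (hs : (Module.finrank ℝ V : ℝ) < 2 * (s - 1))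
    (h : Lp ℂ 2 (volume : Measure V)) (v : V) : MemLp (fun x => evalDeriv s h x v) 2 := by
  have hs0 : (0 : ℝ) ≤ Module.finrank ℝ V := by positivity
  have hi := integrable_fourierSMulRight hs h
  have h1 : (fun x => evalDeriv s h x v) =
      𝓕⁻ (fun ξ => VectorFourier.fourierSMulRight (negInner : V →L[ℝ] V →L[ℝ] ℝ)
        (fun ξ => (besselSymbol s ξ : ℂ) * h ξ) ξ v) := by
    ext x
    rw [fourierInv_eq_fourierIntegral]
    exact (Real.fourierIntegral_continuousLinearMap_apply' (F := V) (L := negInner) (a := v) hi)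
  rw [h1]
  refine memLp_fourierInv (hi.apply_continuousLinearMap v) ?_
  have h2 : (fun ξ => VectorFourier.fourierSMulRight (negInner : V →L[ℝ] V →L[ℝ] ℝ)
        (fun ξ => (besselSymbol s ξ : ℂ) * h ξ) ξ v) =
      fun ξ => (2 * Real.pi * Complex.I * (⟪ξ, v⟫_ℝ : ℂ) * (besselSymbol s ξ : ℂ)) * h ξ := by
    ext ξ
    rw [VectorFourier.fourierSMulRight_apply]
    rw [show negInner ξ v = -⟪ξ, v⟫_ℝ from rfl]
    simp
    ring
  rw [h2]
  refine memLp_of_bounded_mul (C := 2 * Real.pi * ‖v‖) ?_ (fun ξ => ?_) h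
  · have := Complex.continuous_ofReal.comp (continuous_besselSymbol (V := V) s)
    have h3 : Continuous fun ξ : V => (⟪ξ, v⟫_ℝ : ℂ) :=
      Complex.continuous_ofReal.comp (by fun_prop)
    exact (continuous_const.mul h3).mul this
  · have h4 : ‖(2 * Real.pi * Complex.I * (⟪ξ, v⟫_ℝ : ℂ) * (besselSymbol s ξ : ℂ))‖
        = 2 * Real.pi * (|⟪ξ, v⟫_ℝ| * besselSymbol s ξ) := by
      simp [abs_of_pos (besselSymbol_pos s ξ), abs_of_pos Real.pi_pos]
      ring
    rw [h4]
    have h5 := abs_real_inner_le_norm ξ v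
    have h6 := norm_mul_besselSymbol_le_one (s := s) (by linarith) ξ
    have h7 := besselSymbol_pos s ξ
    have : |⟪ξ, v⟫_ℝ| * besselSymbol s ξ ≤ ‖v‖ :=
      calc |⟪ξ, v⟫_ℝ| * besselSymbol s ξ ≤ (‖ξ‖ * ‖v‖) * besselSymbol s ξ := by gcongr
        _ = ‖v‖ * (‖ξ‖ * besselSymbol s ξ) := by ring
        _ ≤ ‖v‖ * 1 := by gcongr
        _ = ‖v‖ := mul_one _
    have := Real.two_pi_pos
    nlinarith

/-- A field of linear maps is in `L²` if all its components are. -/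
theorem memLp_clm_of_apply {F : Type*} [NormedAddCommGroup F] [NormedSpace ℝ F]
    {A : V → V →L[ℝ] F} (hA : Continuous A) (h : ∀ v, MemLp (fun x => A x v) 2) : MemLp A 2 := by
  let b := stdOrthonormalBasis ℝ V
  have hs : MemLp (fun x => ∑ i, ‖A x (b i)‖) 2 := memLp_finsetSum _ fun i _ => (h (b i)).norm
  refine hs.of_le hA.aestronglyMeasurable (Filter.Eventually.of_forall fun x => ?_)
  rw [Real.norm_of_nonneg (by positivity)]
  refine ContinuousLinearMap.opNorm_le_bound _ (by positivity) fun v => ?_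
  calc ‖A x v‖ = ‖∑ i, ⟪b i, v⟫_ℝ • A x (b i)‖ := by
        conv_lhs => rw [← b.sum_repr' v]
        simp
    _ ≤ ∑ i, ‖⟪b i, v⟫_ℝ • A x (b i)‖ := norm_sum_le _ _
    _ ≤ ∑ i, ‖A x (b i)‖ * ‖v‖ := by
        refine Finset.sum_le_sum fun i _ => ?_
        rw [norm_smul, mul_comm]
        gcongr
        refine (norm_inner_le_norm _ _).trans ?_
        simp
    _ = _ := by rw [Finset.sum_mul]

open TemperedDistribution in
/-- The representation formula for functions in `H^s`. -/
theorem ae_eq_evalCLM_of_besselPotential_eq {s : ℝ} (hs : (Module.finrank ℝ V : ℝ) < 2 * s)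
    {f G : Lp ℂ 2 (volume : Measure V)}
    (h : besselPotential V ℂ s (f : 𝓢'(V, ℂ)) = (G : 𝓢'(V, ℂ))) :
    (f : V → ℂ) =ᵐ[volume] fun x => evalCLM hs x (𝓕 G) := by
  have hs0 : (0 : ℝ) ≤ Module.finrank ℝ V := by positivity
  have hk : MemLp (fun ξ : V => (besselSymbol s ξ : ℂ)) ∞ :=
    memLp_top_of_bound (Complex.continuous_ofReal.comp
      (continuous_besselSymbol s)).aestronglyMeasurable 1 (Filter.Eventually.of_forall fun ξ => by
        simpa [abs_of_pos (besselSymbol_pos s ξ)] using besselSymbol_le_one (by linarith) ξ)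
  have hkt : (fun ξ : V => (besselSymbol s ξ : ℂ)).HasTemperateGrowth := by
    unfold besselSymbol; fun_prop
  -- On the Fourier side the hypothesis says that 𝓕G is (1+|ξ|²)^{s/2} 𝓕f. Multiplying by the
  -- reciprocal symbol inverts this among tempered distributions, and L² embeds injectively there.
  have h1 : 𝓕 f = (hk.toLp _ • 𝓕 G : Lp ℂ 2 (volume : Measure V)) := by
    have hinj := LinearMap.ker_eq_bot.1 (Lp.ker_toTemperedDistributionCLM_eq_bot
      (F := ℂ) (μ := (volume : Measure V)) (p := 2))
    apply hinj
    change ((𝓕 f : Lp ℂ 2 (volume : Measure V)) : 𝓢'(V, ℂ)) =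
      ((hk.toLp _ • 𝓕 G : Lp ℂ 2 (volume : Measure V)) : 𝓢'(V, ℂ))
    rw [Lp.toTemperedDistribution_smul_eq hkt hk, ← Lp.fourier_toTemperedDistribution_eq,
      ← Lp.fourier_toTemperedDistribution_eq, ← h,
      fourier_besselPotential_eq_smulLeftCLM_fourier_apply,
      smulLeftCLM_smulLeftCLM_apply (by fun_prop) hkt]
    have : (fun ξ : V => (((1 + ‖ξ‖ ^ 2) ^ (s / 2) : ℝ) : ℂ)) * (fun ξ => (besselSymbol s ξ : ℂ))
        = fun _ => 1 := by
      ext ξ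
      rw [Pi.mul_apply, ← Complex.ofReal_mul, mul_comm, besselSymbol_mul_rpow]
      simp
    rw [this]
    simp
  have h2 : (𝓕 f : Lp ℂ 2 (volume : Measure V)) =ᵐ[volume]
      fun ξ => (besselSymbol s ξ : ℂ) * (𝓕 G : Lp ℂ 2 (volume : Measure V)) ξ := by
    rw [h1]
    filter_upwards [Lp.coeFn_lpSMul (r := 2) (hk.toLp _) (𝓕 G), hk.coeFn_toLp] with ξ e1 e2
    rw [e1]
    simp [e2]
  have h3 := fourierInv_ae_eq (𝓕 f)
    ((integrable_mul_Lp (memLp_besselSymbol hs) (𝓕 G)).congr h2.symm)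
  rw [FourierTransform.fourierInv_fourier_eq] at h3
  filter_upwards [h3] with x hx
  rw [hx, evalCLM_apply]
  exact Real.fourierInv_congr_ae h2 x

theorem contDiff_evalCLM {s : ℝ} (hs : (Module.finrank ℝ V : ℝ) < 2 * (s - 1)) :
    ContDiff ℝ 1 (fun p : Lp ℂ 2 (volume : Measure V) × V =>
      evalCLM (finrank_lt_of_lt_sub_one hs) p.2 p.1) :=
  contDiff_uncurry_of_linear (Λ := fun x => evalCLM (finrank_lt_of_lt_sub_one hs) x)
    (D := evalDeriv s) (hasFDerivAt_evalCLM hs) (norm_evalDeriv_le hs) (continuous_evalDeriv hs)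

theorem contDiff_re_evalCLM_comp {s : ℝ} (hs : (Module.finrank ℝ V : ℝ) < 2 * (s - 1))
    {H : ℝ → Lp ℂ 2 (volume : Measure V)} (hH : ContDiff ℝ 1 H) :
    ContDiff ℝ 1 (fun p : ℝ × V => (evalCLM (finrank_lt_of_lt_sub_one hs) p.2 (H p.1)).re) := by
  have h1 : ContDiff ℝ 1 (fun p : ℝ × V => (H p.1, p.2)) :=
    (hH.comp contDiff_fst).prodMk contDiff_snd
  have h2 := (contDiff_evalCLM hs).comp h1
  exact Complex.reCLM.contDiff.comp h2

end Sobolev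

open scoped FourierTransform in
/-- Functions in `C¹([0,T], H^s(ℝⁿ))`, `s > 1 + n/2`, have jointly `C¹` representatives. -/
theorem IsC1Sobolev.exists_contDiff {n : ℕ} {s T : ℝ} (hs : (n : ℝ) < 2 * (s - 1)) (hT : 0 < T)
    {f : ℝ → Space n → ℝ} (hf : IsC1Sobolev s T f) :
    ∃ g : ℝ → Space n → ℝ, ContDiff ℝ 1 (fun p : ℝ × Space n => g p.1 p.2) ∧
      (∃ C, ∀ t ∈ Icc 0 T, ∀ x, ‖g t x‖ ≤ C ∧ ‖fderiv ℝ (g t) x‖ ≤ C) ∧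
      ∀ t ∈ Icc 0 T, g t =ᵐ[volume] f t ∧ MemLp (g t) 2 ∧ MemLp (fderiv ℝ (g t)) 2 := by
  obtain ⟨G, hG, hfG⟩ := hf
  obtain ⟨H, hH, hHG⟩ := exists_contDiff_extension hT hG
  have hs1 : (Module.finrank ℝ (Space n) : ℝ) < 2 * (s - 1) := by simpa using hs
  have hs2 := finrank_lt_of_lt_sub_one hs1
  -- The Fourier transform is a continuous linear map on L², so the frequency-side curve is still C¹
  -- in time.
  obtain ⟨𝓗, h𝓗, h𝓗H⟩ : ∃ 𝓗 : ℝ → Lp ℂ 2 (volume : Measure (Space n)),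
      ContDiff ℝ 1 𝓗 ∧ ∀ t, 𝓗 t = 𝓕 (H t) :=
    ⟨_, ((Lp.fourierTransformₗᵢ (Space n)
      ℂ).toContinuousLinearEquiv.toContinuousLinearMap.restrictScalars ℝ).contDiff.comp hH,
      fun t => rfl⟩
  have hd : ∀ t x, HasFDerivAt (fun x => (evalCLM hs2 x (𝓗 t)).re)
      (Complex.reCLM ∘L evalDeriv s (𝓗 t) x) x := fun t x =>
    Complex.reCLM.hasFDerivAt.comp x (hasFDerivAt_evalCLM hs1 (𝓗 t) x)
  obtain ⟨B, hB⟩ := (isCompact_Icc (a := (0 : ℝ)) (b := T)).exists_bound_of_continuousOn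
    h𝓗.continuous.continuousOn
  have hfd : ∀ t, fderiv ℝ (fun x => (evalCLM hs2 x (𝓗 t)).re) =
      fun x => Complex.reCLM ∘L evalDeriv s (𝓗 t) x := fun t => funext fun x => (hd t x).fderiv
  obtain ⟨c1, hc1', hc1⟩ : ∃ c : ℝ, 0 ≤ c ∧ ∀ h x, ‖evalCLM hs2 x h‖ ≤ c * ‖h‖ :=
    ⟨_, norm_nonneg _, fun h x => norm_evalCLM_apply_le hs2 x h⟩
  obtain ⟨c2, hc2', hc2⟩ : ∃ c : ℝ, 0 ≤ c ∧ ∀ h (x : Space n), ‖evalDeriv s h x‖ ≤ c * ‖h‖ :=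
    ⟨_, mul_nonneg Real.two_pi_pos.le (norm_nonneg _), norm_evalDeriv_le hs1⟩
  refine ⟨fun t x => (evalCLM hs2 x (𝓗 t)).re, ?_, ?_, fun t ht => ⟨?_, ?_, ?_⟩⟩
  · exact contDiff_re_evalCLM_comp hs1 h𝓗
  · refine ⟨max (c1 * B) (c2 * B), fun t ht x => ⟨?_, ?_⟩⟩
    · refine le_trans ?_ (le_max_left _ _)
      exact (Complex.abs_re_le_norm _).trans ((hc1 _ x).trans
        (mul_le_mul_of_nonneg_left (hB t ht) hc1'))
    · refine le_trans ?_ (le_max_right _ _)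
      rw [hfd]
      refine (ContinuousLinearMap.opNorm_comp_le _ _).trans ?_
      rw [Complex.reCLM_norm, one_mul]
      exact (hc2 _ x).trans (mul_le_mul_of_nonneg_left (hB t ht) hc2')
  · obtain ⟨hm, he⟩ := hfG t ht
    rw [← hHG t ht] at he
    filter_upwards [ae_eq_evalCLM_of_besselPotential_eq hs2 he, hm.coeFn_toLp] with x h1 h2
    have : (f t x : ℂ) = evalCLM hs2 x (𝓗 t) := by
      rw [← h2, h1, h𝓗H]
    rw [← this, Complex.ofReal_re]
  · exact (memLp_evalCLM hs2 _).re
  · rw [hfd]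
    refine memLp_clm_of_apply
      (continuous_const.clm_comp (continuous_evalDeriv hs1 _)) fun v => ?_
    exact (memLp_evalDeriv_apply hs1 (𝓗 t) v).re

/-! ### Differentiation under the integral, and enlarging the class of test functions -/

section Analysis

open Filter Topology

variable {V : Type*} [NormedAddCommGroup V] [InnerProductSpace ℝ V] [FiniteDimensional ℝ V]
  [MeasurableSpace V] [BorelSpace V]

/-- Differentiation of an integral over a compact set with respect to a parameter. -/
theorem hasDerivAt_setIntegral_of_contDiff {F : ℝ → V → ℝ}
    (hF : ContDiff ℝ 1 (fun p : ℝ × V => F p.1 p.2)) {K : Set V} (hK : IsCompact K) (t : ℝ) :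
    HasDerivAt (fun s => ∫ x in K, F s x) (∫ x in K, deriv (fun s => F s x) t) t := by
  have hd : ∀ s x, HasDerivAt (fun s => F s x)
      (fderiv ℝ (fun p : ℝ × V => F p.1 p.2) (s, x) (1, 0)) s := fun s x => by
    have h1 := ((hF.differentiable one_ne_zero) (s, x)).hasFDerivAt
    have h2 : HasDerivAt (fun s : ℝ => (s, x)) ((1 : ℝ), (0 : V)) s :=
      (hasDerivAt_id s).prodMk (hasDerivAt_const s x)
    exact h1.comp_hasDerivAt s h2
  have hc : Continuous fun p : ℝ × V => fderiv ℝ (fun p : ℝ × V => F p.1 p.2) p (1, 0) :=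
    (hF.continuous_fderiv one_ne_zero).clm_apply continuous_const
  obtain ⟨C, hC⟩ := ((isCompact_Icc (a := t - 1) (b := t + 1)).prod hK).exists_bound_of_continuousOn
    hc.continuousOn
  have hcx : ∀ s, Continuous (F s) := fun s => hF.continuous.comp (Continuous.prodMk_right s)
  have := (hasDerivAt_integral_of_dominated_loc_of_deriv_le (μ := volume.restrict K)
    (F := F) (F' := fun s x => fderiv ℝ (fun p : ℝ × V => F p.1 p.2) (s, x) (1, 0))
    (x₀ := t) (s := Icc (t - 1) (t + 1)) (bound := fun _ => C)
    (Icc_mem_nhds (by linarith) (by linarith))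
    (Eventually.of_forall fun s => (hcx s).aestronglyMeasurable)
    ((hcx t).continuousOn.integrableOn_compact hK)
    (hc.comp (Continuous.prodMk_right t)).aestronglyMeasurable
    ((ae_restrict_iff' hK.measurableSet).2 (Eventually.of_forall fun x hx s hs =>
      hC (s, x) ⟨hs, hx⟩))
    (continuousOn_const.integrableOn_compact hK)
    (Eventually.of_forall fun x s _ => hd s x)).2
  exact this.congr_deriv
    (integral_congr_ae (Eventually.of_forall fun x => (hd t x).deriv.symm))

theorem integral_mul_fderiv_eq_neg {f g : V → ℝ} (hf : ContDiff ℝ 1 f) (hg : ContDiff ℝ 1 g)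
    (hgc : HasCompactSupport g) (v : V) :
    ∫ x, f x * fderiv ℝ g x v = -∫ x, fderiv ℝ f x v * g x := by
  have hf' : Continuous fun x => fderiv ℝ f x v :=
    (hf.continuous_fderiv one_ne_zero).clm_apply continuous_const
  have hg' : Continuous fun x => fderiv ℝ g x v :=
    (hg.continuous_fderiv one_ne_zero).clm_apply continuous_const
  have hgc' : HasCompactSupport fun x => fderiv ℝ g x v := hgc.fderiv_apply ℝ v
  exact integral_mul_fderiv_eq_neg_fderiv_mul_of_integrable
    ((hf'.mul hg.continuous).integrable_of_hasCompactSupport hgc.mul_left)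
    ((hf.continuous.mul hg').integrable_of_hasCompactSupport hgc'.mul_left)
    ((hf.continuous.mul hg.continuous).integrable_of_hasCompactSupport hgc.mul_left)
    (fun x _ => hf.differentiable one_ne_zero x) (fun x _ => hg.differentiable one_ne_zero x)

variable {F : Type*} [NormedAddCommGroup F] [NormedSpace ℝ F] [CompleteSpace F]

/-- Mollification in `C¹`. -/
theorem exists_smooth_approx {φ : V → F} (hφ : ContDiff ℝ 1 φ) (hc : HasCompactSupport φ)
    {ε : ℝ} (hε : 0 < ε) :
    ∃ ψ : V → F, ContDiff ℝ ∞ ψ ∧ HasCompactSupport ψ ∧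
      Function.support ψ ⊆ Metric.cthickening 1 (tsupport φ) ∧
      (∀ x, ‖ψ x - φ x‖ ≤ ε) ∧ ∀ x, ‖fderiv ℝ ψ x - fderiv ℝ φ x‖ ≤ ε := by
  have hφ' := hφ.continuous_fderiv one_ne_zero
  have hu := hc.uniformContinuous_of_continuous hφ.continuous
  have hu' := (hc.fderiv ℝ).uniformContinuous_of_continuous hφ'
  obtain ⟨δ₁, hδ₁, h₁⟩ := Metric.uniformContinuous_iff.1 hu ε hε
  obtain ⟨δ₂, hδ₂, h₂⟩ := Metric.uniformContinuous_iff.1 hu' ε hε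
  -- Below the moduli of uniform continuity of φ and of its derivative; the cap 1 keeps the support
  -- in the thickening of radius 1.
  set δ := min 1 (min δ₁ δ₂)
  have hδ : 0 < δ := lt_min one_pos (lt_min hδ₁ hδ₂)
  let b : ContDiffBump (0 : V) := ⟨δ / 2, δ, by positivity, by linarith⟩
  let η : V → ℝ := b.normed volume
  have hηs : ContDiff ℝ ∞ η := b.contDiff_normed
  have hηc : HasCompactSupport η := b.hasCompactSupport_normed
  have hsub : Function.support (convolution η φ (ContinuousLinearMap.lsmul ℝ ℝ) volume) ⊆
      Metric.cthickening 1 (tsupport φ) := by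
    refine (support_convolution_subset _).trans ?_
    rintro x ⟨y, hy, z, hz, rfl⟩
    have hy' : y ∈ Metric.ball (0 : V) δ := by
      rw [← b.support_normed_eq (μ := volume)]; exact hy
    refine Metric.mem_cthickening_of_dist_le _ z 1 _ (subset_tsupport _ hz) ?_
    rw [mem_ball_zero_iff] at hy'
    simpa [dist_eq_norm] using hy'.le.trans (min_le_left _ _)
  refine ⟨convolution η φ (ContinuousLinearMap.lsmul ℝ ℝ) volume, ?_, ?_, hsub, ?_, ?_⟩
  · exact hηc.contDiff_convolution_left _ hηs hφ.continuous.locallyIntegrable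
  · exact HasCompactSupport.convolution _ hηc hc
  · intro x
    rw [← dist_eq_norm]
    refine b.dist_normed_convolution_le hφ.continuous.aestronglyMeasurable fun y hy => ?_
    exact (h₁ (lt_of_lt_of_le (Metric.mem_ball.1 hy)
      ((min_le_right _ _).trans (min_le_left _ _)))).le
  · intro x
    have hd := hc.hasFDerivAt_convolution_right (ContinuousLinearMap.lsmul ℝ ℝ : ℝ →L[ℝ] F →L[ℝ] F)
      (hηs.continuous.locallyIntegrable (μ := volume)) hφ x
    have he : convolution η (fderiv ℝ φ)
        ((ContinuousLinearMap.lsmul ℝ ℝ : ℝ →L[ℝ] F →L[ℝ] F).precompR V) volume x =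
        convolution η (fderiv ℝ φ) (ContinuousLinearMap.lsmul ℝ ℝ) volume x := by
      refine integral_congr_ae (Eventually.of_forall fun y => ?_)
      ext v
      simp [ContinuousLinearMap.precompR_apply]
    rw [hd.fderiv, he, ← dist_eq_norm]
    refine b.dist_normed_convolution_le hφ'.aestronglyMeasurable fun y hy => ?_
    exact (h₂ (lt_of_lt_of_le (Metric.mem_ball.1 hy)
      ((min_le_right _ _).trans (min_le_right _ _)))).le

/-- A linear first order functional that vanishes on smooth test functions vanishes on `C¹`
functions with compact support. -/
theorem integral_weak_form_of_contDiff {K₀ : V → F →L[ℝ] ℝ} {K₁ : V → (V →L[ℝ] F) →L[ℝ] ℝ}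
    (h₀ : Continuous K₀) (h₁ : Continuous K₁)
    (h : ∀ φ : V → F, ContDiff ℝ ∞ φ → HasCompactSupport φ →
      ∫ x, (K₀ x (φ x) + K₁ x (fderiv ℝ φ x)) = 0)
    {φ : V → F} (hφ : ContDiff ℝ 1 φ) (hc : HasCompactSupport φ) :
    ∫ x, (K₀ x (φ x) + K₁ x (fderiv ℝ φ x)) = 0 := by
  set K := Metric.cthickening 1 (tsupport φ) with hKdef
  have hK : IsCompact K := IsCompact.cthickening hc
  have hcont : ∀ ψ : V → F, ContDiff ℝ 1 ψ →
      Continuous fun x => K₀ x (ψ x) + K₁ x (fderiv ℝ ψ x) := fun ψ hψ =>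
    (h₀.clm_apply hψ.continuous).add (h₁.clm_apply (hψ.continuous_fderiv one_ne_zero))
  have hint : ∀ ψ : V → F, ContDiff ℝ 1 ψ → Function.support ψ ⊆ K →
      Function.support (fun x => K₀ x (ψ x) + K₁ x (fderiv ℝ ψ x)) ⊆ K := by
    intro ψ _ hs x hx
    by_contra hxK
    have h1 : x ∉ tsupport ψ := fun h2 => hxK (closure_minimal hs hK.isClosed h2)
    apply hx
    simp [image_eq_zero_of_notMem_tsupport h1, fderiv_of_notMem_tsupport (𝕜 := ℝ) h1]
  set A := ∫ x in K, (‖K₀ x‖ + ‖K₁ x‖)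
  have hA : IntegrableOn (fun x => ‖K₀ x‖ + ‖K₁ x‖) K := by
    have hcn : Continuous fun x => ‖K₀ x‖ + ‖K₁ x‖ :=
      h₀.norm.add ((continuous_norm (E := (V →L[ℝ] F) →L[ℝ] ℝ)).comp h₁)
    exact hcn.continuousOn.integrableOn_compact hK
  -- The mollified ψ is ε-close to φ in C¹ and supported in the fixed compact set `K`, so the
  -- functional changes by at most ε times an integral independent of ψ.
  have key : ∀ ε > 0, |∫ x, (K₀ x (φ x) + K₁ x (fderiv ℝ φ x))| ≤ ε * A := by
    intro ε hε
    obtain ⟨ψ, hψ, hψc, hψs, hψ0, hψ1⟩ := exists_smooth_approx hφ hc hε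
    have hψ' : ContDiff ℝ 1 ψ := hψ.of_le (by exact_mod_cast le_top)
    have hφs : Function.support φ ⊆ K :=
      (subset_tsupport φ).trans (Metric.self_subset_cthickening _)
    have e1 : ∫ x, (K₀ x (φ x) + K₁ x (fderiv ℝ φ x)) =
        ∫ x in K, ((K₀ x (φ x) + K₁ x (fderiv ℝ φ x)) -
          (K₀ x (ψ x) + K₁ x (fderiv ℝ ψ x))) := by
      rw [integral_sub ((hcont φ hφ).continuousOn.integrableOn_compact hK)
        ((hcont ψ hψ').continuousOn.integrableOn_compact hK),
        setIntegral_eq_integral_of_forall_compl_eq_zero fun x hx => by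
          by_contra h0; exact hx (hint φ hφ hφs h0),
        setIntegral_eq_integral_of_forall_compl_eq_zero fun x hx => by
          by_contra h0; exact hx (hint ψ hψ' hψs h0), h ψ hψ hψc, sub_zero]
    rw [e1, ← Real.norm_eq_abs, ← integral_const_mul]
    refine norm_integral_le_of_norm_le (hA.const_mul ε) (Eventually.of_forall fun x => ?_)
    have e2 : (K₀ x (φ x) + K₁ x (fderiv ℝ φ x)) - (K₀ x (ψ x) + K₁ x (fderiv ℝ ψ x)) =
        K₀ x (φ x - ψ x) + K₁ x (fderiv ℝ φ x - fderiv ℝ ψ x) := by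
      rw [map_sub, map_sub]; ring
    rw [e2]
    have b1 := (K₀ x).le_of_opNorm_le_of_le le_rfl ((norm_sub_rev _ _).trans_le (hψ0 x))
    have b2 := (K₁ x).le_of_opNorm_le_of_le le_rfl ((norm_sub_rev _ _).trans_le (hψ1 x))
    refine (norm_add_le _ _).trans ((add_le_add b1 b2).trans_eq (by ring))
  by_contra h0
  have hpos : 0 < |∫ x, (K₀ x (φ x) + K₁ x (fderiv ℝ φ x))| := abs_pos.2 h0
  set I := |∫ x, (K₀ x (φ x) + K₁ x (fderiv ℝ φ x))|
  have h2 := key (I / (2 * (|A| + 1))) (by positivity)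
  have h3 : I / (2 * (|A| + 1)) * A ≤ I / 2 := by
    have : I / (2 * (|A| + 1)) * A ≤ I / (2 * (|A| + 1)) * (|A| + 1) := by
      gcongr; linarith [le_abs_self A]
    refine this.trans_eq ?_
    field_simp
  linarith

/-- A linear first order functional that vanishes on `C¹` functions with compact support vanishes
on all `C¹` functions for which the pairing is integrable. -/
theorem integral_weak_form_of_integrable {K₀ : V → F →L[ℝ] ℝ} {K₁ : V → (V →L[ℝ] F) →L[ℝ] ℝ}
    (h₀ : Continuous K₀) (h₁ : Continuous K₁)
    (h : ∀ φ : V → F, ContDiff ℝ 1 φ → HasCompactSupport φ →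
      ∫ x, (K₀ x (φ x) + K₁ x (fderiv ℝ φ x)) = 0)
    {φ : V → F} (hφ : ContDiff ℝ 1 φ)
    (hi₀ : Integrable fun x => K₀ x (φ x) + K₁ x (fderiv ℝ φ x))
    (hi₁ : Integrable fun x => ‖K₁ x‖ * ‖φ x‖) :
    ∫ x, (K₀ x (φ x) + K₁ x (fderiv ℝ φ x)) = 0 := by
  let b : ContDiffBump (0 : V) := ⟨1, 2, one_pos, one_lt_two⟩
  -- Cut-offs at scale N+1. Their gradients are O(1/N), so the commutator term is O(1/N) times the
  -- integrable function `‖K₁ x‖ * ‖φ x‖`; no decay of φ alone is required.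
  let χ : ℕ → V → ℝ := fun N x => b (((N : ℝ) + 1)⁻¹ • x)
  have hχd : ∀ N, ContDiff ℝ 1 (χ N) := fun N => b.contDiff.comp (contDiff_const_smul _)
  have hχc : ∀ N, HasCompactSupport (χ N) := fun N =>
    b.hasCompactSupport.comp_smul (inv_ne_zero (by positivity))
  obtain ⟨C, hC⟩ := (b.hasCompactSupport.fderiv ℝ).exists_bound_of_continuous
    (b.contDiff.continuous_fderiv (n := 1) one_ne_zero)
  have hχ' : ∀ N x, ‖fderiv ℝ (χ N) x‖ ≤ C * ((N : ℝ) + 1)⁻¹ := by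
    intro N x
    have hd : HasFDerivAt (χ N) ((fderiv ℝ b (((N : ℝ) + 1)⁻¹ • x)).comp
        (((N : ℝ) + 1)⁻¹ • ContinuousLinearMap.id ℝ V)) x :=
      ((b.contDiff (n := 1)).differentiable one_ne_zero _).hasFDerivAt.comp x
        ((hasFDerivAt_id x).const_smul _)
    rw [hd.fderiv]
    refine (ContinuousLinearMap.opNorm_comp_le _ _).trans ?_
    have hn : ‖((N : ℝ) + 1)⁻¹ • ContinuousLinearMap.id ℝ V‖ ≤ ((N : ℝ) + 1)⁻¹ := by
      rw [norm_smul, Real.norm_of_nonneg (by positivity)]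
      exact mul_le_of_le_one_right (by positivity) ContinuousLinearMap.norm_id_le
    have hC0 : 0 ≤ C := (norm_nonneg _).trans (hC 0)
    exact mul_le_mul (hC _) hn (norm_nonneg _) hC0
  have hC0 : 0 ≤ C := (norm_nonneg _).trans (hC 0)
  have hfd : ∀ N x, fderiv ℝ (fun y => χ N y • φ y) x =
      χ N x • fderiv ℝ φ x + (fderiv ℝ (χ N) x).smulRight (φ x) := fun N x =>
    fderiv_fun_smul ((hχd N).differentiable one_ne_zero x) (hφ.differentiable one_ne_zero x)
  have hzero : ∀ N, ∫ x, (χ N x * (K₀ x (φ x) + K₁ x (fderiv ℝ φ x)) +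
      K₁ x ((fderiv ℝ (χ N) x).smulRight (φ x))) = 0 := by
    intro N
    rw [← h (fun y => χ N y • φ y) ((hχd N).smul hφ) (hχc N).smul_right]
    refine integral_congr_ae (Eventually.of_forall fun x => ?_)
    simp only [hfd, map_add, map_smul, smul_eq_mul]
    ring
  have hχ0 : ∀ N x, 0 ≤ χ N x := fun N x => b.nonneg
  have hχ1 : ∀ N x, χ N x ≤ 1 := fun N x => b.le_one
  have hlim : ∀ x, Tendsto (fun N => χ N x) atTop (𝓝 1) := by
    intro x
    have h1 : Tendsto (fun N : ℕ => ((N : ℝ) + 1)⁻¹ • x) atTop (𝓝 ((0 : ℝ) • x)) := by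
      refine Tendsto.smul_const ?_ x
      simpa using tendsto_one_div_add_atTop_nhds_zero_nat (𝕜 := ℝ)
    rw [zero_smul] at h1
    have h2 := (b.continuous.tendsto 0).comp h1
    rwa [b.one_of_mem_closedBall (Metric.mem_closedBall_self b.rIn_pos.le)] at h2
  have hK₁b : ∀ N x, ‖K₁ x ((fderiv ℝ (χ N) x).smulRight (φ x))‖ ≤
      C * ((N : ℝ) + 1)⁻¹ * (‖K₁ x‖ * ‖φ x‖) := by
    intro N x
    refine ((K₁ x).le_opNorm _).trans ?_
    rw [ContinuousLinearMap.norm_smulRight_apply]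
    have := mul_le_mul_of_nonneg_left (hχ' N x) (mul_nonneg (norm_nonneg (K₁ x))
      (norm_nonneg (φ x)))
    linarith
  have hcφ' := hφ.continuous_fderiv one_ne_zero
  have hT : Tendsto (fun N => ∫ x, (χ N x * (K₀ x (φ x) + K₁ x (fderiv ℝ φ x)) +
      K₁ x ((fderiv ℝ (χ N) x).smulRight (φ x)))) atTop
      (𝓝 (∫ x, (K₀ x (φ x) + K₁ x (fderiv ℝ φ x)))) := by
    refine tendsto_integral_of_dominated_convergence
      (fun x => ‖K₀ x (φ x) + K₁ x (fderiv ℝ φ x)‖ + C * (‖K₁ x‖ * ‖φ x‖)) (fun N => ?_)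
      (hi₀.norm.add (hi₁.const_mul C)) (fun N => Eventually.of_forall fun x => ?_)
      (Eventually.of_forall fun x => ?_)
    · have hs : Continuous fun x => (fderiv ℝ (χ N) x).smulRight (φ x) := by
        have := (hχd N).continuous_fderiv one_ne_zero
        exact (ContinuousLinearMap.smulRightL ℝ V F).continuous₂.comp
          (this.prodMk hφ.continuous)
      exact (((hχd N).continuous.mul ((h₀.clm_apply hφ.continuous).add
        (h₁.clm_apply hcφ'))).add (h₁.clm_apply hs)).aestronglyMeasurable
    · refine (norm_add_le _ _).trans (add_le_add ?_ ?_)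
      · rw [norm_mul, Real.norm_of_nonneg (hχ0 N x)]
        exact mul_le_of_le_one_left (norm_nonneg _) (hχ1 N x)
      · refine (hK₁b N x).trans ?_
        have : ((N : ℝ) + 1)⁻¹ ≤ 1 := inv_le_one_of_one_le₀ (by linarith [N.cast_nonneg (α := ℝ)])
        have h4 : C * ((N : ℝ) + 1)⁻¹ ≤ C := mul_le_of_le_one_right hC0 this
        exact mul_le_mul_of_nonneg_right h4 (by positivity)
    · have l1 := (hlim x).mul_const (K₀ x (φ x) + K₁ x (fderiv ℝ φ x))
      have l2 : Tendsto (fun N => K₁ x ((fderiv ℝ (χ N) x).smulRight (φ x))) atTop (𝓝 0) := by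
        refine squeeze_zero_norm (fun N => hK₁b N x) ?_
        have := (tendsto_one_div_add_atTop_nhds_zero_nat (𝕜 := ℝ)).const_mul C
        simpa using this.mul_const (‖K₁ x‖ * ‖φ x‖)
      simpa using l1.add l2
  exact tendsto_nhds_unique hT (by simp [hzero])

end Analysis

set_option maxSynthPendingDepth 3

open Filter Topology
open scoped InnerProductSpace ENNReal

/-! ### Trace, Frobenius product, divergence and integration by parts -/

section Operators

variable {n : ℕ}

/-- The standard basis vectors. -/
abbrev stdVec (i : Fin n) : Space n := EuclideanSpace.single i 1

/-- The trace of a linear endomorphism of `ℝⁿ`. -/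
def traceL : (Space n →L[ℝ] Space n) →L[ℝ] ℝ :=
  ∑ i : Fin n, (EuclideanSpace.proj i : Space n →L[ℝ] ℝ) ∘L
    (ContinuousLinearMap.apply ℝ (Space n) (stdVec i))

theorem traceL_apply (A : Space n →L[ℝ] Space n) : traceL A = ∑ i, A (stdVec i) i := by
  simp [traceL]

/-- The Frobenius inner product of linear endomorphisms of `ℝⁿ`. -/
def frobL : (Space n →L[ℝ] Space n) →L[ℝ] (Space n →L[ℝ] Space n) →L[ℝ] ℝ :=
  ∑ i : Fin n, (innerSL ℝ : Space n →L[ℝ] Space n →L[ℝ] ℝ).bilinearComp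
    (ContinuousLinearMap.apply ℝ (Space n) (stdVec i))
    (ContinuousLinearMap.apply ℝ (Space n) (stdVec i))

theorem frobL_apply (A B : Space n →L[ℝ] Space n) :
    frobL A B = ∑ i, ⟪A (stdVec i), B (stdVec i)⟫_ℝ := by
  simp [frobL]

theorem frobL_apply' (A B : Space n →L[ℝ] Space n) :
    frobL A B = ∑ i, ∑ j, A (stdVec j) i * B (stdVec j) i := by
  rw [frobL_apply, Finset.sum_comm]
  simp [PiLp.inner_apply, mul_comm]

/-- The divergence of a vector field. -/
def divg (v : Space n → Space n) (x : Space n) : ℝ := traceL (fderiv ℝ v x)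

theorem continuous_divg {v : Space n → Space n} (hv : ContDiff ℝ 1 v) : Continuous (divg v) :=
  traceL.continuous.comp (hv.continuous_fderiv one_ne_zero)

theorem sum_stdVec (v : Space n) : ∑ i, v i • stdVec i = v := by
  ext j
  simp [Finset.sum_apply, Pi.single_apply]

theorem hasFDerivAt_coord {v : Space n → Space n} {x : Space n} (hv : DifferentiableAt ℝ v x)
    (i : Fin n) : HasFDerivAt (fun y => v y i)
      ((EuclideanSpace.proj i : Space n →L[ℝ] ℝ) ∘L fderiv ℝ v x) x :=
  (EuclideanSpace.proj i : Space n →L[ℝ] ℝ).hasFDerivAt.comp x hv.hasFDerivAt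

theorem fderiv_coord {v : Space n → Space n} {x : Space n} (hv : DifferentiableAt ℝ v x)
    (i : Fin n) (w : Space n) : fderiv ℝ (fun y => v y i) x w = fderiv ℝ v x w i := by
  rw [(hasFDerivAt_coord hv i).fderiv]; rfl

theorem contDiff_coord {k : ℕ∞ω} {v : Space n → Space n} (hv : ContDiff ℝ k v) (i : Fin n) :
    ContDiff ℝ k (fun y => v y i) :=
  (EuclideanSpace.proj i : Space n →L[ℝ] ℝ).contDiff.comp hv

theorem fderiv_apply_eq_sum (φ : Space n → ℝ) (x v : Space n) :
    fderiv ℝ φ x v = ∑ j, v j * pd j φ x := by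
  conv_lhs => rw [← sum_stdVec v]
  simp [pd]

theorem divg_smul {g : Space n → ℝ} {v : Space n → Space n} {x : Space n}
    (hg : DifferentiableAt ℝ g x) (hv : DifferentiableAt ℝ v x) :
    divg (fun y => g y • v y) x = fderiv ℝ g x (v x) + g x * divg v x := by
  rw [divg, fderiv_fun_smul hg hv, map_add, map_smul, divg, add_comm, smul_eq_mul]
  congr 1
  rw [traceL_apply, fderiv_apply_eq_sum]
  simp [pd, mul_comm]

/-- Integration by parts for the divergence. -/
theorem integral_fderiv_apply_eq_neg {φ : Space n → ℝ} {v : Space n → Space n}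
    (hφ : ContDiff ℝ 1 φ) (hc : HasCompactSupport φ) (hv : ContDiff ℝ 1 v) :
    ∫ x, fderiv ℝ φ x (v x) = -∫ x, divg v x * φ x := by
  have hcv := fun j => (contDiff_coord hv j)
  have hd : ∀ (j : Fin n), Continuous fun x => fderiv ℝ φ x (stdVec j) := fun j =>
    (hφ.continuous_fderiv one_ne_zero).clm_apply continuous_const
  have hdv : ∀ (j : Fin n), Continuous fun x => fderiv ℝ (fun y => v y j) x (stdVec j) := fun j =>
    ((hcv j).continuous_fderiv one_ne_zero).clm_apply continuous_const
  have e1 : ∀ x, fderiv ℝ φ x (v x) = ∑ j, v x j * fderiv ℝ φ x (stdVec j) := fun x =>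
    fderiv_apply_eq_sum φ x (v x)
  have e2 : ∀ x, divg v x * φ x = ∑ j, fderiv ℝ (fun y => v y j) x (stdVec j) * φ x := fun x => by
    rw [divg, traceL_apply, Finset.sum_mul]
    simp only [fderiv_coord (hv.differentiable one_ne_zero x)]
  simp_rw [e1, e2]
  rw [integral_finsetSum, integral_finsetSum, ← Finset.sum_neg_distrib]
  · exact Finset.sum_congr rfl fun j _ => integral_mul_fderiv_eq_neg (hcv j) hφ hc _
  · exact fun j _ => ((hdv j).mul hφ.continuous).integrable_of_hasCompactSupport hc.mul_left
  · exact fun j _ => ((hcv j).continuous.mul (hd j)).integrable_of_hasCompactSupport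
      (hc.fderiv_apply ℝ _).mul_left

/-- The divergence theorem for a compactly supported flux. -/
theorem integral_divg_smul_eq_zero {g : Space n → ℝ} {v : Space n → Space n}
    (hg : ContDiff ℝ 1 g) (hc : HasCompactSupport g) (hv : ContDiff ℝ 1 v) :
    ∫ x, (fderiv ℝ g x (v x) + g x * divg v x) = 0 := by
  have h1 : Integrable fun x => fderiv ℝ g x (v x) :=
    ((hg.continuous_fderiv one_ne_zero).clm_apply hv.continuous).integrable_of_hasCompactSupport
      ((hc.fderiv ℝ).mono fun x hx => by
        contrapose! hx
        simp only [Function.mem_support, not_not] at hx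
        simp [hx])
  have h2 : Integrable fun x => g x * divg v x :=
    (hg.continuous.mul (continuous_divg hv)).integrable_of_hasCompactSupport hc.mul_right
  rw [integral_add h1 h2, integral_fderiv_apply_eq_neg hg hc hv]
  simp [mul_comm]

end Operators

/-! ### Classical formulation of the system -/

section Strong

variable {n : ℕ}

/-- The material derivative `∂ₜu + (u·∇)u`. -/
def matDeriv (u : ℝ → Space n → Space n) (t : ℝ) (x : Space n) : Space n :=
  deriv (fun s => u s x) t + fderiv ℝ (u t) x (u t x)

/-- The stress tensor paired with the gradient of a test field. -/
def stress (a μ lam : ℝ) (ρ : ℝ → Space n → ℝ) (u : ℝ → Space n → Space n) (t : ℝ) (x : Space n) :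
    (Space n →L[ℝ] Space n) →L[ℝ] ℝ :=
  μ • frobL (fderiv ℝ (u t) x) + ((lam + μ) * divg (u t) x - a * ρ t x) • traceL

/-- Solutions of the system that are jointly `C¹`. They are defined for all times, but solve the
system only on `(0,T)`. -/
structure StrongSolution (a μ lam T : ℝ) (ρ : ℝ → Space n → ℝ) (u : ℝ → Space n → Space n) :
    Prop where
  density_contDiff : ContDiff ℝ 1 (fun p : ℝ × Space n => ρ p.1 p.2)
  velocity_contDiff : ContDiff ℝ 1 (fun p : ℝ × Space n => u p.1 p.2)
  bounded : ∃ C, ∀ t ∈ Icc 0 T, ∀ x, ‖u t x‖ ≤ C ∧ ‖fderiv ℝ (u t) x‖ ≤ C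
  memLp : ∀ t ∈ Icc 0 T, MemLp (u t) 2 ∧ MemLp (fderiv ℝ (u t)) 2
  continuity : ∀ t ∈ Ioo 0 T, ∀ x,
    deriv (fun s => ρ s x) t + fderiv ℝ (ρ t) x (u t x) + ρ t x * divg (u t) x = 0
  momentum : ∀ t ∈ Ioo 0 T, ∀ Φ : Space n → Space n, ContDiff ℝ 1 Φ → HasCompactSupport Φ →
    ∫ x, ((ρ t x • innerSL ℝ (matDeriv u t x)) (Φ x) + stress a μ lam ρ u t x (fderiv ℝ Φ x)) = 0

end Strong

/-! ### From distributional solutions to jointly C¹ solutions -/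

section FromWeak

theorem integral_linear_combination {α : Type*} [MeasurableSpace α] {ν : Measure α}
    {f₁ f₂ f₃ f₄ : α → ℝ} (h₁ : Integrable f₁ ν) (h₂ : Integrable f₂ ν) (h₃ : Integrable f₃ ν)
    (h₄ : Integrable f₄ ν) (c₂ c₃ c₄ : ℝ) :
    ∫ x, (f₁ x + c₂ * f₂ x + c₃ * f₃ x + c₄ * f₄ x) ∂ν =
      ∫ x, f₁ x ∂ν + c₂ * ∫ x, f₂ x ∂ν + c₃ * ∫ x, f₃ x ∂ν + c₄ * ∫ x, f₄ x ∂ν := by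
  have h₂' := h₂.const_mul c₂
  have h₃' := h₃.const_mul c₃
  have h₄' := h₄.const_mul c₄
  have e := integral_add ((h₁.add h₂').add h₃') h₄'
  have e' := integral_add (h₁.add h₂') h₃'
  have e'' := integral_add h₁ h₂'
  simp only [Pi.add_apply, integral_const_mul] at e e' e''
  rw [e, e', e'']

variable {n : ℕ}

theorem ContDiff.slice {F : Type*} [NormedAddCommGroup F] [NormedSpace ℝ F] {f : ℝ → Space n → F}
    (hf : ContDiff ℝ 1 (fun p : ℝ × Space n => f p.1 p.2)) (t : ℝ) : ContDiff ℝ 1 (f t) :=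
  hf.comp (contDiff_prodMk_right t)

theorem hasDerivAt_slice {F : Type*} [NormedAddCommGroup F] [NormedSpace ℝ F]
    {f : ℝ → Space n → F} (hf : ContDiff ℝ 1 (fun p : ℝ × Space n => f p.1 p.2)) (t : ℝ)
    (x : Space n) : HasDerivAt (fun s => f s x)
      (fderiv ℝ (fun p : ℝ × Space n => f p.1 p.2) (t, x) (1, 0)) t := by
  have h1 := ((hf.differentiable one_ne_zero) (t, x)).hasFDerivAt
  have h2 : HasDerivAt (fun s : ℝ => (s, x)) ((1 : ℝ), (0 : Space n)) t :=
    (hasDerivAt_id t).prodMk (hasDerivAt_const t x)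
  exact h1.comp_hasDerivAt t h2

theorem differentiableAt_slice {F : Type*} [NormedAddCommGroup F] [NormedSpace ℝ F]
    {f : ℝ → Space n → F} (hf : ContDiff ℝ 1 (fun p : ℝ × Space n => f p.1 p.2)) (t : ℝ)
    (x : Space n) : DifferentiableAt ℝ (fun s => f s x) t :=
  (hasDerivAt_slice hf t x).differentiableAt

theorem continuous_deriv_slice {F : Type*} [NormedAddCommGroup F] [NormedSpace ℝ F]
    {f : ℝ → Space n → F} (hf : ContDiff ℝ 1 (fun p : ℝ × Space n => f p.1 p.2)) :
    Continuous (fun p : ℝ × Space n => deriv (fun s => f s p.2) p.1) := by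
  have : (fun p : ℝ × Space n => deriv (fun s => f s p.2) p.1) =
      fun p => fderiv ℝ (fun p : ℝ × Space n => f p.1 p.2) p (1, 0) :=
    funext fun p => (hasDerivAt_slice hf p.1 p.2).deriv
  rw [this]
  exact (hf.continuous_fderiv one_ne_zero).clm_apply continuous_const

theorem continuous_deriv_slice_right {F : Type*} [NormedAddCommGroup F] [NormedSpace ℝ F]
    {f : ℝ → Space n → F} (hf : ContDiff ℝ 1 (fun p : ℝ × Space n => f p.1 p.2)) (t : ℝ) :
    Continuous (fun x => deriv (fun s => f s x) t) :=
  (continuous_deriv_slice hf).comp (Continuous.prodMk_right t)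

theorem hasDerivAt_integral_mul_test {f : ℝ → Space n → ℝ}
    (hf : ContDiff ℝ 1 (fun p : ℝ × Space n => f p.1 p.2)) {φ : Space n → ℝ}
    (hφ : ContDiff ℝ 1 φ) (hc : HasCompactSupport φ) (t : ℝ) :
    HasDerivAt (fun s => ∫ x, f s x * φ x) (∫ x, deriv (fun s => f s x) t * φ x) t := by
  have hF : ContDiff ℝ 1 (fun p : ℝ × Space n => f p.1 p.2 * φ p.2) :=
    hf.mul (hφ.comp contDiff_snd)
  have h := hasDerivAt_setIntegral_of_contDiff (F := fun s x => f s x * φ x) hF hc t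
  have hz : ∀ x ∉ tsupport φ, φ x = 0 := fun x hx => image_eq_zero_of_notMem_tsupport hx
  have e1 : ∀ s, ∫ x in tsupport φ, f s x * φ x = ∫ x, f s x * φ x := fun s =>
    setIntegral_eq_integral_of_forall_compl_eq_zero fun x hx => by rw [hz x hx, mul_zero]
  have e2 : ∫ x in tsupport φ, deriv (fun s => f s x * φ x) t =
      ∫ x, deriv (fun s => f s x) t * φ x := by
    rw [setIntegral_eq_integral_of_forall_compl_eq_zero fun x hx => by simp [hz x hx]]
    refine integral_congr_ae (Eventually.of_forall fun x => ?_)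
    exact deriv_mul_const (differentiableAt_slice hf t x) _
  simpa only [e1, e2] using h

/-- A continuous function that integrates to zero against test functions vanishes. -/
theorem eq_zero_of_integral_mul_test_eq_zero {f : Space n → ℝ} (hf : Continuous f)
    (h : ∀ φ, IsTest φ → ∫ x, f x * φ x = 0) : ∀ x, f x = 0 := by
  have h1 : f =ᵐ[volume] (fun _ => 0) := by
    refine ae_eq_zero_of_integral_contDiff_smul_eq_zero hf.locallyIntegrable fun φ hφ hc => ?_
    rw [← h φ ⟨hφ, hc⟩]
    exact integral_congr_ae (Eventually.of_forall fun x => by simp [mul_comm])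
  exact fun x => congrFun ((hf.ae_eq_iff_eq volume continuous_const).1 h1) x

variable {ρ : ℝ → Space n → ℝ} {u : ℝ → Space n → Space n} {T : ℝ}

/-- For C¹ fields the time derivative passes under the integral and the flux integrates by parts;
the residual is continuous and orthogonal to every test function. -/
theorem ContinuityEq.pointwise (hρ : ContDiff ℝ 1 (fun p : ℝ × Space n => ρ p.1 p.2))
    (hu : ContDiff ℝ 1 (fun p : ℝ × Space n => u p.1 p.2)) (h : ContinuityEq T ρ u) {t : ℝ}
    (ht : t ∈ Ioo 0 T) (x : Space n) :
    deriv (fun s => ρ s x) t + fderiv ℝ (ρ t) x (u t x) + ρ t x * divg (u t) x = 0 := by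
  have hρt := ContDiff.slice hρ t
  have hut := ContDiff.slice hu t
  have hdρ : ∀ y, DifferentiableAt ℝ (ρ t) y := hρt.differentiable one_ne_zero
  have hdu : ∀ y, DifferentiableAt ℝ (u t) y := hut.differentiable one_ne_zero
  have c1 := continuous_deriv_slice_right hρ t
  have c2 : Continuous fun x => divg (fun y => ρ t y • u t y) x := continuous_divg (hρt.smul hut)
  have key := eq_zero_of_integral_mul_test_eq_zero (c1.add c2) (fun φ hφ => ?_) x
  · simp only [Pi.add_apply, divg_smul (hdρ _) (hdu _)] at key
    linarith
  have hφ1 : ContDiff ℝ 1 φ := hφ.1.of_le (by exact_mod_cast le_top)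
  have e1 := (h φ hφ t ht).unique (hasDerivAt_integral_mul_test hρ hφ1 hφ.2 t)
  have e2 : ∫ x, fderiv ℝ φ x (ρ t x • u t x) =
      -∫ x, divg (fun y => ρ t y • u t y) x * φ x :=
    integral_fderiv_apply_eq_neg hφ1 hφ.2 (hρt.smul hut)
  have e3 : ∀ x, ∑ j, ρ t x * u t x j * pd j φ x = fderiv ℝ φ x (ρ t x • u t x) := fun x => by
    rw [fderiv_apply_eq_sum]; simp
  simp_rw [e3] at e1
  have i1 : Integrable fun x => deriv (fun s => ρ s x) t * φ x :=
    (c1.mul hφ1.continuous).integrable_of_hasCompactSupport hφ.2.mul_left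
  have i2 : Integrable fun x => divg (fun y => ρ t y • u t y) x * φ x :=
    (c2.mul hφ1.continuous).integrable_of_hasCompactSupport hφ.2.mul_left
  simp only [Pi.add_apply, add_mul]
  rw [integral_add i1 i2, ← e1, e2]
  ring

theorem pd_eq_fderiv (j : Fin n) (φ : Space n → ℝ) (x : Space n) :
    pd j φ x = fderiv ℝ φ x (stdVec j) := rfl

theorem contDiff_pd {φ : Space n → ℝ} (hφ : ContDiff ℝ ∞ φ) (j : Fin n) :
    ContDiff ℝ ∞ (pd j φ) :=
  (hφ.fderiv_right (m := ∞) le_rfl).clm_apply contDiff_const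

theorem pd_comm {φ : Space n → ℝ} (hφ : ContDiff ℝ ∞ φ) (i j : Fin n) (x : Space n) :
    pd i (pd j φ) x = pd j (pd i φ) x := by
  have hs : IsSymmSndFDerivAt ℝ φ x :=
    hφ.contDiffAt.isSymmSndFDerivAt
      (by rw [minSmoothness_of_isRCLikeNormedField]; exact WithTop.coe_le_coe.2 le_top)
  have hd : DifferentiableAt ℝ (fderiv ℝ φ) x :=
    ((hφ.fderiv_right (m := ∞) le_rfl).differentiable (by simp)) x
  have e : ∀ i j, pd i (pd j φ) x = fderiv ℝ (fderiv ℝ φ) x (stdVec i) (stdVec j) := fun i j => by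
    have : pd j φ = fun y => fderiv ℝ φ y (stdVec j) := rfl
    rw [pd_eq_fderiv, this, fderiv_clm_apply hd (differentiableAt_const _)]
    simp
  rw [e, e, hs.eq]

theorem deriv_coord (hu : ContDiff ℝ 1 (fun p : ℝ × Space n => u p.1 p.2)) (t : ℝ) (x : Space n)
    (i : Fin n) : deriv (fun s => u s x i) t = deriv (fun s => u s x) t i := by
  have h := (differentiableAt_slice hu t x).hasDerivAt
  exact ((EuclideanSpace.proj i : Space n →L[ℝ] ℝ).hasFDerivAt.comp_hasDerivAt t h).deriv

variable {a μ lam : ℝ}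

/-- One derivative is moved from the test function onto `u` in each viscous term, and the continuity
equation turns ∂ₜ(ρuᵢ) + div(ρuᵢu) into ρ times the material derivative. Only first derivatives of
the test function remain, so the velocity itself can later serve as one. -/
theorem MomentumEq.component (hρ : ContDiff ℝ 1 (fun p : ℝ × Space n => ρ p.1 p.2))
    (hu : ContDiff ℝ 1 (fun p : ℝ × Space n => u p.1 p.2)) (hcont : ContinuityEq T ρ u)
    (h : MomentumEq a μ lam T ρ u) {t : ℝ} (ht : t ∈ Ioo 0 T) (i : Fin n) {φ : Space n → ℝ}
    (hφ : IsTest φ) :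
    ∫ x, (ρ t x * matDeriv u t x i * φ x +
      (μ * (∑ j, fderiv ℝ (u t) x (stdVec j) i * fderiv ℝ φ x (stdVec j)) +
        ((lam + μ) * divg (u t) x - a * ρ t x) * fderiv ℝ φ x (stdVec i))) = 0 := by
  have hρt := ContDiff.slice hρ t
  have hut := ContDiff.slice hu t
  have hui : ContDiff ℝ 1 (fun p : ℝ × Space n => u p.1 p.2 i) :=
    (EuclideanSpace.proj i : Space n →L[ℝ] ℝ).contDiff.comp hu
  have huti := contDiff_coord hut i
  have hdρ : ∀ y, DifferentiableAt ℝ (ρ t) y := hρt.differentiable one_ne_zero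
  have hdu : ∀ y, DifferentiableAt ℝ (u t) y := hut.differentiable one_ne_zero
  have hdui : ∀ y, DifferentiableAt ℝ (fun y => u t y i) y := huti.differentiable one_ne_zero
  have hφ1 : ContDiff ℝ 1 φ := hφ.1.of_le (by exact_mod_cast le_top)
  have hpd1 : ∀ j, ContDiff ℝ 1 (pd j φ) := fun j =>
    (contDiff_pd hφ.1 j).of_le (by exact_mod_cast le_top)
  have hpdc : ∀ j, HasCompactSupport (pd j φ) := fun j => hφ.2.fderiv_apply ℝ _
  have hpdc2 : ∀ j k, HasCompactSupport (pd j (pd k φ)) := fun j k => (hpdc k).fderiv_apply ℝ _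
  have hpd2 : ∀ j k, Continuous (pd j (pd k φ)) := fun j k =>
    (contDiff_pd (contDiff_pd hφ.1 k) j).continuous
  have hm : ContDiff ℝ 1 (fun p : ℝ × Space n => ρ p.1 p.2 * u p.1 p.2 i) := hρ.mul hui
  have e1 := (h i φ hφ t ht).unique
    (hasDerivAt_integral_mul_test (f := fun t x => ρ t x * u t x i) hm hφ1 hφ.2 t)
  have hdu_c : ∀ j, Continuous fun x => fderiv ℝ (u t) x (stdVec j) i := fun j =>
    (EuclideanSpace.proj i : Space n →L[ℝ] ℝ).continuous.comp
      ((hut.continuous_fderiv one_ne_zero).clm_apply continuous_const)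
  -- the four flux terms
  set w : Space n → Space n := fun x => (ρ t x * u t x i) • u t x with hw
  have hw1 : ContDiff ℝ 1 w := (hρt.mul huti).smul hut
  have t1 : ∫ x, fderiv ℝ φ x (w x) = -∫ x, divg w x * φ x :=
    integral_fderiv_apply_eq_neg hφ1 hφ.2 hw1
  have t2 : ∀ j, ∫ x, u t x i * pd j (pd j φ) x =
      -∫ x, fderiv ℝ (u t) x (stdVec j) i * pd j φ x := fun j => by
    have := integral_mul_fderiv_eq_neg huti (hpd1 j) (hpdc j) (stdVec j)
    simp only [fderiv_coord (hdu _)] at this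
    exact this
  have t3 : ∫ x, fderiv ℝ (pd i φ) x (u t x) = -∫ x, divg (u t) x * pd i φ x :=
    integral_fderiv_apply_eq_neg (hpd1 i) (hpdc i) hut
  have hcd := continuous_divg hut
  have i0 : Integrable fun x => deriv (fun s => ρ s x * u s x i) t * φ x :=
    ((continuous_deriv_slice_right (f := fun t x => ρ t x * u t x i) hm t).mul
      hφ1.continuous).integrable_of_hasCompactSupport hφ.2.mul_left
  have i1 : Integrable fun x => fderiv ℝ φ x (w x) :=
    ((hφ1.continuous_fderiv one_ne_zero).clm_apply hw1.continuous).integrable_of_hasCompactSupport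
      ((hφ.2.fderiv ℝ).mono fun x hx hx' => hx (by simp [hx']))
  have i1' : Integrable fun x => divg w x * φ x :=
    ((continuous_divg hw1).mul hφ1.continuous).integrable_of_hasCompactSupport hφ.2.mul_left
  have i2 : ∀ j, Integrable fun x => u t x i * pd j (pd j φ) x := fun j =>
    (huti.continuous.mul (hpd2 j j)).integrable_of_hasCompactSupport (hpdc2 j j).mul_left
  have i2' : ∀ j, Integrable fun x => fderiv ℝ (u t) x (stdVec j) i * pd j φ x := fun j =>
    ((hdu_c j).mul (hpd1 j).continuous).integrable_of_hasCompactSupport (hpdc j).mul_left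
  have i3 : Integrable fun x => fderiv ℝ (pd i φ) x (u t x) :=
    (((hpd1 i).continuous_fderiv one_ne_zero).clm_apply
      hut.continuous).integrable_of_hasCompactSupport
      (((hpdc i).fderiv ℝ).mono fun x hx hx' => hx (by simp [hx']))
  have i3' : Integrable fun x => divg (u t) x * pd i φ x :=
    (hcd.mul (hpd1 i).continuous).integrable_of_hasCompactSupport (hpdc i).mul_left
  have i4 : Integrable fun x => ρ t x * pd i φ x :=
    (hρt.continuous.mul (hpd1 i).continuous).integrable_of_hasCompactSupport (hpdc i).mul_left
  have e2 : ∀ x, ((∑ j, ρ t x * u t x i * u t x j * pd j φ x)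
        + μ * u t x i * (∑ j, pd j (pd j φ) x)
        + (lam + μ) * (∑ j, u t x j * pd i (pd j φ) x)
        + a * ρ t x * pd i φ x) =
      fderiv ℝ φ x (w x) + μ * (∑ j, u t x i * pd j (pd j φ) x)
        + (lam + μ) * fderiv ℝ (pd i φ) x (u t x) + a * (ρ t x * pd i φ x) := fun x => by
    rw [fderiv_apply_eq_sum φ, fderiv_apply_eq_sum (pd i φ)]
    simp only [hw, PiLp.smul_apply, smul_eq_mul, Finset.mul_sum, pd_comm hφ.1 i, mul_assoc]
  have is2 : Integrable fun x => ∑ j, u t x i * pd j (pd j φ) x :=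
    integrable_finsetSum _ fun j _ => i2 j
  have is2' : Integrable fun x => ∑ j, fderiv ℝ (u t) x (stdVec j) i * pd j φ x :=
    integrable_finsetSum _ fun j _ => i2' j
  simp_rw [e2] at e1
  rw [integral_linear_combination i1 is2 i3 i4, t1, t3,
    integral_finsetSum _ fun j _ => i2 j] at e1
  simp_rw [t2] at e1
  rw [Finset.sum_neg_distrib, ← integral_finsetSum _ fun j _ => i2' j] at e1
  have e3 : ∀ x, (ρ t x * matDeriv u t x i * φ x +
      (μ * (∑ j, fderiv ℝ (u t) x (stdVec j) i * fderiv ℝ φ x (stdVec j)) +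
        ((lam + μ) * divg (u t) x - a * ρ t x) * fderiv ℝ φ x (stdVec i))) =
      (deriv (fun s => ρ s x * u s x i) t * φ x + divg w x * φ x) +
        μ * (∑ j, fderiv ℝ (u t) x (stdVec j) i * pd j φ x) +
        (lam + μ) * (divg (u t) x * pd i φ x) + (-a) * (ρ t x * pd i φ x) := fun x => by
    have d1 : deriv (fun s => ρ s x * u s x i) t =
        deriv (fun s => ρ s x) t * u t x i + ρ t x * deriv (fun s => u s x) t i := by
      rw [← deriv_coord hu]
      exact deriv_fun_mul (differentiableAt_slice hρ t x)
        (differentiableAt_slice (f := fun s y => u s y i) hui t x)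
    have d2 : divg w x = (ρ t x * fderiv ℝ (u t) x (u t x) i + u t x i * fderiv ℝ (ρ t) x (u t x))
        + ρ t x * u t x i * divg (u t) x := by
      rw [hw, divg_smul ((hdρ x).fun_mul (hdui x)) (hdu x), fderiv_fun_mul (hdρ x) (hdui x)]
      simp [fderiv_coord (hdu x)]
    have d3 := hcont.pointwise hρ hu ht x
    rw [d1, d2, matDeriv, PiLp.add_apply]
    simp only [pd_eq_fderiv]
    linear_combination (-(u t x i * φ x)) * d3
  simp_rw [e3]
  have i01 : Integrable fun x => deriv (fun s => ρ s x * u s x i) t * φ x + divg w x * φ x :=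
    i0.add i1'
  rw [integral_linear_combination i01 is2' i3' i4, integral_add i0 i1']
  linarith

/-- Summing the components gives the identity for smooth fields; as it involves one derivative of
the field with continuous coefficients, mollification extends it to C¹ fields. -/
theorem MomentumEq.weak_form (hρ : ContDiff ℝ 1 (fun p : ℝ × Space n => ρ p.1 p.2))
    (hu : ContDiff ℝ 1 (fun p : ℝ × Space n => u p.1 p.2)) (hcont : ContinuityEq T ρ u)
    (h : MomentumEq a μ lam T ρ u) {t : ℝ} (ht : t ∈ Ioo 0 T) {Φ : Space n → Space n}
    (hΦ : ContDiff ℝ 1 Φ) (hc : HasCompactSupport Φ) :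
    ∫ x, ((ρ t x • innerSL ℝ (matDeriv u t x)) (Φ x) +
      stress a μ lam ρ u t x (fderiv ℝ Φ x)) = 0 := by
  have hρt := ContDiff.slice hρ t
  have hut := ContDiff.slice hu t
  have hcm : Continuous (matDeriv u t) := (continuous_deriv_slice_right hu t).add
    ((hut.continuous_fderiv one_ne_zero).clm_apply hut.continuous)
  have h₀ : Continuous fun x => ρ t x • innerSL ℝ (matDeriv u t x) :=
    hρt.continuous.smul ((innerSL ℝ).continuous.comp hcm)
  have h₁ : Continuous (stress a μ lam ρ u t) := by
    have hcf : Continuous fun x => frobL (fderiv ℝ (u t) x) :=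
      frobL.continuous.comp (hut.continuous_fderiv one_ne_zero)
    exact (hcf.const_smul μ).add (((continuous_const.mul (continuous_divg hut)).sub
      (continuous_const.mul hρt.continuous)).smul continuous_const)
  refine integral_weak_form_of_contDiff h₀ h₁ (fun Ψ hΨ hΨc => ?_) hΦ hc
  have hΨ1 : ContDiff ℝ 1 Ψ := hΨ.of_le (by exact_mod_cast le_top)
  have hdΨ : ∀ y, DifferentiableAt ℝ Ψ y := hΨ1.differentiable one_ne_zero
  have hcΨ : ∀ i, HasCompactSupport fun x => Ψ x i := fun i =>
    hΨc.comp_left (g := fun v : Space n => v i) rfl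
  have e1 : ∀ x, ((ρ t x • innerSL ℝ (matDeriv u t x)) (Ψ x) +
      stress a μ lam ρ u t x (fderiv ℝ Ψ x)) =
      ∑ i, (ρ t x * matDeriv u t x i * Ψ x i +
      (μ * (∑ j, fderiv ℝ (u t) x (stdVec j) i * fderiv ℝ (fun y => Ψ y i) x (stdVec j)) +
        ((lam + μ) * divg (u t) x - a * ρ t x) *
          fderiv ℝ (fun y => Ψ y i) x (stdVec i))) := fun x => by
    simp only [fderiv_coord (hdΨ x), Finset.sum_add_distrib, ← Finset.mul_sum]
    simp only [stress, add_apply, smul_apply, frobL_apply', traceL_apply, innerSL_apply_apply,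
      smul_eq_mul, PiLp.inner_apply, Finset.mul_sum, mul_assoc]
    simp [mul_comm]
  simp_rw [e1]
  rw [integral_finsetSum]
  · exact Finset.sum_eq_zero fun i _ =>
      h.component hρ hu hcont ht i ⟨contDiff_coord hΨ i, hcΨ i⟩
  · intro i _
    have hd : ∀ j, Continuous fun x => fderiv ℝ (fun y => Ψ y i) x (stdVec j) := fun j =>
      ((contDiff_coord hΨ1 i).continuous_fderiv one_ne_zero).clm_apply continuous_const
    have hds : ∀ j, HasCompactSupport fun x => fderiv ℝ (fun y => Ψ y i) x (stdVec j) := fun j =>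
      (hcΨ i).fderiv_apply ℝ _
    have hduc : ∀ j, Continuous fun x => fderiv ℝ (u t) x (stdVec j) i := fun j =>
      (EuclideanSpace.proj i : Space n →L[ℝ] ℝ).continuous.comp
        ((hut.continuous_fderiv one_ne_zero).clm_apply continuous_const)
    have hmi : Continuous fun x => matDeriv u t x i :=
      (EuclideanSpace.proj i : Space n →L[ℝ] ℝ).continuous.comp hcm
    have j1 : Integrable fun x => ρ t x * matDeriv u t x i * Ψ x i :=
      ((hρt.continuous.mul hmi).mul
        (contDiff_coord hΨ1 i).continuous).integrable_of_hasCompactSupport (hcΨ i).mul_left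
    have j2 : Integrable fun x => μ * ∑ j, fderiv ℝ (u t) x (stdVec j) i *
        fderiv ℝ (fun y => Ψ y i) x (stdVec j) :=
      (integrable_finsetSum _ fun j _ => ((hduc j).mul (hd j)).integrable_of_hasCompactSupport
        (hds j).mul_left).const_mul μ
    have j3 : Integrable fun x => ((lam + μ) * divg (u t) x - a * ρ t x) *
        fderiv ℝ (fun y => Ψ y i) x (stdVec i) :=
      (((continuous_const.mul (continuous_divg hut)).sub
        (continuous_const.mul hρt.continuous)).mul (hd i)).integrable_of_hasCompactSupport
        (hds i).mul_left
    exact j1.add (j2.add j3)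

theorem ContinuityEq.congr_ae {ρ' : ℝ → Space n → ℝ} {u' : ℝ → Space n → Space n}
    (h : ContinuityEq T ρ u) (hρ : ∀ t ∈ Icc 0 T, ρ' t =ᵐ[volume] ρ t)
    (hu : ∀ t ∈ Icc 0 T, u' t =ᵐ[volume] u t) : ContinuityEq T ρ' u' := by
  intro φ hφ t ht
  have h1 := h φ hφ t ht
  have e1 : ∫ x, ∑ j, ρ' t x * u' t x j * pd j φ x = ∫ x, ∑ j, ρ t x * u t x j * pd j φ x := by
    refine integral_congr_ae ?_
    filter_upwards [hρ t (Ioo_subset_Icc_self ht), hu t (Ioo_subset_Icc_self ht)] with x e1 e2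
    rw [e1, e2]
  rw [e1]
  refine h1.congr_of_eventuallyEq ?_
  filter_upwards [Icc_mem_nhds ht.1 ht.2] with s hs
  refine integral_congr_ae ?_
  filter_upwards [hρ s hs] with x e1
  rw [e1]

theorem MomentumEq.congr_ae {ρ' : ℝ → Space n → ℝ} {u' : ℝ → Space n → Space n}
    (h : MomentumEq a μ lam T ρ u) (hρ : ∀ t ∈ Icc 0 T, ρ' t =ᵐ[volume] ρ t)
    (hu : ∀ t ∈ Icc 0 T, u' t =ᵐ[volume] u t) : MomentumEq a μ lam T ρ' u' := by
  intro i φ hφ t ht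
  refine ((h i φ hφ t ht).congr_of_eventuallyEq ?_).congr_deriv ?_
  · filter_upwards [Icc_mem_nhds ht.1 ht.2] with s hs
    refine integral_congr_ae ?_
    filter_upwards [hρ s hs, hu s hs] with x e1 e2
    rw [e1, e2]
  · refine integral_congr_ae ?_
    filter_upwards [hρ t (Ioo_subset_Icc_self ht), hu t (Ioo_subset_Icc_self ht)] with x e1 e2
    rw [e1, e2]

/-- A solution in `C¹([0,T], H^m)` has a jointly `C¹` representative. -/
theorem IsSolution.exists_strongSolution {m : ℝ} (hm : (n : ℝ) < 2 * (m - 1)) (hT : 0 < T)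
    {ρ₀ : Space n → ℝ} {u₀ : Space n → Space n} (h : IsSolution a μ lam m T ρ₀ u₀ ρ u) :
    ∃ ρ' u', StrongSolution a μ lam T ρ' u' ∧ ρ' 0 =ᵐ[volume] ρ₀ ∧ u' 0 =ᵐ[volume] u₀ := by
  obtain ⟨ρ', hρ', -, hρ2⟩ := h.density_regular.exists_contDiff hm hT
  choose v hv hvb hv2 using fun i => (h.velocity_regular i).exists_contDiff hm hT
  choose C hC using hvb
  let u' : ℝ → Space n → Space n := fun t x => WithLp.toLp 2 fun i => v i t x
  have hu'i : ∀ t x i, u' t x i = v i t x := fun t x i => rfl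
  have hu' : ContDiff ℝ 1 (fun p : ℝ × Space n => u' p.1 p.2) :=
    contDiff_euclidean.2 fun i => hv i
  have hu'd : ∀ t x, DifferentiableAt ℝ (u' t) x := fun t =>
    (ContDiff.slice hu' t).differentiable one_ne_zero
  have hnorm : ∀ w : Space n, ‖w‖ ≤ ∑ i, ‖w i‖ := fun w => by
    conv_lhs => rw [← sum_stdVec w]
    refine (norm_sum_le _ _).trans_eq (Finset.sum_congr rfl fun i _ => ?_)
    rw [norm_smul]; simp
  have hfd : ∀ t x, ‖fderiv ℝ (u' t) x‖ ≤ ∑ i, ‖fderiv ℝ (v i t) x‖ := fun t x => by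
    refine ContinuousLinearMap.opNorm_le_bound _ (by positivity) fun w => ?_
    refine (hnorm _).trans ?_
    rw [Finset.sum_mul]
    refine Finset.sum_le_sum fun i _ => ?_
    rw [← fderiv_coord (hu'd t x) i w]
    exact ContinuousLinearMap.le_opNorm _ _
  have hρae : ∀ t ∈ Icc 0 T, ρ' t =ᵐ[volume] ρ t := fun t ht => (hρ2 t ht).1
  have huae : ∀ t ∈ Icc 0 T, u' t =ᵐ[volume] u t := fun t ht => by
    have := ae_all_iff.2 fun i => (hv2 i t ht).1
    filter_upwards [this] with x hx
    ext i
    exact hx i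
  have hcont := h.continuity_eq.congr_ae hρae huae
  have hmom := h.momentum_eq.congr_ae hρae huae
  have h0 : (0 : ℝ) ∈ Icc 0 T := ⟨le_rfl, hT.le⟩
  refine ⟨ρ', u', ⟨hρ', hu', ?_, fun t ht => ⟨?_, ?_⟩, fun t ht x => hcont.pointwise hρ' hu' ht x,
    fun t ht Φ hΦ hc => hmom.weak_form hρ' hu' hcont ht hΦ hc⟩,
    (hρae 0 h0).trans h.density_initial, (huae 0 h0).trans h.velocity_initial⟩
  · exact ⟨∑ i, C i, fun t ht x => ⟨(hnorm _).trans (Finset.sum_le_sum fun i _ => (hC i t ht x).1),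
      (hfd t x).trans (Finset.sum_le_sum fun i _ => (hC i t ht x).2)⟩⟩
  · have hs : MemLp (fun x => ∑ i, ‖v i t x‖) 2 :=
      memLp_finsetSum _ fun i _ => (hv2 i t ht).2.1.norm
    refine hs.of_le (ContDiff.slice hu' t).continuous.aestronglyMeasurable
      (Eventually.of_forall fun x => ?_)
    rw [Real.norm_of_nonneg (by positivity)]
    exact hnorm _
  · have hs : MemLp (fun x => ∑ i, ‖fderiv ℝ (v i t) x‖) 2 :=
      memLp_finsetSum _ fun i _ => (hv2 i t ht).2.2.norm
    refine hs.of_le ((ContDiff.slice hu' t).continuous_fderiv one_ne_zero).aestronglyMeasurable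
      (Eventually.of_forall fun x => ?_)
    rw [Real.norm_of_nonneg (by positivity)]
    exact hfd t x

end FromWeak

/-! ### Spatial derivatives of jointly C¹ functions -/

section Slices

variable {n : ℕ} {F : Type*} [NormedAddCommGroup F] [NormedSpace ℝ F] {f : ℝ → Space n → F}

theorem fderiv_slice (hf : ContDiff ℝ 1 (fun p : ℝ × Space n => f p.1 p.2)) (p : ℝ × Space n) :
    fderiv ℝ (f p.1) p.2 = (fderiv ℝ (fun p : ℝ × Space n => f p.1 p.2) p).comp
      (ContinuousLinearMap.inr ℝ ℝ (Space n)) := by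
  have h := ((hf.differentiable one_ne_zero) p).hasFDerivAt
  exact (HasFDerivAt.comp (g := fun p : ℝ × Space n => f p.1 p.2) (f := fun y => (p.1, y)) p.2 h
    (hasFDerivAt_prodMk_right p.1 p.2)).fderiv

theorem continuous_fderiv_slice (hf : ContDiff ℝ 1 (fun p : ℝ × Space n => f p.1 p.2)) :
    Continuous fun p : ℝ × Space n => fderiv ℝ (f p.1) p.2 := by
  simp_rw [fderiv_slice hf]
  exact (hf.continuous_fderiv one_ne_zero).clm_comp continuous_const

end Slices

/-! ### Particle paths and confinement of the gas -/

section Characteristics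

variable {n : ℕ} {a μ lam T : ℝ} {ρ : ℝ → Space n → ℝ} {u : ℝ → Space n → Space n}

/-- Particle paths exist on the whole time interval. -/
theorem StrongSolution.exists_path (S : StrongSolution a μ lam T ρ u) {t₀ : ℝ}
    (ht₀ : t₀ ∈ Icc 0 T) (x₀ : Space n) :
    ∃ X : ℝ → Space n, X t₀ = x₀ ∧
      ∀ t ∈ Icc 0 T, HasDerivWithinAt X (u t (X t)) (Icc 0 T) t := by
  obtain ⟨C, hC⟩ := S.bounded
  have hC0 : 0 ≤ C := (norm_nonneg _).trans (hC t₀ ht₀ x₀).1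
  have hT : 0 ≤ T := ht₀.1.trans ht₀.2
  -- With speed at most `C`, a path cannot leave the ball of radius `C * T` during [0,T], so one
  -- application of Picard–Lindelöf covers the whole interval. The gradient bound is the Lipschitz
  -- constant.
  have hpl : IsPicardLindelof u (⟨t₀, ht₀⟩ : Icc 0 T) x₀ (C.toNNReal * T.toNNReal) 0 C.toNNReal
      C.toNNReal := by
    refine ⟨fun t ht => LipschitzWith.lipschitzOnWith ?_, fun x _ => ?_, fun t ht x _ => ?_, ?_⟩
    · refine lipschitzWith_of_nnnorm_fderiv_le
        ((ContDiff.slice S.velocity_contDiff t).differentiable one_ne_zero) fun x => ?_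
      rw [← NNReal.coe_le_coe, coe_nnnorm, Real.coe_toNNReal _ hC0]
      exact (hC t ht x).2
    · exact (S.velocity_contDiff.continuous.comp (Continuous.prodMk_left x)).continuousOn
    · rw [Real.coe_toNNReal _ hC0]
      exact (hC t ht x).1
    · simp only [NNReal.coe_mul, Real.coe_toNNReal _ hC0, Real.coe_toNNReal _ hT, NNReal.coe_zero,
        sub_zero]
      exact mul_le_mul_of_nonneg_left (max_le (by linarith [ht₀.1]) ht₀.2) hC0
  exact hpl.exists_eq_forall_mem_Icc_hasDerivWithinAt₀

theorem eq_of_hasDerivAt_zero {f : ℝ → ℝ} {s t : ℝ} (hst : s ≤ t) (hc : ContinuousOn f (Icc s t))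
    (hd : ∀ r ∈ Ioo s t, HasDerivAt f 0 r) : f t = f s := by
  rcases hst.eq_or_lt with rfl | h
  · rfl
  obtain ⟨c, -, hc'⟩ := exists_hasDerivAt_eq_slope f (fun _ => 0) h hc hd
  rw [eq_comm, div_eq_zero_iff] at hc'
  rcases hc' with h1 | h1 <;> linarith

/-- Along a particle path the density is multiplied by a positive factor. -/
theorem StrongSolution.density_path (S : StrongSolution a μ lam T ρ u) {X : ℝ → Space n}
    (hX : ∀ t ∈ Icc 0 T, HasDerivWithinAt X (u t (X t)) (Icc 0 T) t) {t : ℝ} (ht : t ∈ Icc 0 T) :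
    ∃ c : ℝ, ρ t (X t) = ρ 0 (X 0) * Real.exp c := by
  have hT : 0 ≤ T := ht.1.trans ht.2
  have hXc : ContinuousOn X (Icc 0 T) := fun s hs => (hX s hs).continuousWithinAt
  have hdiv : Continuous fun p : ℝ × Space n => divg (u p.1) p.2 :=
    traceL.continuous.comp (continuous_fderiv_slice S.velocity_contDiff)
  -- The divergence along the path. Time is clamped to [0,T] so that `d` is continuous on the whole
  -- line; ρ along the path times exp ∫d is then constant.
  set d : ℝ → ℝ := fun s => divg (u (projIcc 0 T hT s)) (X (projIcc 0 T hT s)) with hd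
  have hdc : Continuous d := by
    have h1 : Continuous fun s => X (projIcc 0 T hT s) :=
      (continuousOn_iff_continuous_domRestrict.1 hXc).comp continuous_projIcc
    exact hdiv.comp ((continuous_subtype_val.comp (continuous_projIcc (h := hT))).prodMk h1)
  set D : ℝ → ℝ := fun s => ∫ r in (0 : ℝ)..s, d r
  have hD : ∀ s, HasDerivAt D (d s) s := fun s =>
    intervalIntegral.integral_hasDerivAt_right (hdc.intervalIntegrable _ _)
      (hdc.stronglyMeasurableAtFilter _ _) hdc.continuousAt
  have hDc : Continuous D := continuous_iff_continuousAt.2 fun s => (hD s).continuousAt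
  have hc : ContinuousOn (fun s => ρ s (X s) * Real.exp (D s)) (Icc 0 t) := by
    have h1 : ContinuousOn (fun s => ρ s (X s)) (Icc 0 T) :=
      S.density_contDiff.continuous.comp_continuousOn (continuousOn_id.prodMk hXc)
    exact (h1.mono (Icc_subset_Icc_right ht.2)).mul (Real.continuous_exp.comp hDc).continuousOn
  have hz := eq_of_hasDerivAt_zero ht.1 hc fun s hs => by
    have hs' : s ∈ Ioo 0 T := ⟨hs.1, hs.2.trans_le ht.2⟩
    have hX' : HasDerivAt X (u s (X s)) s :=
      (hX s (Ioo_subset_Icc_self hs')).hasDerivAt (Icc_mem_nhds hs'.1 hs'.2)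
    have h1 := ((S.density_contDiff.differentiable one_ne_zero) (s, X s)).hasFDerivAt
    have h2 : HasDerivAt (fun s => ρ s (X s))
        (fderiv ℝ (fun p : ℝ × Space n => ρ p.1 p.2) (s, X s) (1, u s (X s))) s :=
      HasFDerivAt.comp_hasDerivAt (l := fun p : ℝ × Space n => ρ p.1 p.2)
        (f := fun s => (s, X s)) s h1 ((hasDerivAt_id s).prodMk hX')
    have h3 : fderiv ℝ (fun p : ℝ × Space n => ρ p.1 p.2) (s, X s) (1, u s (X s)) =
        deriv (fun r => ρ r (X s)) s + fderiv ℝ (ρ s) (X s) (u s (X s)) := by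
      rw [(hasDerivAt_slice S.density_contDiff s (X s)).deriv,
        show fderiv ℝ (ρ s) (X s) = _ from fderiv_slice S.density_contDiff (s, X s),
        ContinuousLinearMap.comp_apply, ← map_add]
      simp
    have h4 := h2.mul (hD s).exp
    have h5 := S.continuity s hs' (X s)
    have h6 : d s = divg (u s) (X s) := by
      simp [hd, projIcc_of_mem hT (Ioo_subset_Icc_self hs')]
    refine h4.congr_deriv ?_
    rw [h3, h6]
    linear_combination Real.exp (D s) * h5
  refine ⟨-D t, ?_⟩
  have h0 : D 0 = 0 := intervalIntegral.integral_same
  simp only [h0, Real.exp_zero, mul_one] at hz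
  rw [← hz, mul_assoc, ← Real.exp_add]
  simp

theorem StrongSolution.density_nonneg (S : StrongSolution a μ lam T ρ u) (h0 : ∀ x, 0 ≤ ρ 0 x)
    {t : ℝ} (ht : t ∈ Icc 0 T) (x : Space n) : 0 ≤ ρ t x := by
  obtain ⟨X, rfl, hX⟩ := S.exists_path ht x
  obtain ⟨c, hc⟩ := S.density_path hX ht
  rw [hc]
  exact mul_nonneg (h0 _) (Real.exp_pos _).le

/-- The support of the density propagates with finite speed. -/
theorem StrongSolution.exists_density_support (S : StrongSolution a μ lam T ρ u) {R : ℝ}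
    (h0 : ∀ x, R < ‖x‖ → ρ 0 x = 0) :
    ∃ R', ∀ t ∈ Icc 0 T, ∀ x, R' < ‖x‖ → ρ t x = 0 := by
  obtain ⟨C, hC⟩ := S.bounded
  refine ⟨R + C * T, fun t ht x hx => ?_⟩
  obtain ⟨X, rfl, hX⟩ := S.exists_path ht x
  obtain ⟨c, hc⟩ := S.density_path hX ht
  have hT : 0 ≤ T := ht.1.trans ht.2
  have hC0 : 0 ≤ C := (norm_nonneg _).trans (hC t ht (X t)).1
  have h1 := (convex_Icc (0 : ℝ) T).norm_image_sub_le_of_norm_hasDerivWithin_le hX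
    (fun s hs => (hC s hs (X s)).1) ⟨le_rfl, hT⟩ ht
  have h2 : ‖X t‖ ≤ ‖X 0‖ + ‖X t - X 0‖ := by
    simpa using norm_add_le (X 0) (X t - X 0)
  have h3 : C * ‖t - 0‖ ≤ C * T := by
    rw [sub_zero, Real.norm_of_nonneg ht.1]
    exact mul_le_mul_of_nonneg_left ht.2 hC0
  rw [hc, h0 _ (by linarith), zero_mul]

/-- The nearest point on a larger sphere lies radially outward. Nontriviality supplies a direction
when `x` is the origin. -/
theorem exists_norm_eq_of_norm_le [Nontrivial (Space n)] (x : Space n) {c : ℝ} (hc : ‖x‖ ≤ c) :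
    ∃ y : Space n, ‖y‖ = c ∧ ‖x - y‖ = c - ‖x‖ := by
  obtain ⟨e, he, hxe⟩ : ∃ e : Space n, ‖e‖ = 1 ∧ x = ‖x‖ • e := by
    rcases eq_or_ne x 0 with rfl | hx
    · obtain ⟨e, he⟩ := exists_norm_eq (Space n) zero_le_one
      exact ⟨e, he, by simp⟩
    · exact ⟨‖x‖⁻¹ • x, norm_smul_inv_norm hx, by rw [smul_inv_smul₀ (norm_ne_zero_iff.2 hx)]⟩
  refine ⟨c • e, ?_, ?_⟩
  · rw [norm_smul, he, mul_one, Real.norm_of_nonneg ((norm_nonneg x).trans hc)]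
  · conv_lhs => rw [hxe]
    rw [← sub_smul, norm_smul, he, mul_one, norm_sub_rev, Real.norm_of_nonneg (by linarith)]

/-- If the velocity vanishes outside any ball that contains the support of the density, then the
support of the density does not spread. -/
theorem StrongSolution.density_eq_zero_of_exterior [Nontrivial (Space n)]
    (S : StrongSolution a μ lam T ρ u) {R : ℝ} (hR : 0 ≤ R) (h0 : ∀ x, R < ‖x‖ → ρ 0 x = 0)
    (hext : ∀ r, 0 ≤ r → (∀ t ∈ Icc 0 T, ∀ x, r < ‖x‖ → ρ t x = 0) →
      ∀ t ∈ Ioo 0 T, ∀ x, r < ‖x‖ → u t x = 0) :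
    ∀ t ∈ Icc 0 T, ∀ x, R < ‖x‖ → ρ t x = 0 := by
  obtain ⟨R', hR'⟩ := S.exists_density_support h0
  obtain ⟨L, hL⟩ := S.bounded
  -- All radii reached by the gas during [0,T]; inserting `R` makes the set nonempty and gives `R ≤
  -- M`.
  set A : Set ℝ := insert R {r | ∃ t ∈ Icc 0 T, ∃ x, ρ t x ≠ 0 ∧ r = ‖x‖}
  have hA : BddAbove A := by
    refine ⟨max R R', ?_⟩
    rintro r (rfl | ⟨t, ht, x, hx, rfl⟩)
    · exact le_max_left _ _
    · exact (not_lt.1 fun h => hx (hR' t ht x h)).trans (le_max_right _ _)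
  set M := sSup A
  have hRM : R ≤ M := le_csSup hA (mem_insert _ _)
  have hM : ∀ t ∈ Icc 0 T, ∀ x, M < ‖x‖ → ρ t x = 0 := fun t ht x hx => by
    by_contra h
    exact absurd (le_csSup hA (mem_insert_of_mem _ ⟨t, ht, x, h, rfl⟩)) (not_le.2 hx)
  suffices hMR : M ≤ R from fun t ht x hx => hM t ht x (hMR.trans_lt hx)
  have hu := hext M (hR.trans hRM) hM
  -- The velocity is L-Lipschitz and vanishes beyond radius `M`, so its size is at most `L` times
  -- the distance to that sphere. Vanishing is known only strictly outside, hence the comparison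
  -- point at radius slightly above `M`.
  have hbd : ∀ t ∈ Ioo 0 T, ∀ x, ‖x‖ ≤ M → ‖u t x‖ ≤ L * (M - ‖x‖) := fun t ht x hx => by
    have hL0 : 0 ≤ L := (norm_nonneg _).trans (hL t (Ioo_subset_Icc_self ht) x).1
    refine le_of_forall_pos_le_add fun ε hε => ?_
    obtain ⟨y, hy, hxy⟩ := exists_norm_eq_of_norm_le x (c := M + ε / (L + 1))
      (hx.trans (by have : 0 < ε / (L + 1) := by positivity
                    linarith))
    have hpos : 0 < ε / (L + 1) := by positivity
    have h1 := convex_univ.norm_image_sub_le_of_norm_fderiv_le (𝕜 := ℝ) (f := u t) (C := L)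
      (fun z _ => (ContDiff.slice S.velocity_contDiff t).differentiable one_ne_zero z)
      (fun z _ => (hL t (Ioo_subset_Icc_self ht) z).2) (mem_univ y) (mem_univ x)
    rw [hu t ht y (by linarith), sub_zero, hxy] at h1
    have h2 : L * (ε / (L + 1)) ≤ ε := by
      rw [← mul_div_assoc, div_le_iff₀ (by positivity)]
      nlinarith
    nlinarith
  by_contra! hlt
  -- The differential inequality below gives M² - |X|² ≥ (M² - R²)e^{-LT} along every path carrying
  -- gas. If R < M, this keeps all radii below a number strictly less than their supremum `M`.
  obtain ⟨r, hrA, hr⟩ := exists_lt_of_lt_csSup (s := A) ⟨R, mem_insert _ _⟩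
    (show Real.sqrt (M ^ 2 - (M ^ 2 - R ^ 2) * Real.exp (-(L * T))) < M by
      have : 0 < (M ^ 2 - R ^ 2) * Real.exp (-(L * T)) :=
        mul_pos (by nlinarith) (Real.exp_pos _)
      rw [Real.sqrt_lt' (by linarith)]
      linarith)
  have hT0 : 0 ≤ T ∨ T < 0 := le_or_gt 0 T
  have key : r ^ 2 ≤ M ^ 2 - (M ^ 2 - R ^ 2) * Real.exp (-(L * T)) := by
    rcases hrA with rfl | ⟨t, ht, x, hx, rfl⟩
    · rcases hT0 with hT | hT
      · have hL0 : 0 ≤ L := (norm_nonneg _).trans (hL 0 ⟨le_rfl, hT⟩ 0).1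
        have : Real.exp (-(L * T)) ≤ 1 := Real.exp_le_one_iff.2 (by nlinarith)
        nlinarith [mul_nonneg (show 0 ≤ M ^ 2 - r ^ 2 by nlinarith) (sub_nonneg.2 this)]
      · exfalso
        have : M ≤ r := csSup_le ⟨r, mem_insert _ _⟩ (by
          rintro s (rfl | ⟨t, ht, -⟩)
          · exact le_rfl
          · exact absurd (ht.1.trans ht.2) (not_le.2 hT))
        linarith
    · have hT : 0 ≤ T := ht.1.trans ht.2
      have hL0 : 0 ≤ L := (norm_nonneg _).trans (hL 0 ⟨le_rfl, hT⟩ 0).1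
      obtain ⟨X, rfl, hX⟩ := S.exists_path ht x
      have hρX : ∀ s ∈ Icc 0 T, ρ s (X s) ≠ 0 := fun s hs h => by
        obtain ⟨c, hc⟩ := S.density_path hX hs
        obtain ⟨c', hc'⟩ := S.density_path hX ht
        rw [hc, mul_eq_zero, or_iff_left (Real.exp_pos c).ne'] at h
        exact hx (by rw [hc', h, zero_mul])
      have hXM : ∀ s ∈ Icc 0 T, ‖X s‖ ≤ M := fun s hs =>
        not_lt.1 fun h => hρX s hs (hM s hs _ h)
      have hX0 : ‖X 0‖ ≤ R := not_lt.1 fun h => hρX 0 ⟨le_rfl, hT⟩ (h0 _ h)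
      have hXc : ContinuousOn X (Icc 0 T) := fun s hs => (hX s hs).continuousWithinAt
      -- This quantity is nondecreasing, since d|X|²/ds ≤ 2L|X|(M - |X|) ≤ L(M² - |X|²). Squares
      -- avoid differentiating the norm at the origin.
      set p : ℝ → ℝ := fun s => (M ^ 2 - ‖X s‖ ^ 2) * Real.exp (L * s)
      have hpc : ContinuousOn p (Icc 0 t) :=
        ((continuousOn_const.sub (hXc.norm.pow 2)).mul
          (Real.continuous_exp.comp (continuous_const.mul continuous_id)).continuousOn).mono
          (Icc_subset_Icc_right ht.2)
      have hp : ∀ s ∈ Ioo 0 t, HasDerivAt p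
          ((-(2 * ⟪X s, u s (X s)⟫_ℝ)) * Real.exp (L * s) +
            (M ^ 2 - ‖X s‖ ^ 2) * (Real.exp (L * s) * L)) s := fun s hs => by
        have hs' : s ∈ Ioo 0 T := ⟨hs.1, hs.2.trans_le ht.2⟩
        have hX' : HasDerivAt X (u s (X s)) s :=
          (hX s (Ioo_subset_Icc_self hs')).hasDerivAt (Icc_mem_nhds hs'.1 hs'.2)
        have h1 := (hX'.norm_sq.const_sub (M ^ 2))
        have h2 : HasDerivAt (fun s => Real.exp (L * s)) (Real.exp (L * s) * L) s := by
          simpa using ((hasDerivAt_id s).const_mul L).exp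
        exact h1.mul h2
      have hmono : MonotoneOn p (Icc 0 t) := by
        refine monotoneOn_of_deriv_nonneg (convex_Icc _ _) hpc ?_ ?_
        · rw [interior_Icc]
          exact fun s hs => (hp s hs).differentiableAt.differentiableWithinAt
        · rw [interior_Icc]
          intro s hs
          have hs' : s ∈ Ioo 0 T := ⟨hs.1, hs.2.trans_le ht.2⟩
          rw [(hp s hs).deriv]
          have h1 := hXM s (Ioo_subset_Icc_self hs')
          have h2 := hbd s hs' (X s) h1
          have h3 := real_inner_le_norm (X s) (u s (X s))
          have h4 : ⟪X s, u s (X s)⟫_ℝ ≤ ‖X s‖ * (L * (M - ‖X s‖)) :=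
            h3.trans (mul_le_mul_of_nonneg_left h2 (norm_nonneg _))
          have h5 : 2 * ⟪X s, u s (X s)⟫_ℝ ≤ (M ^ 2 - ‖X s‖ ^ 2) * L := by
            nlinarith [mul_nonneg hL0 (sq_nonneg (M - ‖X s‖))]
          have := (Real.exp_pos (L * s)).le
          nlinarith
      have h6 := hmono ⟨le_rfl, ht.1⟩ ⟨ht.1, le_rfl⟩ ht.1
      simp only [p, mul_zero, Real.exp_zero, mul_one] at h6
      have h7 : M ^ 2 - R ^ 2 ≤ (M ^ 2 - ‖X t‖ ^ 2) * Real.exp (L * t) := by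
        nlinarith [norm_nonneg (X 0)]
      have h8 : (M ^ 2 - ‖X t‖ ^ 2) * Real.exp (L * t) ≤
          (M ^ 2 - ‖X t‖ ^ 2) * Real.exp (L * T) := by
        have := hXM t ht
        refine mul_le_mul_of_nonneg_left (Real.exp_le_exp.2 (by nlinarith [ht.2])) ?_
        nlinarith [norm_nonneg (X t)]
      have h9 : (M ^ 2 - R ^ 2) * Real.exp (-(L * T)) ≤ M ^ 2 - ‖X t‖ ^ 2 := by
        rw [Real.exp_neg, ← div_eq_mul_inv, div_le_iff₀ (Real.exp_pos _)]
        exact h7.trans h8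
      linarith
  have hr0 : 0 ≤ r := (Real.sqrt_nonneg _).trans hr.le
  exact absurd (Real.le_sqrt_of_sq_le key) (not_le.2 hr)

end Characteristics

/-! ### A Poincaré inequality weighted by the density -/

section Poincare

variable {V : Type*} [NormedAddCommGroup V] [InnerProductSpace ℝ V] [FiniteDimensional ℝ V]
  [MeasurableSpace V] [BorelSpace V]
  {F : Type*} [NormedAddCommGroup F] [NormedSpace ℝ F] [CompleteSpace F]

theorem sq_integral_le_integral_sq {f : ℝ → ℝ} (hf : Continuous f) :
    (∫ s in (0 : ℝ)..1, f s) ^ 2 ≤ ∫ s in (0 : ℝ)..1, f s ^ 2 := by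
  set c := ∫ s in (0 : ℝ)..1, f s
  have h0 : 0 ≤ ∫ s in (0 : ℝ)..1, (f s - c) ^ 2 :=
    intervalIntegral.integral_nonneg zero_le_one fun s _ => sq_nonneg _
  have h1 : ∫ s in (0 : ℝ)..1, (f s - c) ^ 2 =
      (∫ s in (0 : ℝ)..1, f s ^ 2) - (∫ s in (0 : ℝ)..1, (2 * c) * f s) + ∫ s in (0 : ℝ)..1, c ^ 2 := by
    have i1 : IntervalIntegrable (fun s => f s ^ 2) volume 0 1 := (hf.pow 2).intervalIntegrable _ _
    have i2 : IntervalIntegrable (fun s => (2 * c) * f s) volume 0 1 :=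
      (continuous_const.mul hf).intervalIntegrable _ _
    have i3 : IntervalIntegrable (fun _ : ℝ => c ^ 2) volume 0 1 :=
      continuous_const.intervalIntegrable _ _
    rw [← intervalIntegral.integral_sub i1 i2, ← intervalIntegral.integral_add (i1.sub i2) i3]
    exact intervalIntegral.integral_congr fun s _ => by ring
  rw [intervalIntegral.integral_const_mul, intervalIntegral.integral_const] at h1
  simp only [sub_zero, one_smul] at h1
  change _ = _ - 2 * c * c + _ at h1
  nlinarith

/-- The fundamental theorem of calculus along the segment, then Cauchy–Schwarz on the unit interval.
-/
theorem norm_sub_sq_le_integral {w : V → F} (hw : ContDiff ℝ 1 w) (y h : V) :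
    ‖w (y + h) - w y‖ ^ 2 ≤ ‖h‖ ^ 2 * ∫ s in (0 : ℝ)..1, ‖fderiv ℝ w (y + s • h)‖ ^ 2 := by
  have hl : ∀ s : ℝ, HasDerivAt (fun s : ℝ => w (y + s • h)) (fderiv ℝ w (y + s • h) h) s := by
    intro s
    have h1 := (hw.differentiable one_ne_zero (y + s • h)).hasFDerivAt
    have h2 : HasDerivAt (fun s : ℝ => y + s • h) h s := by
      simpa using ((hasDerivAt_id s).smul_const h).const_add y
    exact h1.comp_hasDerivAt s h2
  have hc0 : Continuous fun s : ℝ => fderiv ℝ w (y + s • h) :=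
    (hw.continuous_fderiv one_ne_zero).comp (by fun_prop)
  have hc : Continuous fun s : ℝ => fderiv ℝ w (y + s • h) h := hc0.clm_apply continuous_const
  have h1 : ∫ s in (0 : ℝ)..1, fderiv ℝ w (y + s • h) h = w (y + h) - w y := by
    rw [intervalIntegral.integral_eq_sub_of_hasDerivAt (fun s _ => hl s)
      (hc.intervalIntegrable _ _)]
    simp
  have h2 : ‖w (y + h) - w y‖ ≤ ∫ s in (0 : ℝ)..1, ‖h‖ * ‖fderiv ℝ w (y + s • h)‖ := by
    rw [← h1]
    refine (intervalIntegral.norm_integral_le_integral_norm zero_le_one).trans ?_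
    refine intervalIntegral.integral_mono_on zero_le_one (hc.norm.intervalIntegrable _ _)
      ((continuous_const.mul hc0.norm).intervalIntegrable _ _) fun s _ => ?_
    rw [mul_comm]
    exact ContinuousLinearMap.le_opNorm _ _
  rw [intervalIntegral.integral_const_mul] at h2
  calc ‖w (y + h) - w y‖ ^ 2 ≤ (‖h‖ * ∫ s in (0 : ℝ)..1, ‖fderiv ℝ w (y + s • h)‖) ^ 2 :=
        pow_le_pow_left₀ (norm_nonneg _) h2 2
    _ ≤ _ := by
        rw [mul_pow]
        exact mul_le_mul_of_nonneg_left (sq_integral_le_integral_sq hc0.norm) (sq_nonneg _)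

theorem enorm_sub_sq_le_lintegral {w : V → F} (hw : ContDiff ℝ 1 w) (y h : V) :
    ENNReal.ofReal (‖w (y + h) - w y‖ ^ 2) ≤ ENNReal.ofReal (‖h‖ ^ 2) *
      ∫⁻ s in Ioc (0 : ℝ) 1, ENNReal.ofReal (‖fderiv ℝ w (y + s • h)‖ ^ 2) := by
  have hc0 : Continuous fun s : ℝ => ‖fderiv ℝ w (y + s • h)‖ ^ 2 :=
    (((hw.continuous_fderiv one_ne_zero).comp (by fun_prop :
      Continuous fun s : ℝ => y + s • h)).norm).pow 2
  have h1 := ENNReal.ofReal_le_ofReal (norm_sub_sq_le_integral hw y h)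
  rwa [ENNReal.ofReal_mul (sq_nonneg _), intervalIntegral.integral_of_le zero_le_one,
    ofReal_integral_eq_lintegral_ofReal (hc0.integrableOn_Ioc)
      (Eventually.of_forall fun s => sq_nonneg _)] at h1

/-- The oscillation of a function in a ball is controlled by its Dirichlet integral. -/
theorem lintegral_lintegral_sub_sq_le {w : V → F} (hw : ContDiff ℝ 1 w) (R : ℝ) :
    ∫⁻ x in Metric.closedBall (0 : V) R, ∫⁻ y in Metric.closedBall (0 : V) R,
      ENNReal.ofReal (‖w x - w y‖ ^ 2) ≤
    ENNReal.ofReal ((2 * R) ^ 2) * volume (Metric.closedBall (0 : V) (2 * R)) *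
      ∫⁻ x, ENNReal.ofReal (‖fderiv ℝ w x‖ ^ 2) := by
  set B := Metric.closedBall (0 : V) R
  set B' := Metric.closedBall (0 : V) (2 * R)
  have hB' : MeasurableSet B' := Metric.isClosed_closedBall.measurableSet
  set D : V → ℝ≥0∞ := fun x => ENNReal.ofReal (‖fderiv ℝ w x‖ ^ 2)
  have hD : Continuous D :=
    ENNReal.continuous_ofReal.comp (((hw.continuous_fderiv one_ne_zero).norm).pow 2)
  set J : V → V → ℝ≥0∞ := fun y h => ∫⁻ s in Ioc (0 : ℝ) 1, D (y + s • h)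
  have hJ : Measurable (Function.uncurry J) := by
    have : Measurable fun q : (V × V) × ℝ => D (q.1.1 + q.2 • q.1.2) :=
      (hD.comp (by fun_prop)).measurable
    exact this.lintegral_prod_right'
  have hJy : ∀ y, Measurable (J y) := fun y => hJ.of_uncurry_left
  -- Substitute x = y + h; two points of `B` differ by a vector of length at most 2R.
  have h1 : ∀ y ∈ B, ∫⁻ x in B, ENNReal.ofReal (‖w x - w y‖ ^ 2) ≤
      ENNReal.ofReal ((2 * R) ^ 2) * ∫⁻ h in B', J y h := by
    intro y hy
    rw [← lintegral_const_mul _ (hJy y), ← lintegral_indicator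
      Metric.isClosed_closedBall.measurableSet, ← lintegral_indicator hB',
      ← lintegral_add_left_eq_self _ y]
    refine lintegral_mono fun h => ?_
    by_cases hh : y + h ∈ B
    · have hh' : ‖h‖ ≤ 2 * R := by
        have h3 : ‖y + h‖ ≤ R := mem_closedBall_zero_iff.1 hh
        have h4 : ‖y‖ ≤ R := mem_closedBall_zero_iff.1 hy
        have h5 := norm_sub_le (y + h) y
        rw [add_sub_cancel_left] at h5
        linarith
      rw [indicator_of_mem hh, indicator_of_mem (mem_closedBall_zero_iff.2 hh')]
      refine (enorm_sub_sq_le_lintegral hw y h).trans ?_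
      gcongr
    · rw [indicator_of_notMem hh]
      exact zero_le
  have hsub : Measurable fun p : V × V => ENNReal.ofReal (‖w p.1 - w p.2‖ ^ 2) :=
    (ENNReal.continuous_ofReal.comp (((hw.continuous.comp continuous_fst).sub
      (hw.continuous.comp continuous_snd)).norm.pow 2)).measurable
  -- For fixed s and h, integrating over all y removes the shift s•h, leaving the Dirichlet integral
  -- whatever s and h are.
  have h2 : ∀ s : ℝ, ∀ h : V, ∫⁻ y, D (y + s • h) = ∫⁻ y, D y := fun s h =>
    lintegral_add_right_eq_self _ _
  calc ∫⁻ x in B, ∫⁻ y in B, ENNReal.ofReal (‖w x - w y‖ ^ 2)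
      = ∫⁻ y in B, ∫⁻ x in B, ENNReal.ofReal (‖w x - w y‖ ^ 2) :=
        lintegral_lintegral_swap hsub.aemeasurable
    _ ≤ ∫⁻ y in B, ENNReal.ofReal ((2 * R) ^ 2) * ∫⁻ h in B', J y h :=
        setLIntegral_mono' Metric.isClosed_closedBall.measurableSet h1
    _ ≤ ∫⁻ y, ENNReal.ofReal ((2 * R) ^ 2) * ∫⁻ h in B', J y h := setLIntegral_le_lintegral _ _
    _ = ENNReal.ofReal ((2 * R) ^ 2) * ∫⁻ y, ∫⁻ h in B', J y h :=
        lintegral_const_mul' _ _ ENNReal.ofReal_ne_top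
    _ = ENNReal.ofReal ((2 * R) ^ 2) * ∫⁻ h in B', ∫⁻ y, J y h := by
        rw [lintegral_lintegral_swap hJ.aemeasurable]
    _ = ENNReal.ofReal ((2 * R) ^ 2) * ∫⁻ h in B', ∫⁻ x, D x := by
        congr 1
        refine lintegral_congr fun h => ?_
        have hm : Measurable fun q : V × ℝ => D (q.1 + q.2 • h) :=
          (hD.comp (by fun_prop)).measurable
        rw [lintegral_lintegral_swap hm.aemeasurable]
        simp [h2]
    _ = _ := by rw [setLIntegral_const, mul_assoc, mul_comm (volume B')]

/-- A weighted Poincaré inequality on a ball. -/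
theorem integral_mul_setIntegral_sq_le {ρ : V → ℝ} {w : V → F} (hw : ContDiff ℝ 1 w)
    (hρ : Continuous ρ) {R P : ℝ} (hρ0 : ∀ x, 0 ≤ ρ x) (hρP : ∀ x, ρ x ≤ P)
    (hs : ∀ x, x ∉ Metric.closedBall (0 : V) R → ρ x = 0)
    (hD : Integrable fun x => ‖fderiv ℝ w x‖ ^ 2) :
    (∫ x, ρ x) * ∫ x in Metric.closedBall (0 : V) R, ‖w x‖ ^ 2 ≤
      2 * volume.real (Metric.closedBall (0 : V) R) * (∫ x, ρ x * ‖w x‖ ^ 2) +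
        2 * P * ((2 * R) ^ 2 * volume.real (Metric.closedBall (0 : V) (2 * R))) *
          ∫ x, ‖fderiv ℝ w x‖ ^ 2 := by
  set B := Metric.closedBall (0 : V) R
  have hB : IsCompact B := isCompact_closedBall 0 R
  have hBB : IsCompact (B ×ˢ B) := hB.prod hB
  set ν : Measure V := volume.restrict B
  have hint : ∀ {f : V × V → ℝ}, Continuous f → Integrable f (ν.prod ν) := fun {f} hf => by
    have := hf.continuousOn.integrableOn_compact (μ := (volume : Measure (V × V))) hBB
    rwa [IntegrableOn, Measure.volume_eq_prod, ← Measure.prod_restrict] at this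
  have hwc := hw.continuous
  have c1 : Continuous fun p : V × V => ‖w p.1‖ ^ 2 * ρ p.2 := by fun_prop
  have c2 : Continuous fun p : V × V => ρ p.2 * ‖w p.2‖ ^ 2 := by fun_prop
  have c3 : Continuous fun p : V × V => ‖w p.1 - w p.2‖ ^ 2 := by fun_prop
  have hP : 0 ≤ P := (hρ0 0).trans (hρP 0)
  have e1 : ∫ p, ‖w p.1‖ ^ 2 * ρ p.2 ∂(ν.prod ν) = (∫ x in B, ‖w x‖ ^ 2) * ∫ x in B, ρ x :=
    integral_prod_mul (fun x => ‖w x‖ ^ 2) ρ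
  have e2 : ∫ p, ρ p.2 * ‖w p.2‖ ^ 2 ∂(ν.prod ν) =
      (∫ _ in B, (1 : ℝ)) * ∫ x in B, ρ x * ‖w x‖ ^ 2 := by
    simpa only [one_mul] using
      integral_prod_mul (μ := ν) (ν := ν) (fun _ => (1 : ℝ)) (fun x => ρ x * ‖w x‖ ^ 2)
  have e3 : ∫ p, ‖w p.1 - w p.2‖ ^ 2 ∂(ν.prod ν) ≤
      (2 * R) ^ 2 * volume.real (Metric.closedBall (0 : V) (2 * R)) *
        ∫ x, ‖fderiv ℝ w x‖ ^ 2 := by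
    have hpos : 0 ≤ (2 * R) ^ 2 * volume.real (Metric.closedBall (0 : V) (2 * R)) *
        ∫ x, ‖fderiv ℝ w x‖ ^ 2 := by
      have := integral_nonneg (μ := volume) (f := fun x : V => ‖fderiv ℝ w x‖ ^ 2)
        fun x => sq_nonneg _
      positivity
    rw [← ENNReal.ofReal_le_ofReal_iff hpos, ofReal_integral_eq_lintegral_ofReal (hint c3)
      (Eventually.of_forall fun p => sq_nonneg _), lintegral_prod
      (fun p : V × V => ENNReal.ofReal (‖w p.1 - w p.2‖ ^ 2))
      (ENNReal.continuous_ofReal.comp c3).measurable.aemeasurable,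
      ENNReal.ofReal_mul (by positivity), ENNReal.ofReal_mul (by positivity),
      ofReal_integral_eq_lintegral_ofReal hD (Eventually.of_forall fun p => sq_nonneg _),
      ofReal_measureReal (measure_closedBall_lt_top.ne)]
    exact lintegral_lintegral_sub_sq_le hw R
  -- Pointwise |w(x)|² ≤ 2|w(y)|² + 2|w(x)-w(y)|². Weighting by ρ(y) makes the first term the
  -- kinetic energy at y; in the second, ρ(y) is replaced by its bound `P`.
  have e4 : ∫ p, ‖w p.1‖ ^ 2 * ρ p.2 ∂(ν.prod ν) ≤
      ∫ p, (2 * (ρ p.2 * ‖w p.2‖ ^ 2) + 2 * P * ‖w p.1 - w p.2‖ ^ 2) ∂(ν.prod ν) := by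
    refine integral_mono (hint c1) (((hint c2).const_mul 2).add ((hint c3).const_mul (2 * P)))
      fun p => ?_
    have h1 : ‖w p.1‖ ≤ ‖w p.2‖ + ‖w p.1 - w p.2‖ := by
      simpa using norm_add_le (w p.2) (w p.1 - w p.2)
    have h2 : ‖w p.1‖ ^ 2 ≤ 2 * ‖w p.2‖ ^ 2 + 2 * ‖w p.1 - w p.2‖ ^ 2 := by
      nlinarith [norm_nonneg (w p.1), sq_nonneg (‖w p.2‖ - ‖w p.1 - w p.2‖)]
    have h3 := mul_le_mul_of_nonneg_right h2 (hρ0 p.2)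
    have h4 := mul_le_mul_of_nonneg_left (hρP p.2) (sq_nonneg ‖w p.1 - w p.2‖)
    dsimp only
    nlinarith
  have i1 : ∫ x in B, ρ x = ∫ x, ρ x := setIntegral_eq_integral_of_forall_compl_eq_zero hs
  have i2 : ∫ x in B, ρ x * ‖w x‖ ^ 2 = ∫ x, ρ x * ‖w x‖ ^ 2 :=
    setIntegral_eq_integral_of_forall_compl_eq_zero fun x hx => by rw [hs x hx, zero_mul]
  rw [integral_add ((hint c2).const_mul 2) ((hint c3).const_mul (2 * P)), integral_const_mul,
    integral_const_mul, e1, e2, i1, i2] at e4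
  have i3 : ∫ _ in B, (1 : ℝ) = volume.real B := by simp
  rw [i3] at e4
  nlinarith [mul_le_mul_of_nonneg_left e3 (mul_nonneg zero_le_two hP)]

end Poincare

/-! ### Comparing the Frobenius norm with the operator norm and the trace -/

section Frobenius

variable {n : ℕ}

theorem frobL_self_nonneg (A : Space n →L[ℝ] Space n) : 0 ≤ frobL A A := by
  rw [frobL_apply]
  exact Finset.sum_nonneg fun i _ => real_inner_self_nonneg

theorem sq_norm_le_frobL (A : Space n →L[ℝ] Space n) : ‖A‖ ^ 2 ≤ frobL A A := by
  have h : ‖A‖ ≤ Real.sqrt (frobL A A) := by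
    refine A.opNorm_le_bound (Real.sqrt_nonneg _) fun v => ?_
    have h1 : ‖A v‖ ≤ ∑ i, ‖A (stdVec i)‖ * ‖v i‖ := by
      conv_lhs => rw [← sum_stdVec v]
      rw [map_sum]
      refine (norm_sum_le _ _).trans (Finset.sum_le_sum fun i _ => ?_)
      rw [map_smul, norm_smul, mul_comm]
    have h2 := Real.sum_mul_le_sqrt_mul_sqrt Finset.univ (fun i => ‖A (stdVec i)‖) (fun i => ‖v i‖)
    rw [EuclideanSpace.norm_eq v, frobL_apply]
    simp only [real_inner_self_eq_norm_sq]
    exact h1.trans h2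
  calc ‖A‖ ^ 2 ≤ Real.sqrt (frobL A A) ^ 2 := pow_le_pow_left₀ (norm_nonneg _) h 2
    _ = _ := Real.sq_sqrt (frobL_self_nonneg A)

/-- Cauchy–Schwarz on the diagonal entries; it lets the dissipation μ|Dw|² absorb terms that are
linear in div w. -/
theorem traceL_sq_le (A : Space n →L[ℝ] Space n) : traceL A ^ 2 ≤ n * frobL A A := by
  rw [traceL_apply, frobL_apply]
  refine (sq_sum_le_card_mul_sum_sq).trans ?_
  rw [Finset.card_univ, Fintype.card_fin]
  refine mul_le_mul_of_nonneg_left (Finset.sum_le_sum fun i _ => ?_) (Nat.cast_nonneg n)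
  rw [real_inner_self_eq_norm_sq, EuclideanSpace.norm_sq_eq]
  refine le_trans ?_ (Finset.single_le_sum (f := fun j => ‖A (stdVec i) j‖ ^ 2)
    (fun j _ => sq_nonneg _) (Finset.mem_univ i))
  simp

end Frobenius

/-! ### Transport theorem and conservation of mass -/

section Transport

variable {n : ℕ} {a μ lam T R t : ℝ} {ρ : ℝ → Space n → ℝ} {u : ℝ → Space n → Space n}

theorem hasCompactSupport_of_eq_zero {F : Type*} [Zero F] {f : Space n → F}
    (h : ∀ x, R < ‖x‖ → f x = 0) : HasCompactSupport f :=
  HasCompactSupport.intro (isCompact_closedBall 0 R) fun x hx =>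
    h x (by simpa using hx)

theorem setIntegral_closedBall_eq_integral {f : Space n → ℝ} (h : ∀ x, R < ‖x‖ → f x = 0) :
    ∫ x in Metric.closedBall 0 R, f x = ∫ x, f x :=
  setIntegral_eq_integral_of_forall_compl_eq_zero fun x hx => h x (by simpa using hx)

theorem deriv_eq_zero_of_eq_zero (ht : t ∈ Ioo 0 T) {f : ℝ → ℝ} (h : ∀ s ∈ Icc 0 T, f s = 0) :
    deriv f t = 0 := by
  have : f =ᶠ[𝓝 t] fun _ => 0 := by
    filter_upwards [Icc_mem_nhds ht.1 ht.2] with s hs using h s hs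
  rw [this.deriv_eq, deriv_const]

/-- The transport theorem for densities. -/
theorem StrongSolution.hasDerivAt_integral_mul (S : StrongSolution a μ lam T ρ u)
    (hs : ∀ t ∈ Icc 0 T, ∀ x, R < ‖x‖ → ρ t x = 0) {G : ℝ → Space n → ℝ}
    (hG : ContDiff ℝ 1 (fun p : ℝ × Space n => G p.1 p.2)) (ht : t ∈ Ioo 0 T) :
    HasDerivAt (fun s => ∫ x in Metric.closedBall 0 R, ρ s x * G s x)
      (∫ x, ρ t x * (deriv (fun s => G s x) t + fderiv ℝ (G t) x (u t x))) t := by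
  have ht' := Ioo_subset_Icc_self ht
  have hρ := ContDiff.slice S.density_contDiff t
  have hu := ContDiff.slice S.velocity_contDiff t
  have hGt := ContDiff.slice hG t
  have h := hasDerivAt_setIntegral_of_contDiff (F := fun s x => ρ s x * G s x)
    (S.density_contDiff.mul hG) (isCompact_closedBall (0 : Space n) R) t
  refine h.congr_deriv ?_
  have hd : ∀ x, deriv (fun s => ρ s x * G s x) t =
      deriv (fun s => ρ s x) t * G t x + ρ t x * deriv (fun s => G s x) t := fun x =>
    deriv_fun_mul (differentiableAt_slice S.density_contDiff t x) (differentiableAt_slice hG t x)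
  rw [setIntegral_closedBall_eq_integral fun x hx => by
    rw [hd, hs t ht' x hx, deriv_eq_zero_of_eq_zero ht fun s hs' => hs s hs' x hx]; ring]
  have hg : ContDiff ℝ 1 fun x => ρ t x * G t x := hρ.mul hGt
  have hgc : HasCompactSupport fun x => ρ t x * G t x :=
    (hasCompactSupport_of_eq_zero (hs t ht')).mul_right
  have hz := integral_divg_smul_eq_zero hg hgc hu
  have hfd : ∀ x v, fderiv ℝ (fun x => ρ t x * G t x) x v =
      ρ t x * fderiv ℝ (G t) x v + G t x * fderiv ℝ (ρ t) x v := fun x v => by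
    rw [fderiv_fun_mul (hρ.differentiable one_ne_zero x) (hGt.differentiable one_ne_zero x)]
    simp
  -- By the continuity equation, ∂ₜ(ρG) equals ρ(∂ₜ + u·∇)G minus the divergence of ρGu, which is
  -- compactly supported and integrates to zero.
  have e : ∀ x, deriv (fun s => ρ s x * G s x) t =
      ρ t x * (deriv (fun s => G s x) t + fderiv ℝ (G t) x (u t x)) -
        (fderiv ℝ (fun x => ρ t x * G t x) x (u t x) + ρ t x * G t x * divg (u t) x) := fun x => by
    rw [hd, hfd]
    linear_combination G t x * S.continuity t ht x
  simp_rw [e]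
  have i1 : Integrable fun x => ρ t x * (deriv (fun s => G s x) t + fderiv ℝ (G t) x (u t x)) :=
    (hρ.continuous.mul ((continuous_deriv_slice_right hG t).add
      ((hGt.continuous_fderiv one_ne_zero).clm_apply hu.continuous))).integrable_of_hasCompactSupport
      (hasCompactSupport_of_eq_zero (hs t ht')).mul_right
  have i2 : Integrable fun x =>
      fderiv ℝ (fun x => ρ t x * G t x) x (u t x) + ρ t x * G t x * divg (u t) x := by
    refine Continuous.integrable_of_hasCompactSupport (((hg.continuous_fderiv
      one_ne_zero).clm_apply hu.continuous).add (hg.continuous.mul (continuous_divg hu))) ?_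
    refine hasCompactSupport_of_eq_zero (R := R) fun x hx => ?_
    have : (fun x => ρ t x * G t x) =ᶠ[𝓝 x] fun _ => 0 := by
      filter_upwards [(isOpen_lt continuous_const continuous_norm).mem_nhds hx] with y hy
      rw [hs t ht' y hy, zero_mul]
    rw [this.fderiv_eq, hs t ht' x hx]
    simp
  rw [integral_sub i1 i2, hz, sub_zero]

/-- Conservation of mass. -/
theorem StrongSolution.integral_density_eq (S : StrongSolution a μ lam T ρ u)
    (hs : ∀ t ∈ Icc 0 T, ∀ x, R < ‖x‖ → ρ t x = 0) (ht : t ∈ Icc 0 T) :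
    ∫ x, ρ t x = ∫ x, ρ 0 x := by
  have hc : Continuous fun s => ∫ x in Metric.closedBall 0 R, ρ s x :=
    continuous_iff_continuousAt.2 fun s =>
      (hasDerivAt_setIntegral_of_contDiff S.density_contDiff
        (isCompact_closedBall (0 : Space n) R) s).continuousAt
  have h := eq_of_hasDerivAt_zero ht.1 hc.continuousOn fun r hr => by
    have := S.hasDerivAt_integral_mul hs (G := fun _ _ => 1) contDiff_const
      (⟨hr.1, hr.2.trans_le ht.2⟩ : r ∈ Ioo 0 T)
    simpa using this
  rwa [setIntegral_closedBall_eq_integral (hs t ht),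
    setIntegral_closedBall_eq_integral (hs 0 ⟨le_rfl, ht.1.trans ht.2⟩)] at h

end Transport

/-! ### Regularity and integrability of the stress -/

section Stress

variable {n : ℕ} {a μ lam T R t : ℝ} {ρ : ℝ → Space n → ℝ} {u : ℝ → Space n → Space n}

theorem continuous_matDeriv (hu : ContDiff ℝ 1 (fun p : ℝ × Space n => u p.1 p.2)) :
    Continuous fun p : ℝ × Space n => matDeriv u p.1 p.2 :=
  (continuous_deriv_slice hu).add ((continuous_fderiv_slice hu).clm_apply hu.continuous)

theorem continuous_matDeriv_slice (hu : ContDiff ℝ 1 (fun p : ℝ × Space n => u p.1 p.2)) (t : ℝ) :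
    Continuous (matDeriv u t) :=
  (continuous_matDeriv hu).comp (Continuous.prodMk_right t)

/-- The viscous part of the stress, as a linear map of the velocity gradient. -/
def viscousL (n : ℕ) (μ lam : ℝ) :
    (Space n →L[ℝ] Space n) →L[ℝ] (Space n →L[ℝ] Space n) →L[ℝ] ℝ :=
  μ • frobL + (lam + μ) • (traceL.smulRight traceL)

theorem viscousL_apply (A B : Space n →L[ℝ] Space n) :
    viscousL n μ lam A B = μ * frobL A B + (lam + μ) * (traceL A * traceL B) := by
  simp [viscousL]

theorem stress_eq (a μ lam : ℝ) (ρ : ℝ → Space n → ℝ) (u : ℝ → Space n → Space n) (t : ℝ)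
    (x : Space n) : stress a μ lam ρ u t x =
      viscousL n μ lam (fderiv ℝ (u t) x) - (a * ρ t x) • traceL := by
  ext A
  simp only [stress, viscousL, divg, _root_.add_apply, _root_.smul_apply, _root_.sub_apply,
    smul_eq_mul, ContinuousLinearMap.smulRight_apply]
  ring

theorem StrongSolution.continuous_stress (S : StrongSolution a μ lam T ρ u) (t : ℝ) :
    Continuous (stress a μ lam ρ u t) := by
  have h1 : Continuous fun x => viscousL n μ lam (fderiv ℝ (u t) x) :=
    (viscousL n μ lam).continuous.comp
      ((ContDiff.slice S.velocity_contDiff t).continuous_fderiv one_ne_zero)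
  have h2 : Continuous fun x => (a * ρ t x) • (traceL : (Space n →L[ℝ] Space n) →L[ℝ] ℝ) :=
    (continuous_const.mul (ContDiff.slice S.density_contDiff t).continuous).smul continuous_const
  exact (h1.sub h2).congr fun x => (stress_eq a μ lam ρ u t x).symm

/-- The viscous part is linear in the velocity gradient, and the pressure is continuous with compact
support. -/
theorem StrongSolution.memLp_stress (S : StrongSolution a μ lam T ρ u)
    (hs : ∀ t ∈ Icc 0 T, ∀ x, R < ‖x‖ → ρ t x = 0) (ht : t ∈ Icc 0 T) :
    MemLp (stress a μ lam ρ u t) 2 := by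
  have h1 : MemLp (fun x => viscousL n μ lam (fderiv ℝ (u t) x)) 2 :=
    (viscousL n μ lam).comp_memLp' (S.memLp t ht).2
  have h2 : MemLp (fun x => (a * ρ t x) • (traceL : (Space n →L[ℝ] Space n) →L[ℝ] ℝ)) 2 := by
    have hc : Continuous fun x => (a * ρ t x) • (traceL : (Space n →L[ℝ] Space n) →L[ℝ] ℝ) :=
      (continuous_const.mul (ContDiff.slice S.density_contDiff t).continuous).smul continuous_const
    exact hc.memLp_of_hasCompactSupport (hasCompactSupport_of_eq_zero (R := R) fun x hx => by
      rw [hs t ht x hx, mul_zero, zero_smul])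
  exact (h1.sub h2).congr_norm (S.continuous_stress t).aestronglyMeasurable
    (Eventually.of_forall fun x => by rw [stress_eq]; rfl)

end Stress

/-! ### Relative energy: identities for the difference of two solutions -/

section Uniqueness

variable {n : ℕ} {a μ lam T R t : ℝ} {ρ₁ ρ₂ : ℝ → Space n → ℝ} {u₁ u₂ : ℝ → Space n → Space n}

/-- The difference of the two momentum balances, as a density tested with the difference of the
velocities. -/
def momentumGap (a μ lam : ℝ) (ρ₁ ρ₂ : ℝ → Space n → ℝ) (u₁ u₂ : ℝ → Space n → Space n) (t : ℝ)
    (x : Space n) : ℝ :=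
  (ρ₁ t x • innerSL ℝ (matDeriv u₁ t x) - ρ₂ t x • innerSL ℝ (matDeriv u₂ t x)) (u₁ t x - u₂ t x) +
    (stress a μ lam ρ₁ u₁ t x - stress a μ lam ρ₂ u₂ t x)
      (fderiv ℝ (u₁ t) x - fderiv ℝ (u₂ t) x)

theorem integrable_norm_mul_norm {F G : Type*} [NormedAddCommGroup F] [NormedAddCommGroup G]
    {f : Space n → F} {g : Space n → G} (hf : MemLp f 2) (hg : MemLp g 2) :
    Integrable fun x => ‖f x‖ * ‖g x‖ :=
  hf.norm.integrable_mul hg.norm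

/-- The difference of velocities has no compact support, but it and its gradient are in L², as is
the difference of stresses, so it is an admissible test field by the cut-off argument of
`integral_weak_form_of_integrable`. -/
theorem integral_momentumGap (S₁ : StrongSolution a μ lam T ρ₁ u₁)
    (S₂ : StrongSolution a μ lam T ρ₂ u₂)
    (hs₁ : ∀ t ∈ Icc 0 T, ∀ x, R < ‖x‖ → ρ₁ t x = 0)
    (hs₂ : ∀ t ∈ Icc 0 T, ∀ x, R < ‖x‖ → ρ₂ t x = 0) (ht : t ∈ Ioo 0 T) :
    Integrable (momentumGap a μ lam ρ₁ ρ₂ u₁ u₂ t) ∧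
      ∫ x, momentumGap a μ lam ρ₁ ρ₂ u₁ u₂ t x = 0 := by
  have ht' := Ioo_subset_Icc_self ht
  have hv₁ := ContDiff.slice S₁.velocity_contDiff t
  have hv₂ := ContDiff.slice S₂.velocity_contDiff t
  have hr₁ := ContDiff.slice S₁.density_contDiff t
  have hr₂ := ContDiff.slice S₂.density_contDiff t
  have hi : ∀ (ρ : Space n → ℝ) (v : Space n → Space n), Continuous ρ → Continuous v →
      Continuous fun x => ρ x • innerSL ℝ (v x) := fun ρ v h1 h2 =>
    h1.smul ((innerSL ℝ : Space n →L[ℝ] Space n →L[ℝ] ℝ).continuous.comp h2)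
  have k₁ := hi _ _ hr₁.continuous (continuous_matDeriv_slice S₁.velocity_contDiff t)
  have k₂ := hi _ _ hr₂.continuous (continuous_matDeriv_slice S₂.velocity_contDiff t)
  have hw : ContDiff ℝ 1 fun x => u₁ t x - u₂ t x := hv₁.sub hv₂
  have hDw : ∀ x, fderiv ℝ (fun x => u₁ t x - u₂ t x) x = fderiv ℝ (u₁ t) x - fderiv ℝ (u₂ t) x :=
    fun x => fderiv_fun_sub (hv₁.differentiable one_ne_zero x) (hv₂.differentiable one_ne_zero x)
  have hst := (S₁.continuous_stress t).sub (S₂.continuous_stress t)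
  have hstL : MemLp (fun x => stress a μ lam ρ₁ u₁ t x - stress a μ lam ρ₂ u₂ t x) 2 :=
    (S₁.memLp_stress hs₁ ht').sub (S₂.memLp_stress hs₂ ht')
  have hwL : MemLp (fun x => u₁ t x - u₂ t x) 2 := (S₁.memLp t ht').1.sub (S₂.memLp t ht').1
  have hDL : MemLp (fun x => fderiv ℝ (u₁ t) x - fderiv ℝ (u₂ t) x) 2 :=
    (S₁.memLp t ht').2.sub (S₂.memLp t ht').2
  have i0 : Integrable fun x => (ρ₁ t x • innerSL ℝ (matDeriv u₁ t x) -
      ρ₂ t x • innerSL ℝ (matDeriv u₂ t x)) (u₁ t x - u₂ t x) :=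
    ((k₁.sub k₂).clm_apply hw.continuous).integrable_of_hasCompactSupport
      (hasCompactSupport_of_eq_zero (R := R) fun x hx => by
        simp [hs₁ t ht' x hx, hs₂ t ht' x hx])
  have i1 : Integrable fun x => (stress a μ lam ρ₁ u₁ t x - stress a μ lam ρ₂ u₂ t x)
      (fderiv ℝ (u₁ t) x - fderiv ℝ (u₂ t) x) := by
    refine (integrable_norm_mul_norm hstL hDL).mono'
      (Continuous.aestronglyMeasurable ?_)
      (Eventually.of_forall fun x => ContinuousLinearMap.le_opNorm _ _)
    exact hst.clm_apply ((hv₁.continuous_fderiv one_ne_zero).sub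
      (hv₂.continuous_fderiv one_ne_zero))
  have i : Integrable (momentumGap a μ lam ρ₁ ρ₂ u₁ u₂ t) := i0.add i1
  refine ⟨i, ?_⟩
  have key := integral_weak_form_of_integrable (φ := fun x => u₁ t x - u₂ t x)
    (K₀ := fun x => ρ₁ t x • innerSL ℝ (matDeriv u₁ t x) - ρ₂ t x • innerSL ℝ (matDeriv u₂ t x))
    (K₁ := fun x => stress a μ lam ρ₁ u₁ t x - stress a μ lam ρ₂ u₂ t x)
    (k₁.sub k₂) hst ?_ hw ?_ (integrable_norm_mul_norm hstL hwL)
  · simp only [hDw] at key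
    exact key
  · intro Φ hΦ hc
    have m₁ := S₁.momentum t ht Φ hΦ hc
    have m₂ := S₂.momentum t ht Φ hΦ hc
    have hΦ' := hΦ.continuous_fderiv one_ne_zero
    have hj : ∀ (K : Space n → Space n →L[ℝ] ℝ) (L : Space n → (Space n →L[ℝ] Space n) →L[ℝ] ℝ),
        Continuous K → Continuous L → Integrable fun x => K x (Φ x) + L x (fderiv ℝ Φ x) :=
      fun K L hK hL => ((hK.clm_apply hΦ.continuous).add
        (hL.clm_apply hΦ')).integrable_of_hasCompactSupport
        (HasCompactSupport.intro hc fun x hx => by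
          have h1 : Φ x = 0 := image_eq_zero_of_notMem_tsupport hx
          have h2 : fderiv ℝ Φ x = 0 :=
            image_eq_zero_of_notMem_tsupport fun h => hx (tsupport_fderiv_subset ℝ h)
          change K x (Φ x) + L x (fderiv ℝ Φ x) = 0
          rw [h1, h2, map_zero, map_zero, add_zero])
    rw [← sub_eq_zero.2 (m₁.trans m₂.symm), ← integral_sub (hj _ _ k₁ (S₁.continuous_stress t))
      (hj _ _ k₂ (S₂.continuous_stress t))]
    refine integral_congr_ae (Eventually.of_forall fun x => ?_)
    simp only [_root_.sub_apply]
    ring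
  · simp only [hDw]
    exact i

/-- Transport of |w|² by the first flow, with w = u₁ - u₂. Transporting u₂ by u₁ instead of by
itself produces the extra term Du₂(w). -/
theorem hasDerivAt_integral_kinetic_gap (S₁ : StrongSolution a μ lam T ρ₁ u₁)
    (S₂ : StrongSolution a μ lam T ρ₂ u₂)
    (hs₁ : ∀ t ∈ Icc 0 T, ∀ x, R < ‖x‖ → ρ₁ t x = 0) (ht : t ∈ Ioo 0 T) :
    HasDerivAt (fun s => ∫ x in Metric.closedBall 0 R, ρ₁ s x * ‖u₁ s x - u₂ s x‖ ^ 2)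
      (∫ x, 2 * (ρ₁ t x * ⟪u₁ t x - u₂ t x,
        matDeriv u₁ t x - matDeriv u₂ t x - fderiv ℝ (u₂ t) x (u₁ t x - u₂ t x)⟫_ℝ)) t := by
  have hw : ContDiff ℝ 1 fun p : ℝ × Space n => u₁ p.1 p.2 - u₂ p.1 p.2 :=
    S₁.velocity_contDiff.sub S₂.velocity_contDiff
  have hv₁ := ContDiff.slice S₁.velocity_contDiff t
  have hv₂ := ContDiff.slice S₂.velocity_contDiff t
  refine (S₁.hasDerivAt_integral_mul hs₁ (G := fun s x => ‖u₁ s x - u₂ s x‖ ^ 2)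
    (hw.norm_sq ℝ) ht).congr_deriv (integral_congr_ae (Eventually.of_forall fun x => ?_))
  have d₁ := differentiableAt_slice S₁.velocity_contDiff t x
  have d₂ := differentiableAt_slice S₂.velocity_contDiff t x
  have e1 : deriv (fun s => ‖u₁ s x - u₂ s x‖ ^ 2) t = 2 * ⟪u₁ t x - u₂ t x,
      deriv (fun s => u₁ s x) t - deriv (fun s => u₂ s x) t⟫_ℝ :=
    ((d₁.hasDerivAt.fun_sub d₂.hasDerivAt).norm_sq).deriv
  have e2 : fderiv ℝ (fun x => ‖u₁ t x - u₂ t x‖ ^ 2) x (u₁ t x) = 2 * ⟪u₁ t x - u₂ t x,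
      fderiv ℝ (u₁ t) x (u₁ t x) - fderiv ℝ (u₂ t) x (u₁ t x)⟫_ℝ := by
    rw [((hv₁.differentiable one_ne_zero x).hasFDerivAt.fun_sub
      (hv₂.differentiable one_ne_zero x).hasFDerivAt).norm_sq.fderiv]
    simp [inner_sub_left, inner_sub_right]
  dsimp only
  rw [e1, e2, ← mul_add, ← inner_add_right, matDeriv, matDeriv, map_sub]
  rw [mul_left_comm]
  congr 4
  abel

theorem hasDerivAt_integral_density_gap (S₁ : StrongSolution a μ lam T ρ₁ u₁)
    (S₂ : StrongSolution a μ lam T ρ₂ u₂)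
    (hs₁ : ∀ t ∈ Icc 0 T, ∀ x, R < ‖x‖ → ρ₁ t x = 0)
    (hs₂ : ∀ t ∈ Icc 0 T, ∀ x, R < ‖x‖ → ρ₂ t x = 0) (ht : t ∈ Ioo 0 T) :
    HasDerivAt (fun s => ∫ x in Metric.closedBall 0 R, (ρ₁ s x - ρ₂ s x) ^ 2)
      (∫ x, -((ρ₁ t x - ρ₂ t x) * ((ρ₁ t x - ρ₂ t x) * divg (u₁ t) x +
        2 * fderiv ℝ (ρ₂ t) x (u₁ t x - u₂ t x) +
        2 * ρ₂ t x * (divg (u₁ t) x - divg (u₂ t) x)))) t := by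
  have ht' := Ioo_subset_Icc_self ht
  have hv₁ := ContDiff.slice S₁.velocity_contDiff t
  have hv₂ := ContDiff.slice S₂.velocity_contDiff t
  have hr₁ := ContDiff.slice S₁.density_contDiff t
  have hr₂ := ContDiff.slice S₂.density_contDiff t
  have h := hasDerivAt_setIntegral_of_contDiff (F := fun s x => (ρ₁ s x - ρ₂ s x) ^ 2)
    ((S₁.density_contDiff.sub S₂.density_contDiff).pow 2) (isCompact_closedBall (0 : Space n) R) t
  refine h.congr_deriv ?_
  have hd : ∀ x, deriv (fun s => (ρ₁ s x - ρ₂ s x) ^ 2) t =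
      2 * (ρ₁ t x - ρ₂ t x) * (deriv (fun s => ρ₁ s x) t - deriv (fun s => ρ₂ s x) t) := fun x => by
    have := ((differentiableAt_slice S₁.density_contDiff t x).hasDerivAt.fun_sub
      (differentiableAt_slice S₂.density_contDiff t x).hasDerivAt).fun_pow 2
    rw [this.deriv]
    simp
  have hz : ∀ x, R < ‖x‖ → ρ₁ t x - ρ₂ t x = 0 := fun x hx => by
    rw [hs₁ t ht' x hx, hs₂ t ht' x hx, sub_zero]
  rw [setIntegral_closedBall_eq_integral fun x hx => by rw [hd, hz x hx]; ring]
  have hg : ContDiff ℝ 1 fun x => (ρ₁ t x - ρ₂ t x) ^ 2 := (hr₁.sub hr₂).pow 2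
  have hgc : HasCompactSupport fun x => (ρ₁ t x - ρ₂ t x) ^ 2 :=
    hasCompactSupport_of_eq_zero (R := R) fun x hx => by rw [hz x hx]; ring
  have hI := integral_divg_smul_eq_zero hg hgc hv₁
  have hfd : ∀ x v, fderiv ℝ (fun x => (ρ₁ t x - ρ₂ t x) ^ 2) x v =
      2 * (ρ₁ t x - ρ₂ t x) * (fderiv ℝ (ρ₁ t) x v - fderiv ℝ (ρ₂ t) x v) := fun x v => by
    have := (((hr₁.differentiable one_ne_zero x).hasFDerivAt.fun_sub
      (hr₂.differentiable one_ne_zero x).hasFDerivAt).pow 2)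
    rw [this.fderiv]
    simp
  have e : ∀ x, deriv (fun s => (ρ₁ s x - ρ₂ s x) ^ 2) t =
      -((ρ₁ t x - ρ₂ t x) * ((ρ₁ t x - ρ₂ t x) * divg (u₁ t) x +
        2 * fderiv ℝ (ρ₂ t) x (u₁ t x - u₂ t x) +
        2 * ρ₂ t x * (divg (u₁ t) x - divg (u₂ t) x))) -
      (fderiv ℝ (fun x => (ρ₁ t x - ρ₂ t x) ^ 2) x (u₁ t x) +
        (ρ₁ t x - ρ₂ t x) ^ 2 * divg (u₁ t) x) := fun x => by
    rw [hd, hfd, map_sub]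
    linear_combination 2 * (ρ₁ t x - ρ₂ t x) * S₁.continuity t ht x -
      2 * (ρ₁ t x - ρ₂ t x) * S₂.continuity t ht x
  simp_rw [e]
  have c1 : Continuous fun x => divg (u₁ t) x := continuous_divg hv₁
  have c2 : Continuous fun x => divg (u₂ t) x := continuous_divg hv₂
  have c3 : Continuous fun x => fderiv ℝ (ρ₂ t) x (u₁ t x - u₂ t x) :=
    (hr₂.continuous_fderiv one_ne_zero).clm_apply (hv₁.continuous.sub hv₂.continuous)
  have c4 : Continuous fun x => fderiv ℝ (fun x => (ρ₁ t x - ρ₂ t x) ^ 2) x (u₁ t x) :=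
    (hg.continuous_fderiv one_ne_zero).clm_apply hv₁.continuous
  have c5 := hr₁.continuous
  have c6 := hr₂.continuous
  rw [integral_sub, hI, sub_zero]
  · exact Continuous.integrable_of_hasCompactSupport (by fun_prop)
      (hasCompactSupport_of_eq_zero (R := R) fun x hx => by rw [hz x hx]; ring)
  · refine Continuous.integrable_of_hasCompactSupport (by fun_prop)
      (hasCompactSupport_of_eq_zero (R := R) fun x hx => ?_)
    rw [hfd, hz x hx]; ring

end Uniqueness

/-! ### Relative energy: estimates and uniqueness of the velocity -/

section Uniqueness

variable {n : ℕ} {a μ lam T R t : ℝ} {ρ₁ ρ₂ : ℝ → Space n → ℝ} {u₁ u₂ : ℝ → Space n → Space n}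

/-- A form of Grönwall's inequality for functions that vanish initially. -/
theorem eq_zero_of_hasDerivAt_le {Y Y' : ℝ → ℝ} {K T : ℝ} (hY : Continuous Y) (h0 : Y 0 = 0)
    (hpos : ∀ t ∈ Icc 0 T, 0 ≤ Y t) (hd : ∀ t ∈ Ioo 0 T, HasDerivAt Y (Y' t) t)
    (hle : ∀ t ∈ Ioo 0 T, Y' t ≤ K * Y t) : ∀ t ∈ Icc 0 T, Y t = 0 := by
  have hz : ∀ t ∈ Ioo 0 T, HasDerivAt (fun t => Y t * Real.exp (-K * t))
      (Y' t * Real.exp (-K * t) + Y t * (Real.exp (-K * t) * -K)) t := fun t ht => by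
    have h2 : HasDerivAt (fun s => Real.exp (-K * s)) (Real.exp (-K * t) * -K) t := by
      simpa using ((hasDerivAt_id t).const_mul (-K)).exp
    exact (hd t ht).mul h2
  have hanti : AntitoneOn (fun t => Y t * Real.exp (-K * t)) (Icc 0 T) := by
    refine antitoneOn_of_deriv_nonpos (convex_Icc _ _) (by fun_prop) ?_ ?_
    · rw [interior_Icc]
      exact fun s hs => (hz s hs).differentiableAt.differentiableWithinAt
    · rw [interior_Icc]
      intro s hs
      rw [(hz s hs).deriv]
      nlinarith [hle s hs, Real.exp_pos (-K * s)]
  intro t ht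
  have h1 := hanti ⟨le_rfl, ht.1.trans ht.2⟩ ht ht.1
  simp only [h0, zero_mul] at h1
  have h2 := Real.exp_pos (-K * t)
  exact le_antisymm (by by_contra! h; nlinarith [mul_pos h h2]) (hpos t ht)

theorem four_mul_le_young (σ C y : ℝ) {δ : ℝ} (hδ : 0 < δ) :
    4 * (|σ| * (C * y)) ≤ δ * y ^ 2 + 4 * C ^ 2 / δ * σ ^ 2 := by
  have h : δ * y ^ 2 + 4 * C ^ 2 / δ * σ ^ 2 - 4 * (|σ| * (C * y)) =
      (δ * y - 2 * C * |σ|) ^ 2 / δ := by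
    rw [← sq_abs σ]
    field_simp
    ring
  have := div_nonneg (sq_nonneg (δ * y - 2 * C * |σ|)) hδ.le
  linarith

/-- Here `d` stands for div w, `Q` for |Dw|² and `r` for ρ₂. The coefficient a - r joins the
pressure gap with the term ρ₂ div w from the density equation; the Young weight μ/(N+1) spends only
μQ of the dissipation and makes sense for N = 0 as well. -/
theorem two_mul_le_young {a r C σ d Q N μ : ℝ} (ha : 0 ≤ a) (hr : |r| ≤ C) (hμ : 0 < μ)
    (hN : 0 ≤ N) (hQ : 0 ≤ Q) (hd : d ^ 2 ≤ N * Q) :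
    2 * (a - r) * σ * d ≤ (a + C) ^ 2 * ((N + 1) / μ) * σ ^ 2 + μ * Q := by
  have hn : 0 < N + 1 := by positivity
  have h1 : |a - r| ≤ a + C := by
    rw [abs_le] at hr ⊢
    constructor <;> linarith
  have h2 : (a - r) ^ 2 ≤ (a + C) ^ 2 := by
    rw [← sq_abs]
    exact pow_le_pow_left₀ (abs_nonneg _) h1 2
  have h3 : 2 * (a - r) * σ * d ≤ (a - r) ^ 2 * ((N + 1) / μ) * σ ^ 2 + μ / (N + 1) * d ^ 2 := by
    have h : (a - r) ^ 2 * ((N + 1) / μ) * σ ^ 2 + μ / (N + 1) * d ^ 2 - 2 * (a - r) * σ * d =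
        ((N + 1) * (a - r) * σ - μ * d) ^ 2 / (μ * (N + 1)) := by
      field_simp
      ring
    have := div_nonneg (sq_nonneg ((N + 1) * (a - r) * σ - μ * d)) (mul_pos hμ hn).le
    linarith
  have h4 : μ / (N + 1) * d ^ 2 ≤ μ * Q := by
    rw [div_mul_eq_mul_div, div_le_iff₀ hn]
    nlinarith
  have h5 : (a - r) ^ 2 * ((N + 1) / μ) * σ ^ 2 ≤ (a + C) ^ 2 * ((N + 1) / μ) * σ ^ 2 := by
    gcongr
  linarith

/-- Subtracting twice the momentum gap cancels the uncontrolled acceleration D₁ and leaves -2σ⟪w,D₂⟫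
plus dissipation -2μ|Dw|². Two cross terms, each at most 2C|σ||w|, cannot be bounded by the energy
where r₁ vanishes, so they are split into σ² and δ|w|². The terms in div w use up half of the
dissipation. -/
theorem gap_integrand_le {r₁ r₂ C δ : ℝ} {w D₁ D₂ : Space n} {A₁ A₂ : Space n →L[ℝ] Space n}
    {g : Space n →L[ℝ] ℝ} (ha : 0 < a) (hμ : 0 < μ) (hlam : 0 ≤ lam + μ) (hδ : 0 < δ)
    (hr₁ : 0 ≤ r₁) (hr₂ : |r₂| ≤ C) (hA : ‖A₂‖ ≤ C) (hD : ‖D₂‖ ≤ C) (hdiv : |traceL A₁| ≤ C)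
    (hg : ‖g‖ ≤ C) :
    2 * (r₁ * ⟪w, D₁ - D₂ - A₂ w⟫_ℝ) -
        (r₁ - r₂) * ((r₁ - r₂) * traceL A₁ + 2 * g w + 2 * r₂ * (traceL A₁ - traceL A₂)) -
        2 * ((r₁ • innerSL ℝ D₁ - r₂ • innerSL ℝ D₂) w +
          (viscousL n μ lam A₁ - (a * r₁) • traceL - (viscousL n μ lam A₂ - (a * r₂) • traceL) :
            (Space n →L[ℝ] Space n) →L[ℝ] ℝ) (A₁ - A₂)) ≤
      (3 * C + (a + C) ^ 2 * ((n + 1) / μ) + 4 * C ^ 2 / δ) *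
        (r₁ * ‖w‖ ^ 2 + (r₁ - r₂) ^ 2) + δ * ‖w‖ ^ 2 - μ * frobL (A₁ - A₂) (A₁ - A₂) := by
  have hC : 0 ≤ C := (norm_nonneg _).trans hA
  set σ := r₁ - r₂ with hσ
  set d := traceL (A₁ - A₂) with hd
  set Q := frobL (A₁ - A₂) (A₁ - A₂) with hQ
  have hQ0 : 0 ≤ Q := frobL_self_nonneg _
  have hdQ : d ^ 2 ≤ n * Q := traceL_sq_le _
  have e1 : (r₁ • innerSL ℝ D₁ - r₂ • innerSL ℝ D₂) w +
      (viscousL n μ lam A₁ - (a * r₁) • traceL - (viscousL n μ lam A₂ - (a * r₂) • traceL) :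
            (Space n →L[ℝ] Space n) →L[ℝ] ℝ) (A₁ - A₂) = r₁ * ⟪w, D₁⟫_ℝ - r₂ * ⟪w, D₂⟫_ℝ + μ * Q + (lam + μ) * d ^ 2 - a * σ * d := by
    have e2 : viscousL n μ lam A₁ - (a * r₁) • traceL - (viscousL n μ lam A₂ - (a * r₂) • traceL) =
        viscousL n μ lam (A₁ - A₂) - (a * σ) • traceL := by
      rw [map_sub, hσ, mul_sub, sub_smul]
      abel
    rw [e2, _root_.sub_apply, _root_.sub_apply, viscousL_apply, _root_.smul_apply,
      _root_.smul_apply, _root_.smul_apply, innerSL_apply_apply, innerSL_apply_apply,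
      real_inner_comm, real_inner_comm D₂]
    simp only [smul_eq_mul]
    ring
  have hd' : traceL A₁ - traceL A₂ = d := (map_sub _ _ _).symm
  rw [e1, hd', inner_sub_right, inner_sub_right]
  have b1 : |⟪w, A₂ w⟫_ℝ| ≤ C * ‖w‖ ^ 2 := by
    refine (abs_real_inner_le_norm _ _).trans ?_
    have := (A₂.le_opNorm w).trans (mul_le_mul_of_nonneg_right hA (norm_nonneg w))
    nlinarith [norm_nonneg w]
  have b2 : |⟪w, D₂⟫_ℝ| ≤ C * ‖w‖ := by
    refine (abs_real_inner_le_norm _ _).trans ?_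
    nlinarith [norm_nonneg w]
  have b3 : |g w| ≤ C * ‖w‖ :=
    (g.le_opNorm w).trans (mul_le_mul_of_nonneg_right hg (norm_nonneg w))
  have t1 : -(r₁ * ⟪w, A₂ w⟫_ℝ) ≤ C * (r₁ * ‖w‖ ^ 2) := by
    nlinarith [neg_abs_le ⟪w, A₂ w⟫_ℝ]
  have t2 : -(σ * traceL A₁ * σ) ≤ C * σ ^ 2 := by
    nlinarith [neg_abs_le (traceL A₁), sq_nonneg σ]
  have y : ∀ s p : ℝ, |p| ≤ C * ‖w‖ → -(σ * p) ≤ |σ| * (C * ‖w‖) := fun s p hp => by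
    refine (neg_le_abs _).trans ?_
    rw [abs_mul]
    exact mul_le_mul_of_nonneg_left hp (abs_nonneg _)
  have t5 := four_mul_le_young σ C ‖w‖ hδ
  have t6 := two_mul_le_young (σ := σ) ha.le hr₂ hμ (Nat.cast_nonneg n) hQ0 hdQ
  have t7 : 0 ≤ (lam + μ) * d ^ 2 := mul_nonneg hlam (sq_nonneg d)
  have k3 : 0 ≤ r₁ * ‖w‖ ^ 2 := mul_nonneg hr₁ (sq_nonneg _)
  have k1 : 0 ≤ (a + C) ^ 2 * (((n : ℝ) + 1) / μ) * (r₁ * ‖w‖ ^ 2) := by positivity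
  have k2 : 0 ≤ 4 * C ^ 2 / δ * (r₁ * ‖w‖ ^ 2) := by positivity
  have k7 := mul_nonneg hC k3
  have k8 := mul_nonneg hC (sq_nonneg σ)
  have e3 : r₁ * ⟪w, D₂⟫_ℝ - r₂ * ⟪w, D₂⟫_ℝ = σ * ⟪w, D₂⟫_ℝ := by rw [hσ]; ring
  have t3 := y σ _ b2
  have t4 := y σ _ b3
  generalize (a + C) ^ 2 * (((n : ℝ) + 1) / μ) = k at *
  generalize 4 * C ^ 2 / δ = k' at *
  generalize ⟪w, D₂⟫_ℝ = q at *
  linarith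
/-- The energy of the difference of two solutions. -/
def gapEnergy (R : ℝ) (ρ₁ ρ₂ : ℝ → Space n → ℝ) (u₁ u₂ : ℝ → Space n → Space n) (s : ℝ) : ℝ :=
  (∫ x in Metric.closedBall 0 R, ρ₁ s x * ‖u₁ s x - u₂ s x‖ ^ 2) +
    ∫ x in Metric.closedBall 0 R, (ρ₁ s x - ρ₂ s x) ^ 2

/-- The dissipation density of the difference of two velocities. -/
def gapDissipation (u₁ u₂ : ℝ → Space n → Space n) (t : ℝ) (x : Space n) : ℝ :=
  frobL (fderiv ℝ (u₁ t) x - fderiv ℝ (u₂ t) x) (fderiv ℝ (u₁ t) x - fderiv ℝ (u₂ t) x)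

theorem gapDissipation_nonneg (u₁ u₂ : ℝ → Space n → Space n) (t : ℝ) (x : Space n) :
    0 ≤ gapDissipation u₁ u₂ t x :=
  frobL_self_nonneg _

theorem StrongSolution.continuous_gapDissipation (S₁ : StrongSolution a μ lam T ρ₁ u₁)
    (S₂ : StrongSolution a μ lam T ρ₂ u₂) (t : ℝ) : Continuous (gapDissipation u₁ u₂ t) := by
  have h := ((ContDiff.slice S₁.velocity_contDiff t).continuous_fderiv one_ne_zero).sub
    ((ContDiff.slice S₂.velocity_contDiff t).continuous_fderiv one_ne_zero)
  exact (frobL.continuous.comp h).clm_apply h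

theorem StrongSolution.memLp_fderiv_sub (S₁ : StrongSolution a μ lam T ρ₁ u₁)
    (S₂ : StrongSolution a μ lam T ρ₂ u₂) (ht : t ∈ Icc 0 T) :
    MemLp (fun x => fderiv ℝ (u₁ t) x - fderiv ℝ (u₂ t) x) 2 :=
  (S₁.memLp t ht).2.sub (S₂.memLp t ht).2

theorem StrongSolution.integrable_gapDissipation (S₁ : StrongSolution a μ lam T ρ₁ u₁)
    (S₂ : StrongSolution a μ lam T ρ₂ u₂) (ht : t ∈ Icc 0 T) :
    Integrable (gapDissipation u₁ u₂ t) :=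
  (integrable_norm_mul_norm (frobL.comp_memLp' (S₁.memLp_fderiv_sub S₂ ht))
    (S₁.memLp_fderiv_sub S₂ ht)).mono' (S₁.continuous_gapDissipation S₂ t).aestronglyMeasurable
    (Eventually.of_forall fun _ => ContinuousLinearMap.le_opNorm _ _)

theorem StrongSolution.fderiv_velocity_sub (S₁ : StrongSolution a μ lam T ρ₁ u₁)
    (S₂ : StrongSolution a μ lam T ρ₂ u₂) (t : ℝ) (x : Space n) :
    fderiv ℝ (fun x => u₁ t x - u₂ t x) x = fderiv ℝ (u₁ t) x - fderiv ℝ (u₂ t) x :=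
  fderiv_fun_sub ((ContDiff.slice S₁.velocity_contDiff t).differentiable one_ne_zero x)
    ((ContDiff.slice S₂.velocity_contDiff t).differentiable one_ne_zero x)

theorem gapEnergy_eq (hs₁ : ∀ x, R < ‖x‖ → ρ₁ t x = 0)
    (hs₂ : ∀ x, R < ‖x‖ → ρ₂ t x = 0) :
    gapEnergy R ρ₁ ρ₂ u₁ u₂ t = (∫ x, ρ₁ t x * ‖u₁ t x - u₂ t x‖ ^ 2) +
      ∫ x, (ρ₁ t x - ρ₂ t x) ^ 2 := by
  rw [gapEnergy,
    setIntegral_closedBall_eq_integral fun x hx => by rw [hs₁ x hx, zero_mul],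
    setIntegral_closedBall_eq_integral fun x hx => by rw [hs₁ x hx, hs₂ x hx]; ring]

theorem exists_hasDerivAt_gapEnergy_le (S₁ : StrongSolution a μ lam T ρ₁ u₁)
    (S₂ : StrongSolution a μ lam T ρ₂ u₂) (ha : 0 < a) (hμ : 0 < μ) (hlam : 0 ≤ lam + μ)
    (hs₁ : ∀ t ∈ Icc 0 T, ∀ x, R < ‖x‖ → ρ₁ t x = 0)
    (hs₂ : ∀ t ∈ Icc 0 T, ∀ x, R < ‖x‖ → ρ₂ t x = 0) (ht : t ∈ Ioo 0 T)
    (hpos : ∀ x, 0 ≤ ρ₁ t x) {C δ : ℝ} (hδ : 0 < δ)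
    (hC : ∀ x ∈ Metric.closedBall (0 : Space n) R, |ρ₂ t x| ≤ C ∧
      ‖fderiv ℝ (u₂ t) x‖ ≤ C ∧ ‖matDeriv u₂ t x‖ ≤ C ∧ |divg (u₁ t) x| ≤ C ∧
      ‖fderiv ℝ (ρ₂ t) x‖ ≤ C) :
    ∃ Y', HasDerivAt (gapEnergy R ρ₁ ρ₂ u₁ u₂) Y' t ∧
      Y' ≤ (3 * C + (a + C) ^ 2 * ((n + 1) / μ) + 4 * C ^ 2 / δ) * gapEnergy R ρ₁ ρ₂ u₁ u₂ t +
        δ * (∫ x in Metric.closedBall 0 R, ‖u₁ t x - u₂ t x‖ ^ 2) -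
        μ * ∫ x, gapDissipation u₁ u₂ t x := by
  set K : ℝ := 3 * C + (a + C) ^ 2 * ((n + 1) / μ) + 4 * C ^ 2 / δ with hK
  set B := Metric.closedBall (0 : Space n) R with hB
  have hBc : IsCompact B := isCompact_closedBall 0 R
  have hBm : MeasurableSet B := Metric.isClosed_closedBall.measurableSet
  have ht' := Ioo_subset_Icc_self ht
  have d₁ := hasDerivAt_integral_kinetic_gap S₁ S₂ hs₁ ht
  have d₂ := hasDerivAt_integral_density_gap S₁ S₂ hs₁ hs₂ ht
  obtain ⟨gi, g0⟩ := integral_momentumGap S₁ S₂ hs₁ hs₂ ht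
  refine ⟨_, HasDerivAt.fun_add d₁ d₂, ?_⟩
  have w₁ := ContDiff.slice S₁.velocity_contDiff t
  have w₂ := ContDiff.slice S₂.velocity_contDiff t
  have q₁ := ContDiff.slice S₁.density_contDiff t
  have q₂ := ContDiff.slice S₂.density_contDiff t
  have v₁ := w₁.continuous
  have v₂ := w₂.continuous
  have r₁ := q₁.continuous
  have r₂ := q₂.continuous
  have m₁ := continuous_matDeriv_slice S₁.velocity_contDiff t
  have m₂ := continuous_matDeriv_slice S₂.velocity_contDiff t
  have c1 : Continuous fun x => fderiv ℝ (u₂ t) x (u₁ t x - u₂ t x) :=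
    (w₂.continuous_fderiv one_ne_zero).clm_apply (v₁.sub v₂)
  have c2 : Continuous fun x => fderiv ℝ (ρ₂ t) x (u₁ t x - u₂ t x) :=
    (q₂.continuous_fderiv one_ne_zero).clm_apply (v₁.sub v₂)
  have c3 := continuous_divg w₁
  have c4 := continuous_divg w₂
  have i1 : Integrable fun x => 2 * (ρ₁ t x * ⟪u₁ t x - u₂ t x,
      matDeriv u₁ t x - matDeriv u₂ t x - fderiv ℝ (u₂ t) x (u₁ t x - u₂ t x)⟫_ℝ) := by
    refine Continuous.integrable_of_hasCompactSupport (by fun_prop)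
      (hasCompactSupport_of_eq_zero (R := R) fun x hx => ?_)
    rw [hs₁ t ht' x hx]; ring
  have i2 : Integrable fun x => -((ρ₁ t x - ρ₂ t x) * ((ρ₁ t x - ρ₂ t x) * divg (u₁ t) x +
      2 * fderiv ℝ (ρ₂ t) x (u₁ t x - u₂ t x) +
      2 * ρ₂ t x * (divg (u₁ t) x - divg (u₂ t) x))) := by
    refine Continuous.integrable_of_hasCompactSupport (by fun_prop)
      (hasCompactSupport_of_eq_zero (R := R) fun x hx => ?_)
    rw [hs₁ t ht' x hx, hs₂ t ht' x hx]; ring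
  have i3 : Integrable fun x => ρ₁ t x * ‖u₁ t x - u₂ t x‖ ^ 2 := by
    refine Continuous.integrable_of_hasCompactSupport (by fun_prop)
      (hasCompactSupport_of_eq_zero (R := R) fun x hx => ?_)
    rw [hs₁ t ht' x hx]; ring
  have i4 : Integrable fun x => (ρ₁ t x - ρ₂ t x) ^ 2 := by
    refine Continuous.integrable_of_hasCompactSupport (by fun_prop)
      (hasCompactSupport_of_eq_zero (R := R) fun x hx => ?_)
    rw [hs₁ t ht' x hx, hs₂ t ht' x hx]; ring
  have i5 : Integrable (B.indicator fun x => ‖u₁ t x - u₂ t x‖ ^ 2) := by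
    have hc : Continuous fun x => ‖u₁ t x - u₂ t x‖ ^ 2 := by fun_prop
    exact (hc.continuousOn.integrableOn_compact hBc).integrable_indicator hBm
  -- The momentum gap integrates to zero, so it is added with factor -2 before the integrands are
  -- compared pointwise.
  have e1 : ∫ x, (2 * (ρ₁ t x * ⟪u₁ t x - u₂ t x,
      matDeriv u₁ t x - matDeriv u₂ t x - fderiv ℝ (u₂ t) x (u₁ t x - u₂ t x)⟫_ℝ) +
      -((ρ₁ t x - ρ₂ t x) * ((ρ₁ t x - ρ₂ t x) * divg (u₁ t) x +
      2 * fderiv ℝ (ρ₂ t) x (u₁ t x - u₂ t x) +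
      2 * ρ₂ t x * (divg (u₁ t) x - divg (u₂ t) x))) +
      -2 * momentumGap a μ lam ρ₁ ρ₂ u₁ u₂ t x) ≤
      ∫ x, (K * (ρ₁ t x * ‖u₁ t x - u₂ t x‖ ^ 2 + (ρ₁ t x - ρ₂ t x) ^ 2) +
        δ * B.indicator (fun x => ‖u₁ t x - u₂ t x‖ ^ 2) x + -μ * gapDissipation u₁ u₂ t x) := by
    refine integral_mono ((i1.fun_add i2).fun_add (gi.const_mul (-2)))
      ((((i3.fun_add i4).const_mul K).fun_add (i5.const_mul _)).fun_add (((S₁.integrable_gapDissipation S₂ ht')).const_mul (-μ)))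
      fun x => ?_
    dsimp only
    by_cases hx : x ∈ B
    · obtain ⟨h2, h3, h4, h5, h6⟩ := hC x hx
      have := gap_integrand_le (a := a) (μ := μ) (lam := lam) (δ := δ)
        (w := u₁ t x - u₂ t x) (D₁ := matDeriv u₁ t x) ha hμ hlam hδ
        (hpos x) h2 h3 h4 h5 h6
      rw [indicator_of_mem hx, momentumGap, stress_eq, stress_eq]
      rw [hK, gapDissipation]
      simp only [divg]
      linarith
    -- In the common vacuum only the viscous terms remain, and they have the favourable sign, so
    -- δ|w|² is needed only inside the ball.
    · have hx' : R < ‖x‖ := by simpa [hB] using hx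
      rw [indicator_of_notMem hx, momentumGap, stress_eq, stress_eq, hs₁ t ht' x hx',
        hs₂ t ht' x hx']
      have hv : (viscousL n μ lam (fderiv ℝ (u₁ t) x) - (a * 0) • traceL -
          (viscousL n μ lam (fderiv ℝ (u₂ t) x) - (a * 0) • traceL) :
          (Space n →L[ℝ] Space n) →L[ℝ] ℝ) =
          viscousL n μ lam (fderiv ℝ (u₁ t) x - fderiv ℝ (u₂ t) x) := by
        rw [map_sub]; simp
      rw [hv, viscousL_apply]
      simp only [zero_smul, sub_zero, _root_.zero_apply, zero_mul, mul_zero, neg_zero, add_zero,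
        zero_add, ne_eq, OfNat.ofNat_ne_zero, not_false_eq_true, zero_pow]
      have h1 := mul_nonneg hlam (mul_self_nonneg
        (traceL (fderiv ℝ (u₁ t) x - fderiv ℝ (u₂ t) x)))
      have h2 := mul_nonneg hμ.le (frobL_self_nonneg (fderiv ℝ (u₁ t) x - fderiv ℝ (u₂ t) x))
      rw [gapDissipation]
      linarith
  rw [integral_add (i1.fun_add i2) (gi.const_mul (-2)), integral_add i1 i2,
    integral_const_mul (-2) (momentumGap a μ lam ρ₁ ρ₂ u₁ u₂ t), g0,
    integral_add (((i3.fun_add i4).const_mul K).fun_add (i5.const_mul _))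
      ((S₁.integrable_gapDissipation S₂ ht').const_mul (-μ)),
    integral_add ((i3.fun_add i4).const_mul K) (i5.const_mul _),
    integral_const_mul K, integral_add i3 i4, integral_const_mul δ, integral_const_mul (-μ),
    integral_indicator hBm,
    ← gapEnergy_eq (hs₁ t ht') (hs₂ t ht')] at e1
  rw [mul_zero, add_zero] at e1
  linarith

/-- Strong solutions are determined by their initial data. -/
theorem StrongSolution.velocity_unique (S₁ : StrongSolution a μ lam T ρ₁ u₁)
    (S₂ : StrongSolution a μ lam T ρ₂ u₂) (ha : 0 < a) (hμ : 0 < μ) (hlam : 0 ≤ lam + μ)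
    (hR : 0 < R) (hs₁ : ∀ t ∈ Icc 0 T, ∀ x, R < ‖x‖ → ρ₁ t x = 0)
    (hs₂ : ∀ t ∈ Icc 0 T, ∀ x, R < ‖x‖ → ρ₂ t x = 0)
    (hρ : ρ₁ 0 = ρ₂ 0) (hu : u₁ 0 = u₂ 0) (hpos : ∀ x, 0 ≤ ρ₁ 0 x) (hmass : 0 < ∫ x, ρ₁ 0 x) :
    ∀ t ∈ Ioo 0 T, u₁ t = u₂ t := by
  set B := Metric.closedBall (0 : Space n) R with hB
  have hBc : IsCompact B := isCompact_closedBall 0 R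
  have hBm : MeasurableSet B := Metric.isClosed_closedBall.measurableSet
  have cr₁ := S₁.density_contDiff.continuous
  have cr₂ := S₂.density_contDiff.continuous
  obtain ⟨C, hC⟩ : ∃ C, ∀ t ∈ Icc 0 T, ∀ x ∈ B, |ρ₁ t x| ≤ C ∧ |ρ₂ t x| ≤ C ∧
      ‖fderiv ℝ (u₂ t) x‖ ≤ C ∧ ‖matDeriv u₂ t x‖ ≤ C ∧ |divg (u₁ t) x| ≤ C ∧
      ‖fderiv ℝ (ρ₂ t) x‖ ≤ C := by
    have c1 : Continuous fun p : ℝ × Space n => ‖fderiv ℝ (u₂ p.1) p.2‖ :=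
      (continuous_fderiv_slice S₂.velocity_contDiff).norm
    have c2 : Continuous fun p : ℝ × Space n => ‖matDeriv u₂ p.1 p.2‖ :=
      (continuous_matDeriv S₂.velocity_contDiff).norm
    have c3 : Continuous fun p : ℝ × Space n => |divg (u₁ p.1) p.2| :=
      (traceL.continuous.comp (continuous_fderiv_slice S₁.velocity_contDiff)).abs
    have c4 : Continuous fun p : ℝ × Space n => ‖fderiv ℝ (ρ₂ p.1) p.2‖ :=
      (continuous_fderiv_slice S₂.density_contDiff).norm
    obtain ⟨C, hC⟩ := ((isCompact_Icc (a := 0) (b := T)).prod hBc).exists_bound_of_continuousOn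
      (((((cr₁.abs.add cr₂.abs).add c1).add c2).add c3).add c4).continuousOn
    refine ⟨C, fun t ht x hx => ?_⟩
    have h := (le_abs_self _).trans (hC (t, x) ⟨ht, hx⟩)
    simp only [Pi.add_apply] at h
    have n1 := abs_nonneg (ρ₁ t x)
    have n2 := abs_nonneg (ρ₂ t x)
    have n3 := norm_nonneg (fderiv ℝ (u₂ t) x)
    have n4 := norm_nonneg (matDeriv u₂ t x)
    have n5 := abs_nonneg (divg (u₁ t) x)
    have n6 := norm_nonneg (fderiv ℝ (ρ₂ t) x)
    refine ⟨?_, ?_, ?_, ?_, ?_, ?_⟩ <;> linarith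
  rcases le_or_gt T 0 with hT | hT
  · exact fun t ht => absurd (ht.1.trans ht.2) (not_lt.2 hT)
  have hC0 : 0 ≤ C := (abs_nonneg _).trans (hC 0 ⟨le_rfl, hT.le⟩ 0 (by simp [hB, hR.le])).1
  set M := ∫ x, ρ₁ 0 x
  set Z : ℝ := 2 * C * ((2 * R) ^ 2 * volume.real (Metric.closedBall (0 : Space n) (2 * R)))
  have hZ : 0 ≤ Z := by positivity
  -- Constant of the weighted Poincaré inequality after division by the mass; the summand 1 makes it
  -- positive.
  set A : ℝ := (2 * volume.real B + Z) / M + 1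
  have hA : 0 < A := by positivity
  -- The choice δ = μ/(2A) makes δ∫_B|w|² at most μ/2 times energy plus dissipation, so half of the
  -- dissipation survives.
  set K : ℝ := 3 * C + (a + C) ^ 2 * ((n + 1) / μ) + 4 * C ^ 2 / (μ / (2 * A))
  set Q := gapDissipation u₁ u₂
  set Y := gapEnergy R ρ₁ ρ₂ u₁ u₂ with hY
  have cw : ContDiff ℝ 1 fun p : ℝ × Space n => u₁ p.1 p.2 - u₂ p.1 p.2 :=
    S₁.velocity_contDiff.sub S₂.velocity_contDiff
  have cwt : ∀ t, ContDiff ℝ 1 fun x => u₁ t x - u₂ t x := fun t =>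
    (ContDiff.slice S₁.velocity_contDiff t).sub (ContDiff.slice S₂.velocity_contDiff t)
  have hρ₁ := fun t ht => S₁.density_nonneg (t := t) hpos ht
  have hYc : Continuous Y :=
    continuous_iff_continuousAt.2 fun s => ((hasDerivAt_setIntegral_of_contDiff
      (F := fun s x => ρ₁ s x * ‖u₁ s x - u₂ s x‖ ^ 2)
      (S₁.density_contDiff.mul (cw.norm_sq ℝ)) hBc s).add
      (hasDerivAt_setIntegral_of_contDiff (F := fun s x => (ρ₁ s x - ρ₂ s x) ^ 2)
      ((S₁.density_contDiff.sub S₂.density_contDiff).pow 2) hBc s)).continuousAt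
  have hY0 : Y 0 = 0 := by simp [hY, gapEnergy, hρ, hu]
  have hYpos : ∀ t ∈ Icc 0 T, 0 ≤ Y t := fun t ht =>
    add_nonneg (integral_nonneg fun x => mul_nonneg (hρ₁ t ht x) (sq_nonneg _))
      (integral_nonneg fun x => sq_nonneg _)
  have hQc := S₁.continuous_gapDissipation S₂
  have hDw := S₁.fderiv_velocity_sub S₂
  have hpoinc : ∀ t ∈ Icc 0 T, ∫ x in B, ‖u₁ t x - u₂ t x‖ ^ 2 ≤ A * (Y t + ∫ x, Q t x) := by
    intro t ht
    have hDi : Integrable fun x => ‖fderiv ℝ (fun x => u₁ t x - u₂ t x) x‖ ^ 2 := by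
      simp only [hDw]
      exact (S₁.memLp_fderiv_sub S₂ ht).integrable_norm_pow two_ne_zero
    have h := integral_mul_setIntegral_sq_le (P := C) (R := R) (cwt t)
      (ContDiff.slice S₁.density_contDiff t).continuous (hρ₁ t ht) (fun x => by
        by_cases hx : x ∈ B
        · exact (le_abs_self _).trans (hC t ht x hx).1
        · rw [hs₁ t ht x (by simpa [hB] using hx)]
          exact hC0) (fun x hx => hs₁ t ht x (by simpa using hx)) hDi
    rw [S₁.integral_density_eq hs₁ ht] at h
    have hle : ∫ x, ‖fderiv ℝ (fun x => u₁ t x - u₂ t x) x‖ ^ 2 ≤ ∫ x, Q t x :=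
      integral_mono hDi (S₁.integrable_gapDissipation S₂ ht) fun x => by
        dsimp only
        rw [hDw]
        exact sq_norm_le_frobL _
    have hQ0 : 0 ≤ ∫ x, Q t x := integral_nonneg fun x => gapDissipation_nonneg _ _ _ _
    have hE : 0 ≤ ∫ x, ρ₁ t x * ‖u₁ t x - u₂ t x‖ ^ 2 :=
      integral_nonneg fun x => mul_nonneg (hρ₁ t ht x) (sq_nonneg _)
    have hS : 0 ≤ ∫ x, (ρ₁ t x - ρ₂ t x) ^ 2 := integral_nonneg fun x => sq_nonneg _
    have hAM : A * M = 2 * volume.real B + Z + M := by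
      simp only [A]
      field_simp
    rw [hY, gapEnergy_eq (hs₁ t ht) (hs₂ t ht)]
    change M * _ ≤ 2 * volume.real B * _ + Z * _ at h
    have hvol : 0 ≤ volume.real B := measureReal_nonneg
    refine le_of_mul_le_mul_left ?_ hmass
    refine h.trans ?_
    rw [← mul_assoc, mul_comm M A, hAM]
    nlinarith [mul_le_mul_of_nonneg_left hle hZ, mul_nonneg hZ hE, mul_nonneg hZ hS,
      mul_nonneg hvol hQ0, mul_nonneg hvol hS, mul_nonneg hmass.le hQ0, mul_nonneg hmass.le hE,
      mul_nonneg hmass.le hS]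
  have hder : ∀ t ∈ Ioo 0 T, ∃ Y', HasDerivAt Y Y' t ∧
      Y' ≤ (K + μ / 2) * Y t - μ / 2 * ∫ x, Q t x := by
    intro t ht
    have ht' := Ioo_subset_Icc_self ht
    obtain ⟨Y', h1, h2⟩ := exists_hasDerivAt_gapEnergy_le S₁ S₂ ha hμ hlam hs₁ hs₂ ht (hρ₁ t ht')
      (show 0 < μ / (2 * A) by positivity) fun x hx => (hC t ht' x hx).2
    refine ⟨Y', h1, h2.trans ?_⟩
    have h7 := mul_le_mul_of_nonneg_left (hpoinc t ht') (show 0 ≤ μ / (2 * A) by positivity)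
    have h8 : μ / (2 * A) * (A * (Y t + ∫ x, Q t x)) = μ / 2 * (Y t + ∫ x, Q t x) := by
      field_simp
    rw [h8] at h7
    change K * Y t + _ - μ * (∫ x, Q t x) ≤ _
    linarith
  choose! Y' hY' hYle using hder
  have hYz := eq_zero_of_hasDerivAt_le (K := K + μ / 2) hYc hY0 hYpos hY' fun t ht => by
    have hQ0 : 0 ≤ ∫ x, Q t x := integral_nonneg fun x => gapDissipation_nonneg _ _ _ _
    nlinarith [hYle t ht]
  intro t ht
  have ht' := Ioo_subset_Icc_self ht
  -- The energy vanishes identically, hence so does its derivative, and the retained dissipation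
  -- must be zero. Then w is constant in space, and the Poincaré bound shows that the constant is
  -- zero, in the vacuum too.
  have hY'0 : Y' t = 0 := by
    have h : Y =ᶠ[𝓝 t] fun _ => 0 := by
      filter_upwards [Icc_mem_nhds ht.1 ht.2] with s hs using hYz s hs
    rw [← (hY' t ht).deriv, h.deriv_eq, deriv_const]
  have hQ0 : 0 ≤ ∫ x, Q t x := integral_nonneg fun x => gapDissipation_nonneg _ _ _ _
  have hQz : ∫ x, Q t x = 0 := by
    have := hYle t ht
    rw [hY'0, hYz t ht', mul_zero, zero_sub] at this
    nlinarith
  have hQx : ∀ x, Q t x = 0 := by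
    have h := (integral_eq_zero_iff_of_nonneg (fun x => gapDissipation_nonneg _ _ _ _) (S₁.integrable_gapDissipation S₂ ht')).1 hQz
    exact fun x => congrFun (((hQc t).ae_eq_iff_eq volume continuous_const).1 h) x
  have hD0 : ∀ x, fderiv ℝ (fun x => u₁ t x - u₂ t x) x = 0 := fun x => by
    have h := sq_norm_le_frobL (fderiv ℝ (u₁ t) x - fderiv ℝ (u₂ t) x)
    have h' : frobL (fderiv ℝ (u₁ t) x - fderiv ℝ (u₂ t) x)
      (fderiv ℝ (u₁ t) x - fderiv ℝ (u₂ t) x) = 0 := hQx x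
    rw [h'] at h
    rw [hDw, ← norm_eq_zero]
    exact pow_eq_zero_iff two_ne_zero |>.1 (le_antisymm h (sq_nonneg _))
  have hconst : ∀ x, u₁ t x - u₂ t x = u₁ t 0 - u₂ t 0 := fun x =>
    is_const_of_fderiv_eq_zero (𝕜 := ℝ) ((cwt t).differentiable one_ne_zero) hD0 x 0
  have h := hpoinc t ht'
  rw [hYz t ht', hQz, add_zero, mul_zero] at h
  simp only [hconst] at h
  rw [setIntegral_const, smul_eq_mul] at h
  have hvol : 0 < volume.real B :=
    ENNReal.toReal_pos (Metric.measure_closedBall_pos volume 0 hR).ne' measure_closedBall_lt_top.ne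
  have h0 : ‖u₁ t 0 - u₂ t 0‖ ^ 2 = 0 := le_antisymm (by nlinarith) (sq_nonneg _)
  funext x
  rw [← sub_eq_zero, hconst x]
  exact norm_eq_zero.1 (pow_eq_zero_iff two_ne_zero |>.1 h0)

end Uniqueness

/-! ### Invariance under isometries and propagation of symmetry -/

section Isometry

variable {n : ℕ} (Q : Space n ≃ₗᵢ[ℝ] Space n)

/-- Conjugation of an endomorphism by a linear isometry. -/
def conjL (A : Space n →L[ℝ] Space n) : Space n →L[ℝ] Space n :=
  (Q.symm : Space n →L[ℝ] Space n) ∘L A ∘L (Q : Space n →L[ℝ] Space n)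

@[simp]
theorem conjL_apply (A : Space n →L[ℝ] Space n) (v : Space n) :
    conjL Q A v = Q.symm (A (Q v)) := rfl

theorem traceL_eq_trace (A : Space n →L[ℝ] Space n) :
    traceL A = LinearMap.trace ℝ (Space n) (A : Space n →ₗ[ℝ] Space n) := by
  rw [LinearMap.trace_eq_sum_inner _ (EuclideanSpace.basisFun (Fin n) ℝ), traceL_apply]
  simp [EuclideanSpace.inner_single_left]

theorem traceL_conjL (A : Space n →L[ℝ] Space n) : traceL (conjL Q A) = traceL A := by
  rw [traceL_eq_trace, traceL_eq_trace]
  exact LinearMap.trace_conj' (A : Space n →ₗ[ℝ] Space n) Q.symm.toLinearEquiv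

theorem frobL_eq_traceL (A B : Space n →L[ℝ] Space n) :
    frobL A B = traceL (ContinuousLinearMap.adjoint A ∘L B) := by
  rw [frobL_apply, traceL_apply]
  refine Finset.sum_congr rfl fun i _ => ?_
  rw [← ContinuousLinearMap.adjoint_inner_right]
  simp [EuclideanSpace.inner_single_left]

/-- The product is tr(AᵀB), the trace is invariant under conjugation, and the adjoint of an isometry
is its inverse. -/
theorem frobL_conjL (A B : Space n →L[ℝ] Space n) :
    frobL (conjL Q A) B = frobL A (conjL Q.symm B) := by
  rw [frobL_eq_traceL, frobL_eq_traceL, ← traceL_conjL Q (ContinuousLinearMap.adjoint A ∘L _)]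
  congr 1
  ext1 v
  refine ext_inner_left ℝ fun w => ?_
  simp only [ContinuousLinearMap.comp_apply, conjL_apply, ContinuousLinearMap.adjoint_inner_right,
    LinearIsometryEquiv.symm_symm]
  rw [← Q.inner_map_map w, Q.apply_symm_apply, ContinuousLinearMap.adjoint_inner_right,
    Q.symm_apply_apply, ← Q.inner_map_map (Q.symm _), Q.apply_symm_apply]

theorem norm_conjL_le (A : Space n →L[ℝ] Space n) : ‖conjL Q A‖ ≤ ‖A‖ :=
  ContinuousLinearMap.opNorm_le_bound _ (norm_nonneg A) fun v => by
    rw [conjL_apply, LinearIsometryEquiv.norm_map]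
    simpa using A.le_opNorm (Q v)

theorem fderiv_comp_isometry {F : Type*} [NormedAddCommGroup F] [NormedSpace ℝ F]
    (f : Space n → F) (x : Space n) :
    fderiv ℝ (fun x => f (Q x)) x = fderiv ℝ f (Q x) ∘L (Q : Space n →L[ℝ] Space n) :=
  Q.toContinuousLinearEquiv.comp_right_fderiv

theorem fderiv_conj_isometry (v : Space n → Space n) (x : Space n) :
    fderiv ℝ (fun x => Q.symm (v (Q x))) x = conjL Q (fderiv ℝ v (Q x)) := by
  have h := Q.symm.toContinuousLinearEquiv.comp_fderiv (f := fun x => v (Q x)) (x := x)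
  rw [fderiv_comp_isometry] at h
  exact h

theorem measurePreserving_isometry : MeasurePreserving Q (volume : Measure (Space n)) volume :=
  Q.measurePreserving

theorem integral_comp_isometry (f : Space n → ℝ) : ∫ x, f (Q x) = ∫ x, f x :=
  (measurePreserving_isometry Q).integral_comp Q.toHomeomorph.measurableEmbedding f

/-- Isometries preserve null sets, and continuous functions that agree almost everywhere agree
everywhere; this carries the symmetry of the data over to their C¹ representatives. -/
theorem eq_comp_isometry_of_ae {F : Type*} [TopologicalSpace F] [T2Space F] {f g : Space n → F}
    (hf : Continuous f) (hg : Continuous g) {f₀ g₀ : Space n → F} (h₁ : f =ᵐ[volume] f₀)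
    (h₂ : g =ᵐ[volume] g₀) (h : ∀ x, f₀ (Q x) = g₀ x) (x : Space n) : f (Q x) = g x := by
  have h3 : (fun x => f (Q x)) =ᵐ[volume] fun x => f₀ (Q x) :=
    (measurePreserving_isometry Q).quasiMeasurePreserving.ae_eq_comp h₁
  have h4 : (fun x => f (Q x)) =ᵐ[volume] g := by
    filter_upwards [h3, h₂] with x h5 h6
    rw [h5, h6, h]
  exact congrFun (((hf.comp Q.continuous).ae_eq_iff_eq volume hg).1 h4) x

variable {a μ lam T R t : ℝ} {ρ : ℝ → Space n → ℝ} {u : ℝ → Space n → Space n}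

/-- The system is invariant under linear isometries. -/
theorem StrongSolution.conj_isometry (S : StrongSolution a μ lam T ρ u) :
    StrongSolution a μ lam T (fun t x => ρ t (Q x)) (fun t x => Q.symm (u t (Q x))) where
  density_contDiff := S.density_contDiff.comp
    (contDiff_fst.prodMk (Q.contDiff.comp contDiff_snd))
  velocity_contDiff := Q.symm.contDiff.comp (S.velocity_contDiff.comp
    (contDiff_fst.prodMk (Q.contDiff.comp contDiff_snd)))
  bounded := by
    obtain ⟨C, hC⟩ := S.bounded
    refine ⟨C, fun t ht x => ⟨?_, ?_⟩⟩
    · rw [LinearIsometryEquiv.norm_map]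
      exact (hC t ht _).1
    · rw [fderiv_conj_isometry]
      exact (norm_conjL_le Q _).trans (hC t ht _).2
  memLp := fun t ht => by
    obtain ⟨h1, h2⟩ := S.memLp t ht
    have hu := ContDiff.slice S.velocity_contDiff t
    have h1' := h1.comp_measurePreserving (measurePreserving_isometry Q)
    have h2' := h2.comp_measurePreserving (measurePreserving_isometry Q)
    have hc : ContDiff ℝ 1 fun x => Q.symm (u t (Q x)) := Q.symm.contDiff.comp (hu.comp Q.contDiff)
    refine ⟨h1'.of_le hc.continuous.aestronglyMeasurable (Eventually.of_forall fun x => ?_),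
      h2'.of_le (hc.continuous_fderiv one_ne_zero).aestronglyMeasurable
        (Eventually.of_forall fun x => ?_)⟩
    · rw [LinearIsometryEquiv.norm_map]; rfl
    · rw [fderiv_conj_isometry]
      exact norm_conjL_le Q _
  continuity := fun t ht x => by
    have h := S.continuity t ht (Q x)
    rw [fderiv_comp_isometry, divg, fderiv_conj_isometry, traceL_conjL]
    simpa [divg] using h
  -- The original equation is tested with the conjugated field QΦQ⁻¹, followed by the change of
  -- variables y = Qx.
  momentum := fun t ht Φ hΦ hc => by
    have hΨ : ContDiff ℝ 1 fun y => Q (Φ (Q.symm y)) :=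
      Q.contDiff.comp (hΦ.comp Q.symm.contDiff)
    have hΨc : HasCompactSupport fun y => Q (Φ (Q.symm y)) :=
      (hc.comp_homeomorph Q.symm.toHomeomorph).comp_left (g := Q) (map_zero Q)
    rw [← S.momentum t ht _ hΨ hΨc]
    refine Eq.trans (integral_congr_ae (Eventually.of_forall fun x => ?_))
      (integral_comp_isometry Q _)
    have hd : deriv (fun s => Q.symm (u s (Q x))) t = Q.symm (deriv (fun s => u s (Q x)) t) :=
      (Q.symm.toContinuousLinearEquiv.toContinuousLinearMap.hasFDerivAt.comp_hasDerivAt t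
        (differentiableAt_slice S.velocity_contDiff t (Q x)).hasDerivAt).deriv
    have hm : matDeriv (fun t x => Q.symm (u t (Q x))) t x = Q.symm (matDeriv u t (Q x)) := by
      rw [matDeriv, matDeriv, hd, fderiv_conj_isometry, conjL_apply, Q.apply_symm_apply, map_add]
    have hΨd : fderiv ℝ (fun y => Q (Φ (Q.symm y))) (Q x) = conjL Q.symm (fderiv ℝ Φ x) := by
      have h := fderiv_conj_isometry Q.symm Φ (Q x)
      rwa [Q.symm_symm, Q.symm_apply_apply] at h
    simp only [stress, divg, hm, hΨd, fderiv_conj_isometry, traceL_conjL, _root_.add_apply,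
      _root_.smul_apply, innerSL_apply_apply, frobL_conjL, Q.symm_apply_apply]
    rw [← Q.inner_map_map, Q.apply_symm_apply]

/-- Solutions inherit the symmetries of their data. -/
theorem StrongSolution.velocity_isometry (S : StrongSolution a μ lam T ρ u) (ha : 0 < a)
    (hμ : 0 < μ) (hlam : 0 ≤ lam + μ) (hsupp : ∀ x, R < ‖x‖ → ρ 0 x = 0) (hpos : ∀ x, 0 ≤ ρ 0 x)
    (hmass : 0 < ∫ x, ρ 0 x) (hρ : ∀ x, ρ 0 (Q x) = ρ 0 x) (hu : ∀ x, u 0 (Q x) = Q (u 0 x))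
    (ht : t ∈ Ioo 0 T) (x : Space n) : u t (Q x) = Q (u t x) := by
  obtain ⟨R', hR'⟩ := S.exists_density_support hsupp
  have h1 : ∀ t ∈ Icc 0 T, ∀ x, max R' 1 < ‖x‖ → ρ t x = 0 := fun t ht x hx =>
    hR' t ht x ((le_max_left _ _).trans_lt hx)
  have h := StrongSolution.velocity_unique S (S.conj_isometry Q) ha hμ hlam
    (lt_max_of_lt_right one_pos) h1 (fun t ht x hx => h1 t ht _ (by rwa [Q.norm_map]))
    (funext fun x => (hρ x).symm) (funext fun x => by rw [hu, Q.symm_apply_apply]) hpos hmass t ht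
  have := congrFun h x
  rw [this, Q.apply_symm_apply]

end Isometry

/-! ### The lemma of du Bois-Reymond -/

section HalfLine

/-- The lemma of du Bois-Reymond on a half-line. -/
theorem exists_const_of_integral_mul_deriv_eq_zero {h : ℝ → ℝ} {r : ℝ}
    (hh : ContinuousOn h (Ioi r))
    (H : ∀ (ψ : ℝ → ℝ) (p q : ℝ), ContDiff ℝ 1 ψ → r < p → (∀ x, x < p ∨ q < x → ψ x = 0) →
      ∫ x, h x * deriv ψ x = 0) : ∃ c, ∀ x ∈ Ioi r, h x = c := by
  -- Supported in [r+1, r+3], inside the half-line; normalised to integral one, it serves to read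
  -- off the constant c = ∫hη.
  let η : ContDiffBump (r + 2) := ⟨1 / 2, 1, by norm_num, by norm_num⟩
  have hηc : HasCompactSupport (η.normed volume) := η.hasCompactSupport_normed
  have hηs : tsupport (η.normed volume) ⊆ Ioi r := by
    rw [η.tsupport_normed_eq]
    intro x hx
    have := (abs_le.1 (by simpa [Real.dist_eq] using hx : |x - (r + 2)| ≤ 1)).1
    simp only [mem_Ioi]
    linarith
  have hηd : ContDiff ℝ ∞ (η.normed volume) := η.contDiff_normed
  set c := ∫ x, h x * η.normed volume x with hc
  have hint : ∀ φ : ℝ → ℝ, ContDiff ℝ ∞ φ → HasCompactSupport φ → tsupport φ ⊆ Ioi r →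
      Integrable fun x => h x * φ x := fun φ hφ hφc hφs => by
    have hcont : ContinuousOn (fun x => h x * φ x) (tsupport φ) :=
      (hh.mono hφs).mul hφ.continuous.continuousOn
    rw [← integrableOn_iff_integrable_of_support_subset (s := tsupport φ)]
    · exact hcont.integrableOn_compact hφc
    · exact (Function.support_mul_subset_right _ _).trans (subset_tsupport φ)
  have key : ∀ᵐ x, x ∈ Ioi r → h x - c = 0 := by
    refine isOpen_Ioi.ae_eq_zero_of_integral_contDiff_smul_eq_zero
      ((hh.sub continuousOn_const).locallyIntegrableOn measurableSet_Ioi) fun φ hφ hφc hφs => ?_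
    set m := ∫ x, φ x with hm
    -- Correcting φ by a multiple of η gives mean zero, so its primitive has compact support in the
    -- half-line and is an admissible ψ.
    set f : ℝ → ℝ := fun x => φ x - m * η.normed volume x with hf
    have hfc : Continuous f := hφ.continuous.sub (continuous_const.mul hηd.continuous)
    obtain ⟨p, hpr, q, hpq⟩ : ∃ p, r < p ∧ ∃ q, ∀ x, x < p ∨ q < x → f x = 0 := by
      have hK : IsCompact (tsupport φ ∪ tsupport (η.normed volume)) := hφc.isCompact.union hηc
      have hne : (tsupport φ ∪ tsupport (η.normed volume)).Nonempty :=
        ⟨r + 2, Or.inr (by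
          rw [η.tsupport_normed_eq]
          exact Metric.mem_closedBall_self η.rOut_pos.le)⟩
      obtain ⟨p, hp, hpl⟩ := hK.exists_isLeast hne
      obtain ⟨q, hq, hql⟩ := hK.exists_isGreatest hne
      refine ⟨p, (union_subset hφs hηs) hp, q, fun x hx => ?_⟩
      have hx' : x ∉ tsupport φ ∪ tsupport (η.normed volume) := fun h => by
        rcases hx with hx | hx
        · exact absurd (hpl h) (not_le.2 hx)
        · exact absurd (hql h) (not_le.2 hx)
      simp only [mem_union, not_or] at hx'
      simp [hf, image_eq_zero_of_notMem_tsupport hx'.1, image_eq_zero_of_notMem_tsupport hx'.2]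
    have hφi : Integrable φ := hφ.continuous.integrable_of_hasCompactSupport hφc
    have hηi : Integrable (η.normed volume) := η.integrable_normed
    have hfi : ∫ x, f x = 0 := by
      rw [integral_sub hφi (hηi.const_mul m), integral_const_mul, η.integral_normed, ← hm]
      ring
    set ψ : ℝ → ℝ := fun x => ∫ s in p..x, f s with hψ
    have hψd : ∀ x, HasDerivAt ψ (f x) x := fun x =>
      intervalIntegral.integral_hasDerivAt_right (hfc.intervalIntegrable _ _)
        (hfc.stronglyMeasurableAtFilter _ _) hfc.continuousAt
    have hψ' : deriv ψ = f := funext fun x => (hψd x).deriv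
    have hψ1 : ContDiff ℝ 1 ψ := contDiff_one_iff_deriv.2
      ⟨fun x => (hψd x).differentiableAt, by rw [hψ']; exact hfc⟩
    have hψ0 : ∀ x, x < p ∨ q < x → ψ x = 0 := by
      rintro x (hx | hx)
      · rw [hψ]
        dsimp only
        rw [intervalIntegral.integral_symm, intervalIntegral.integral_of_le hx.le,
          integral_Ioc_eq_integral_Ioo, setIntegral_eq_zero_of_forall_eq_zero, neg_zero]
        exact fun s hs => hpq s (Or.inl hs.2)
      · rcases le_or_gt p x with hpx | hpx
        · have h1 : ∫ s in Ioc p x, f s = ∫ s, f s := by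
            rw [← integral_Icc_eq_integral_Ioc]
            refine setIntegral_eq_integral_of_forall_compl_eq_zero fun s hs => ?_
            rw [mem_Icc, not_and_or, not_le, not_le] at hs
            exact hpq s (hs.imp_right fun h => hx.trans h)
          rw [hψ]
          dsimp only
          rw [intervalIntegral.integral_of_le hpx, h1, hfi]
        · rw [hψ]
          dsimp only
          rw [intervalIntegral.integral_symm, intervalIntegral.integral_of_le hpx.le,
            setIntegral_eq_zero_of_forall_eq_zero, neg_zero]
          exact fun s hs => hpq s (Or.inr (hx.trans hs.1))
    have h1 := H ψ p q hψ1 hpr hψ0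
    rw [hψ'] at h1
    have i1 := hint φ hφ hφc hφs
    have i2 := hint _ hηd hηc hηs
    have e1 : ∀ x, h x * f x = h x * φ x - m * (h x * η.normed volume x) := fun x => by
      simp only [hf]; ring
    simp_rw [e1] at h1
    rw [integral_sub i1 (i2.const_mul m), integral_const_mul, ← hc] at h1
    have e2 : ∀ x, φ x • (h x - c) = h x * φ x - c * φ x := fun x => by
      rw [smul_eq_mul]; ring
    simp_rw [e2]
    rw [integral_sub i1 (hφi.const_mul c), integral_const_mul, ← hm]
    linarith
  have h0 : EqOn (fun x => h x - c) (fun _ => 0) (Ioi r) :=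
    Measure.eqOn_open_of_ae_eq ((ae_restrict_iff' measurableSet_Ioi).2 key) isOpen_Ioi
      (hh.sub continuousOn_const) continuousOn_const
  exact ⟨c, fun x hx => sub_eq_zero.1 (h0 hx)⟩

end HalfLine

/-! ### Gradients of radial vector fields -/

section RadialGradient

variable {n : ℕ}

/-- The endomorphism `h ↦ α h + β ⟪x, h⟫ x`. -/
def radialL (α β : ℝ) (x : Space n) : Space n →L[ℝ] Space n :=
  α • ContinuousLinearMap.id ℝ (Space n) + β • (innerSL ℝ x).smulRight x

theorem radialL_apply (α β : ℝ) (x h : Space n) :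
    radialL α β x h = α • h + (β * ⟪x, h⟫_ℝ) • x := by
  simp [radialL, mul_smul]

theorem sum_sq_coord (x : Space n) : ∑ i, x i * x i = ‖x‖ ^ 2 := by
  rw [EuclideanSpace.norm_sq_eq]
  simp [sq]

theorem traceL_radialL (α β : ℝ) (x : Space n) : traceL (radialL α β x) = n * α + β * ‖x‖ ^ 2 := by
  rw [traceL_apply, ← sum_sq_coord, Finset.mul_sum]
  simp [radialL_apply, Finset.sum_add_distrib, EuclideanSpace.inner_single_right, mul_assoc]

theorem frobL_radialL (α β α' β' : ℝ) (x : Space n) :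
    frobL (radialL α β x) (radialL α' β' x) =
      n * (α * α') + (α * β' + β * α') * ‖x‖ ^ 2 + β * β' * (‖x‖ ^ 2) ^ 2 := by
  have e : ∀ i : Fin n, ⟪radialL α β x (stdVec i), radialL α' β' x (stdVec i)⟫_ℝ =
      α * α' + (α * β' + β * α' + β * β' * ‖x‖ ^ 2) * (x i * x i) := fun i => by
    rw [radialL_apply, radialL_apply, inner_add_left, inner_add_right, inner_add_right]
    simp only [inner_smul_left, inner_smul_right, EuclideanSpace.inner_single_right,
      EuclideanSpace.inner_single_left, real_inner_self_eq_norm_sq]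
    simp
    ring
  rw [frobL_apply]
  simp_rw [e]
  rw [Finset.sum_add_distrib, ← Finset.mul_sum Finset.univ (fun i => x i * x i), sum_sq_coord,
    Finset.sum_const, Finset.card_univ, Fintype.card_fin, nsmul_eq_mul]
  ring

theorem hasFDerivAt_radial {g : ℝ → ℝ} {g' : ℝ} {x : Space n} (hx : x ≠ 0)
    (hg : HasDerivAt g g' ‖x‖) :
    HasFDerivAt (fun y : Space n => g ‖y‖ • y) (radialL (g ‖x‖) (g' / ‖x‖) x) x := by
  have hx' : ‖x‖ ≠ 0 := norm_ne_zero_iff.2 hx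
  have h1 : HasFDerivAt (fun y : Space n => ‖y‖) (‖x‖⁻¹ • innerSL ℝ x) x := by
    have h2 := (hasStrictFDerivAt_norm_sq x).hasFDerivAt.sqrt (by positivity)
    simp only [Real.sqrt_sq (norm_nonneg _)] at h2
    refine h2.congr_fderiv ?_
    ext1 v
    simp only [_root_.smul_apply, innerSL_apply_apply, nsmul_eq_mul, smul_eq_mul, Nat.cast_ofNat]
    field_simp
  have h3 := (hg.comp_hasFDerivAt x h1).smul (hasFDerivAt_id x)
  refine h3.congr_fderiv ?_
  ext1 v
  simp [radialL_apply, div_eq_mul_inv, mul_assoc]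

end RadialGradient

/-! ### The Lamé system in the vacuum; the line -/

section Exterior

variable {n : ℕ} {a μ lam T r t : ℝ} {ρ : ℝ → Space n → ℝ} {u : ℝ → Space n → Space n}

/-- The stationary Lamé system in the exterior of a ball, in weak form. -/
def ExteriorLame (μ lam r : ℝ) (v : Space n → Space n) : Prop :=
  ∀ Φ : Space n → Space n, ContDiff ℝ 1 Φ → HasCompactSupport Φ →
    (∃ p, r < p ∧ ∀ x, ‖x‖ < p → Φ x = 0) →
    ∫ x, viscousL n μ lam (fderiv ℝ v x) (fderiv ℝ Φ x) = 0

/-- The velocity solves the Lamé system in the vacuum. -/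
theorem StrongSolution.exteriorLame (S : StrongSolution a μ lam T ρ u) (ht : t ∈ Ioo 0 T)
    (hr : ∀ x, r < ‖x‖ → ρ t x = 0) : ExteriorLame μ lam r (u t) := by
  rintro Φ hΦ hc ⟨p, hp, hΦp⟩
  rw [← S.momentum t ht Φ hΦ hc]
  refine integral_congr_ae (Eventually.of_forall fun x => ?_)
  simp only [stress_eq, _root_.sub_apply, _root_.smul_apply, smul_eq_mul]
  rcases lt_or_ge r ‖x‖ with hx | hx
  · rw [hr x hx]; ring
  · have h : Φ =ᶠ[𝓝 x] fun _ => 0 := by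
      filter_upwards [(isOpen_lt continuous_norm continuous_const).mem_nhds (hx.trans_lt hp)]
        with y hy using hΦp y hy
    rw [h.fderiv_eq, hΦp x (hx.trans_lt hp)]
    simp

theorem eq_zero_of_integrableOn_const_Ioi {r c : ℝ} (h : IntegrableOn (fun _ : ℝ => c) (Ioi r)) :
    c = 0 := by
  have := integrableOn_const_iff (C := c) (by simp) |>.1 h
  simpa using this

theorem traceL_one (A : Space 1 →L[ℝ] Space 1) (w : Space 1) : A w = traceL A • w := by
  conv_lhs => rw [← sum_stdVec w]
  ext i
  fin_cases i
  simp [traceL_apply, mul_comm]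

theorem viscousL_one (A B : Space 1 →L[ℝ] Space 1) :
    viscousL 1 μ lam A B = (lam + 2 * μ) * (traceL A * traceL B) := by
  rw [viscousL_apply, frobL_apply', traceL_apply, traceL_apply]
  simp
  ring

/-- On the line, solutions of the Lamé system in the exterior of a ball vanish if they have finite
energy. -/
theorem ExteriorLame.eq_zero_one {v : Space 1 → Space 1} (h : ExteriorLame μ lam r v)
    (hκ : lam + 2 * μ ≠ 0) (hr : 0 ≤ r) (hv : ContDiff ℝ 1 v) (hL : MemLp v 2)
    (hDL : MemLp (fderiv ℝ v) 2) (x : Space 1) (hx : r < ‖x‖) : v x = 0 := by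
  have hx0 : x ≠ 0 := norm_pos_iff.1 (hr.trans_lt hx)
  set e : Space 1 := ‖x‖⁻¹ • x
  have he : ‖e‖ = 1 := norm_smul_inv_norm hx0
  have hxe : ‖x‖ • e = x := smul_inv_smul₀ (norm_ne_zero_iff.2 hx0) x
  obtain ⟨I, hI⟩ : ∃ I : ℝ ≃ₗᵢ[ℝ] Space 1, ∀ y, I y = y • e :=
    ⟨(LinearIsometry.toSpanSingleton ℝ (Space 1) he).toLinearIsometryEquiv (by simp), fun y => by
      simp⟩
  have hIm : MeasurePreserving I volume volume := I.measurePreserving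
  have hIe : ∀ y : ℝ, ⟪e, I y⟫_ℝ = y := fun y => by
    rw [hI, inner_smul_right, real_inner_self_eq_norm_sq, he]; ring
  have cD : Continuous fun y => divg v (I y) := (continuous_divg hv).comp I.continuous
  obtain ⟨c, hc⟩ := exists_const_of_integral_mul_deriv_eq_zero (r := r) cD.continuousOn
    fun ψ p q hψ hp hψ0 => by
    -- Since ψ vanishes below p > r ≥ 0, this field lives only on the side of the origin containing
    -- `x`; the two components of the exterior are treated separately.
    set Φ : Space 1 → Space 1 := fun z => ψ ⟪e, z⟫_ℝ • e
    have hinner : ContDiff ℝ 1 fun z : Space 1 => ⟪e, z⟫_ℝ := (innerSL ℝ e).contDiff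
    have hΦ : ContDiff ℝ 1 Φ := (hψ.comp hinner).smul contDiff_const
    have hle : ∀ z : Space 1, ⟪e, z⟫_ℝ ≤ ‖z‖ := fun z => by
      simpa [he] using real_inner_le_norm e z
    have hnorm : ∀ z : Space 1, ‖z‖ = |⟪e, z⟫_ℝ| := fun z => by
      rw [← I.apply_symm_apply z, hIe, I.norm_map, Real.norm_eq_abs]
    have hΦp : ∀ z : Space 1, ‖z‖ < p → Φ z = 0 := fun z hz => by
      simp only [Φ]
      rw [hψ0 _ (Or.inl ((hle z).trans_lt hz)), zero_smul]
    have hΦc : HasCompactSupport Φ := hasCompactSupport_of_eq_zero (R := max q (-p)) fun z hz => by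
      simp only [Φ]
      rw [hψ0, zero_smul]
      rw [hnorm] at hz
      rcases lt_abs.1 hz with h1 | h1
      · exact Or.inr ((le_max_left _ _).trans_lt h1)
      · left
        have := (le_max_right q (-p)).trans_lt h1
        linarith
    have hΦd : ∀ z, traceL (fderiv ℝ Φ z) = deriv ψ ⟪e, z⟫_ℝ := fun z => by
      have h1 : HasFDerivAt (fun z : Space 1 => ψ ⟪e, z⟫_ℝ) (deriv ψ ⟪e, z⟫_ℝ • innerSL ℝ e) z :=
        (hψ.differentiable one_ne_zero _).hasDerivAt.comp_hasFDerivAt z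
          (innerSL ℝ e).hasFDerivAt
      have h2 := h1.smul_const e
      have h3 := traceL_one (fderiv ℝ Φ z) e
      rw [h2.fderiv] at h3 ⊢
      have h4 : ⟪e, e⟫_ℝ = 1 := by rw [real_inner_self_eq_norm_sq, he]; norm_num
      have h5 := congrArg (fun w => ⟪e, w⟫_ℝ) h3
      simp only [ContinuousLinearMap.smulRight_apply, _root_.smul_apply, innerSL_apply_apply,
        inner_smul_right, h4, smul_eq_mul, mul_one] at h5
      exact h5.symm
    have h1 := h Φ hΦ hΦc ⟨p, hp, hΦp⟩
    simp_rw [viscousL_one, hΦd] at h1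
    rw [integral_const_mul] at h1
    have h2 := (mul_eq_zero.1 h1).resolve_left hκ
    rw [← hIm.integral_comp I.toHomeomorph.measurableEmbedding] at h2
    simp only [hIe] at h2
    exact h2
  -- The divergence is square integrable on a half-line where it is constant.
  have hc0 : c = 0 := by
    have h1 : MemLp (fun y => divg v (I y)) 2 :=
      (traceL.comp_memLp' hDL).comp_measurePreserving hIm
    have h2 : IntegrableOn (fun _ : ℝ => c ^ 2) (Ioi r) :=
      (h1.integrable_sq.integrableOn).congr_fun (fun y hy => by simp only [hc y hy])
        measurableSet_Ioi
    exact pow_eq_zero_iff two_ne_zero |>.1 (eq_zero_of_integrableOn_const_Ioi h2)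
  have hd : ∀ y ∈ Ioi r, HasDerivAt (fun y => v (I y)) 0 y := fun y hy => by
    have h1 : HasDerivAt (fun y => I y) e y := by
      simp_rw [hI]
      simpa using (hasDerivAt_id y).smul_const e
    have h2 := (hv.differentiable one_ne_zero (I y)).hasFDerivAt.comp_hasDerivAt y h1
    refine h2.congr_deriv ?_
    rw [traceL_one]
    have h3 : divg v (I y) = 0 := (hc y hy).trans hc0
    rw [divg] at h3
    rw [h3, zero_smul]
  have hconst : ∀ y ∈ Ioi r, v (I y) = v x := fun y hy => by
    have h1 : I ‖x‖ = x := by rw [hI, hxe]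
    conv_rhs => rw [← h1]
    exact (convex_Ioi r).is_const_of_fderivWithin_eq_zero (𝕜 := ℝ) (f := fun y => v (I y))
      (fun y hy => (hd y hy).differentiableAt.differentiableWithinAt)
      (fun y hy => by
        rw [fderivWithin_of_isOpen isOpen_Ioi hy, (hd y hy).hasFDerivAt.fderiv]
        ext; simp) hy hx
  have h1 : MemLp (fun y => v (I y)) 2 := hL.comp_measurePreserving hIm
  have h2 : IntegrableOn (fun _ : ℝ => ‖v x‖ ^ 2) (Ioi r) :=
    ((h1.integrable_norm_pow two_ne_zero).integrableOn).congr_fun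
      (fun y hy => by simp only [hconst y hy]) measurableSet_Ioi
  exact norm_eq_zero.1 (pow_eq_zero_iff two_ne_zero |>.1 (eq_zero_of_integrableOn_const_Ioi h2))

end Exterior

/-! ### Radial solutions of the Lamé system in the plane -/

section Planar

variable {μ lam r : ℝ}

/-- Polar coordinates: twice the area of the unit disc is the length of the unit circle. -/
theorem integral_radial_plane (f : ℝ → ℝ) :
    ∫ x : Space 2, f ‖x‖ =
      2 * (volume.real (Metric.ball (0 : Space 2) 1) * ∫ y in Ioi (0 : ℝ), y * f y) := by
  have h := integral_fun_norm_addHaar (volume : Measure (Space 2)) f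
  simpa using h

/-- Square integrable functions on the plane decay faster than `1 / |x|`. -/
theorem eq_zero_of_memLp_plane {F : Type*} [NormedAddCommGroup F] {f : Space 2 → F}
    (hf : MemLp f 2) {R d : ℝ} (hR : 0 ≤ R) (h : ∀ x, R < ‖x‖ → d ^ 2 / ‖x‖ ^ 2 ≤ ‖f x‖ ^ 2) :
    d = 0 := by
  -- In polar coordinates d²/|x|² becomes d²/y, which is not integrable at infinity unless d = 0.
  set g : ℝ → ℝ := (Ioi R).indicator fun y => d ^ 2 / y ^ 2 with hg
  have hgm : Measurable g :=
    (measurable_const.div (measurable_id.pow_const 2)).indicator measurableSet_Ioi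
  have h1 : Integrable fun x : Space 2 => g ‖x‖ := by
    refine (hf.integrable_norm_pow two_ne_zero).mono'
      (hgm.comp measurable_norm).aestronglyMeasurable (Eventually.of_forall fun x => ?_)
    by_cases hx : R < ‖x‖
    · rw [hg, indicator_of_mem (mem_Ioi.2 hx), Real.norm_of_nonneg (by positivity)]
      exact h x hx
    · rw [hg, indicator_of_notMem (by simpa using hx), norm_zero]
      positivity
  rw [integrable_fun_norm_addHaar] at h1
  have h2 : IntegrableOn (fun y : ℝ => d ^ 2 * y⁻¹) (Ioi R) := by
    refine (h1.mono_set (Ioi_subset_Ioi hR)).congr_fun (fun y hy => ?_) measurableSet_Ioi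
    have hy0 : y ≠ 0 := (hR.trans_lt hy).ne'
    simp only [hg, indicator_of_mem hy, finrank_euclideanSpace, Fintype.card_fin, smul_eq_mul]
    field_simp
    simp [mul_comm]
  by_contra hd
  have hd2 : d ^ 2 ≠ 0 := pow_ne_zero 2 hd
  refine not_integrableOn_Ioi_inv (a := R) ?_
  have h3 : IntegrableOn (fun y : ℝ => (d ^ 2)⁻¹ * (d ^ 2 * y⁻¹)) (Ioi R) := h2.const_mul _
  simpa only [inv_mul_cancel_left₀ hd2] using h3

theorem integrable_of_eq_zero_outside {g : ℝ → ℝ} {p q : ℝ} (hp : 0 < p)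
    (hg : ContinuousOn g (Ioi 0)) (h0 : ∀ y, y < p ∨ q < y → g y = 0) : Integrable g := by
  rw [← integrableOn_iff_integrable_of_support_subset (s := Icc p q)]
  · exact (hg.mono fun y hy => hp.trans_le hy.1).integrableOn_compact isCompact_Icc
  · intro y hy
    rw [mem_Icc, ← not_lt, ← not_lt, ← not_or]
    exact fun h => hy (h0 y h)

theorem setIntegral_Ioi_deriv_eq_zero {F F' : ℝ → ℝ} {p q : ℝ} (hp : 0 < p)
    (hF : ∀ y, 0 < y → HasDerivAt F (F' y) y) (hc : ContinuousOn F' (Ioi 0))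
    (h0 : ∀ y, y < p ∨ q < y → F y = 0) (h0' : ∀ y, y < p ∨ q < y → F' y = 0) :
    ∫ y in Ioi (0 : ℝ), F' y = 0 := by
  set q' := max p q + 1
  have hpq : p / 2 ≤ q' := by
    have := le_max_left p q
    simp only [q']
    linarith
  have hpos : ∀ y ∈ uIcc (p / 2) q', 0 < y := fun y hy => by
    rw [uIcc_of_le hpq] at hy
    linarith [hy.1]
  have h1 : ∫ y in (p / 2)..q', F' y = F q' - F (p / 2) :=
    intervalIntegral.integral_eq_sub_of_hasDerivAt (fun y hy => hF y (hpos y hy))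
      (hc.mono hpos).intervalIntegrable
  rw [h0 q' (Or.inr (by simp only [q']; linarith [le_max_right p q])),
    h0 (p / 2) (Or.inl (by linarith)), sub_zero, intervalIntegral.integral_of_le hpq] at h1
  refine Eq.trans ?_ h1
  refine setIntegral_eq_of_subset_of_forall_sdiff_eq_zero measurableSet_Ioi
    (show Ioc (p / 2) q' ⊆ Ioi 0 from fun y hy => (half_pos hp).trans hy.1) fun y hy => h0' y ?_
  by_contra! h
  refine hy.2 ⟨by linarith [h.1], h.2.trans ?_⟩
  simp only [q']
  linarith [le_max_right p q]

/-- A planar vector field that commutes with all linear isometries is radial. -/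
theorem exists_radial_profile {v : Space 2 → Space 2} (hv : ContDiff ℝ 1 v)
    (hQ : ∀ (Q : Space 2 ≃ₗᵢ[ℝ] Space 2) (x : Space 2), v (Q x) = Q (v x)) :
    ∃ f : ℝ → ℝ, ContDiff ℝ 1 f ∧ ∀ x, x ≠ 0 → v x = (f ‖x‖ / ‖x‖) • x := by
  set e : Space 2 := stdVec 0
  have he : ‖e‖ = 1 := by simp [e]
  -- The reflection in the line through `e` fixes s•e, hence fixes v(s•e), which must lie on that
  -- line. Below, the reflection exchanging ‖x‖•e and `x` carries the profile to every other
  -- direction.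
  have h1 : ∀ s : ℝ, v (s • e) = ⟪e, v (s • e)⟫_ℝ • e := fun s => by
    have h2 := hQ (Submodule.reflection (ℝ ∙ e)) (s • e)
    rw [Submodule.reflection_mem_subspace_eq_self
      (Submodule.smul_mem _ s (Submodule.mem_span_singleton_self e))] at h2
    obtain ⟨k, hk⟩ := Submodule.mem_span_singleton.1
      ((Submodule.reflection_eq_self_iff _).1 h2.symm)
    rw [← hk, inner_smul_right, real_inner_self_eq_norm_sq, he]
    simp
  refine ⟨fun s => ⟪e, v (s • e)⟫_ℝ, ?_, fun x hx => ?_⟩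
  · exact contDiff_const.inner ℝ (hv.comp (contDiff_id.smul contDiff_const))
  · have hn : ‖‖x‖ • e‖ = ‖x‖ := by rw [norm_smul, he, mul_one, norm_norm]
    have h3 := Submodule.reflection_sub hn
    have h4 := hQ (Submodule.reflection (ℝ ∙ (‖x‖ • e - x))ᗮ) (‖x‖ • e)
    rw [h3, h1, map_smul] at h4
    have h5 : Submodule.reflection (ℝ ∙ (‖x‖ • e - x))ᗮ e = ‖x‖⁻¹ • x := by
      rw [eq_inv_smul_iff₀ (norm_ne_zero_iff.2 hx), ← map_smul, h3]
    rw [h4, h5, smul_smul, div_eq_mul_inv]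

/-- On the plane, radial solutions of the Lamé system in the exterior of a ball vanish if they have
finite energy. -/
theorem ExteriorLame.eq_zero_two {v : Space 2 → Space 2} (h : ExteriorLame μ lam r v)
    (hκ : lam + 2 * μ ≠ 0) (hr : 0 ≤ r) (hv : ContDiff ℝ 1 v) (hL : MemLp v 2)
    (hDL : MemLp (fderiv ℝ v) 2)
    (hQ : ∀ (Q : Space 2 ≃ₗᵢ[ℝ] Space 2) (x : Space 2), v (Q x) = Q (v x))
    (x : Space 2) (hx : r < ‖x‖) : v x = 0 := by
  obtain ⟨f, hf, hvf⟩ := exists_radial_profile hv hQ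
  have hfd : ∀ y, HasDerivAt f (deriv f y) y := fun y =>
    (hf.differentiable one_ne_zero y).hasDerivAt
  have hgd : ∀ y, y ≠ 0 → HasDerivAt (fun y => f y / y) ((deriv f y * y - f y) / y ^ 2) y :=
    fun y hy => by simpa using (hfd y).fun_div (hasDerivAt_id y) hy
  have hvd : ∀ x, x ≠ 0 → fderiv ℝ v x =
      radialL (f ‖x‖ / ‖x‖) ((deriv f ‖x‖ * ‖x‖ - f ‖x‖) / ‖x‖ ^ 2 / ‖x‖) x := fun x hx => by
    have h1 := hasFDerivAt_radial hx (hgd ‖x‖ (norm_ne_zero_iff.2 hx))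
    refine (h1.congr_of_eventuallyEq ?_).fderiv
    filter_upwards [isOpen_ne.mem_nhds hx] with y hy using hvf y hy
  have hdiv : ∀ x, x ≠ 0 → divg v x = deriv f ‖x‖ + f ‖x‖ / ‖x‖ := fun x hx => by
    have hx' : ‖x‖ ≠ 0 := norm_ne_zero_iff.2 hx
    rw [divg, hvd x hx, traceL_radialL]
    field_simp
    push_cast
    ring
  have cD : ContinuousOn (fun y => deriv f y + f y / y) (Ioi r) :=
    (hf.continuous_deriv_one).continuousOn.add
      (hf.continuous.continuousOn.div continuousOn_id fun y hy => (hr.trans_lt hy).ne')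
  obtain ⟨c, hc⟩ := exists_const_of_integral_mul_deriv_eq_zero cD fun χ p q hχ hp hχ0 => by
    have hp0 : 0 < p := hr.trans_lt hp
    -- The field φ(|z|)z has divergence (y²φ)'/y = χ'/y at y = |z|, and the factor 1/y cancels the
    -- polar weight. So the divergence of `v` is tested against χ' itself.
    set φ : ℝ → ℝ := fun y => χ y / y ^ 2 with hφ
    have hχd : ∀ y, HasDerivAt χ (deriv χ y) y := fun y =>
      (hχ.differentiable one_ne_zero y).hasDerivAt
    have hφd : ∀ y, y ≠ 0 → HasDerivAt φ ((deriv χ y * y ^ 2 - χ y * (2 * y)) / (y ^ 2) ^ 2) y :=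
      fun y hy => by
        have := (hχd y).fun_div ((hasDerivAt_id y).fun_pow 2) (pow_ne_zero 2 hy)
        simpa using this
    set Φ : Space 2 → Space 2 := fun z => φ ‖z‖ • z with hΦ
    have hΦp : ∀ z : Space 2, ‖z‖ < p → Φ z = 0 := fun z hz => by
      simp [hΦ, hφ, hχ0 _ (Or.inl hz)]
    have hΦ1 : ContDiff ℝ 1 Φ := contDiff_iff_contDiffAt.2 fun z => by
      rcases eq_or_ne z 0 with rfl | hz
      · have : Φ =ᶠ[𝓝 0] fun _ => 0 := by
          filter_upwards [(isOpen_lt continuous_norm continuous_const).mem_nhds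
            (show ‖(0 : Space 2)‖ < p by simpa using hp0)] with y hy using hΦp y hy
        exact contDiffAt_const.congr_of_eventuallyEq this
      · have hn : ContDiffAt ℝ 1 (fun z : Space 2 => ‖z‖) z := contDiffAt_norm ℝ hz
        exact ((hχ.contDiffAt.comp z hn).div (hn.pow 2)
          (pow_ne_zero 2 (norm_ne_zero_iff.2 hz))).smul contDiffAt_id
    have hΦc : HasCompactSupport Φ := hasCompactSupport_of_eq_zero (R := q) fun z hz => by
      simp [hΦ, hφ, hχ0 _ (Or.inr hz)]
    have hΦd : ∀ z, z ≠ 0 → fderiv ℝ Φ z = radialL (φ ‖z‖)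
        ((deriv χ ‖z‖ * ‖z‖ ^ 2 - χ ‖z‖ * (2 * ‖z‖)) / (‖z‖ ^ 2) ^ 2 / ‖z‖) z := fun z hz =>
      (hasFDerivAt_radial hz (hφd _ (norm_ne_zero_iff.2 hz))).fderiv
    have h1 := h Φ hΦ1 hΦc ⟨p, hp, hΦp⟩
    -- Radial fields have symmetric gradients, with eigenvalues f', f/y for `v` and g', g/y for Φ,
    -- where g = χ/y. Then f'g' + fg/y² is the product of the divergences minus (fg)'/y. The last
    -- term is a null Lagrangian: times y it is the exact derivative `N`, so only (λ+2μ) div v div Φ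
    -- survives.
    set k : ℝ → ℝ := fun y => (lam + 2 * μ) * ((deriv f y + f y / y) * deriv χ y) / y -
      μ * ((deriv f y * χ y + f y * deriv χ y) / y - f y * χ y / y ^ 2) / y with hk
    have e1 : ∀ z : Space 2, z ≠ 0 → viscousL 2 μ lam (fderiv ℝ v z) (fderiv ℝ Φ z) = k ‖z‖ := by
      intro z hz
      have hz' : ‖z‖ ≠ 0 := norm_ne_zero_iff.2 hz
      rw [viscousL_apply, hvd z hz, hΦd z hz, frobL_radialL, traceL_radialL, traceL_radialL]
      simp only [hk, hφ]
      push_cast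
      generalize ‖z‖ = y at hz'
      field_simp
      ring
    have hχ' : ∀ y, y < p ∨ q < y → deriv χ y = 0 := fun y hy => by
      have h2 : χ =ᶠ[𝓝 y] fun _ => 0 := by
        filter_upwards [((isOpen_Iio (a := p)).union (isOpen_Ioi (a := q))).mem_nhds hy] with z hz
          using hχ0 z hz
      rw [h2.deriv_eq, deriv_const]
    have cf := hf.continuous.continuousOn (s := Ioi (0 : ℝ))
    have cf' := hf.continuous_deriv_one.continuousOn (s := Ioi (0 : ℝ))
    have cχ := hχ.continuous.continuousOn (s := Ioi (0 : ℝ))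
    have cχ' := hχ.continuous_deriv_one.continuousOn (s := Ioi (0 : ℝ))
    have cy : ContinuousOn (fun y : ℝ => y) (Ioi (0 : ℝ)) := continuousOn_id
    have hy0 : ∀ y ∈ Ioi (0 : ℝ), y ≠ 0 := fun y hy => (mem_Ioi.1 hy).ne'
    set N : ℝ → ℝ := fun y => (deriv f y * χ y + f y * deriv χ y) / y - f y * χ y / y ^ 2 with hN
    have cN : ContinuousOn N (Ioi 0) :=
      (((cf'.mul cχ).add (cf.mul cχ')).div cy hy0).sub
        ((cf.mul cχ).div (cy.pow 2) fun y hy => pow_ne_zero 2 (hy0 y hy))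
    have cDχ : ContinuousOn (fun y => (deriv f y + f y / y) * deriv χ y) (Ioi 0) :=
      (cf'.add (cf.div cy hy0)).mul cχ'
    have zN : ∀ y, y < p ∨ q < y → N y = 0 := fun y hy => by
      simp [hN, hχ0 y hy, hχ' y hy]
    have zD : ∀ y, y < p ∨ q < y → (deriv f y + f y / y) * deriv χ y = 0 := fun y hy => by
      rw [hχ' y hy, mul_zero]
    have hNint : ∫ y in Ioi (0 : ℝ), N y = 0 := by
      refine setIntegral_Ioi_deriv_eq_zero (F := fun y => f y * χ y / y) hp0 (fun y hy => ?_) cN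
        (fun y hy => by rw [hχ0 y hy, mul_zero, zero_div]) zN
      have h2 := ((hfd y).fun_mul (hχd y)).fun_div (hasDerivAt_id y) hy.ne'
      refine h2.congr_deriv ?_
      simp only [hN, id]
      field_simp
    have h2 : ∫ z, viscousL 2 μ lam (fderiv ℝ v z) (fderiv ℝ Φ z) = ∫ z : Space 2, k ‖z‖ := by
      refine integral_congr_ae ?_
      filter_upwards [compl_mem_ae_iff.2 (measure_singleton (0 : Space 2))] with z hz using e1 z hz
    rw [h1, integral_radial_plane] at h2
    have hvol : volume.real (Metric.ball (0 : Space 2) 1) ≠ 0 :=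
      (ENNReal.toReal_pos (Metric.measure_ball_pos volume 0 one_pos).ne'
        measure_ball_lt_top.ne).ne'
    have h3 : ∫ y in Ioi (0 : ℝ), y * k y = 0 := by
      simpa [hvol] using h2.symm
    have h4 : ∫ y in Ioi (0 : ℝ), y * k y = ∫ y in Ioi (0 : ℝ),
        ((lam + 2 * μ) * ((deriv f y + f y / y) * deriv χ y) - μ * N y) := by
      refine setIntegral_congr_fun measurableSet_Ioi fun y hy => ?_
      have := hy0 y hy
      simp only [hk, hN]
      field_simp
    rw [h4, integral_sub ((integrable_of_eq_zero_outside hp0 cDχ zD).integrableOn.const_mul _)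
      ((integrable_of_eq_zero_outside hp0 cN zN).integrableOn.const_mul _), integral_const_mul,
      integral_const_mul, hNint, mul_zero, sub_zero] at h3
    rw [← (mul_eq_zero.1 h3).resolve_left hκ]
    refine (setIntegral_eq_integral_of_forall_compl_eq_zero fun y hy => zD y (Or.inl ?_)).symm
    exact (not_lt.1 hy).trans_lt hp0
  -- For |x| > 1 the constant c² dominates c²/|x|², which reduces this to the decay criterion.
  have hc0 : c = 0 := by
    have h1 : MemLp (fun x => divg v x) 2 := traceL.comp_memLp' hDL
    refine eq_zero_of_memLp_plane h1 (R := max r 1) (hr.trans (le_max_left _ _)) fun x hx => ?_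
    have hx1 : r < ‖x‖ := (le_max_left _ _).trans_lt hx
    have hx2 : 1 < ‖x‖ := (le_max_right _ _).trans_lt hx
    rw [hdiv x (norm_pos_iff.1 (hr.trans_lt hx1)), hc ‖x‖ hx1, Real.norm_eq_abs, sq_abs]
    exact div_le_self (sq_nonneg c) (by nlinarith)
  -- The divergence is (yf)'/y, so yf is constant; then |v| = |d|/|x| in the exterior, and L² forces
  -- d = 0.
  have hprod : ∀ y ∈ Ioi r, HasDerivAt (fun y => y * f y) 0 y := fun y hy => by
    refine ((hasDerivAt_id y).fun_mul (hfd y)).congr_deriv ?_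
    have hy0 : y ≠ 0 := (hr.trans_lt hy).ne'
    have h1 := (hc y hy).trans hc0
    field_simp at h1
    simp only [id]
    linarith
  have hconst : ∀ y ∈ Ioi r, y * f y = ‖x‖ * f ‖x‖ := fun y hy =>
    (convex_Ioi r).is_const_of_fderivWithin_eq_zero (𝕜 := ℝ) (f := fun y => y * f y)
      (fun y hy => (hprod y hy).differentiableAt.differentiableWithinAt)
      (fun y hy => by
        rw [fderivWithin_of_isOpen isOpen_Ioi hy, (hprod y hy).hasFDerivAt.fderiv]
        ext; simp) hy hx
  have hd0 : ‖x‖ * f ‖x‖ = 0 := by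
    refine eq_zero_of_memLp_plane hL hr fun z hz => ?_
    have hz0 : 0 < ‖z‖ := hr.trans_lt hz
    rw [← hconst ‖z‖ hz, hvf z (norm_pos_iff.1 hz0), norm_smul, mul_pow, mul_pow, Real.norm_eq_abs,
      sq_abs]
    field_simp
    exact le_rfl
  have hx0 : 0 < ‖x‖ := hr.trans_lt hx
  rw [hvf x (norm_pos_iff.1 hx0), (mul_eq_zero.1 hd0).resolve_left hx0.ne', zero_div, zero_smul]

end Planar

/-! ### Virial identity and growth of the second moment -/

section Virial

variable {n : ℕ} {a μ lam T R t : ℝ} {ρ : ℝ → Space n → ℝ} {u : ℝ → Space n → Space n}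

/-- Twice-integrated lower bound on I''. Monotonicity replaces integration because no continuity of
the second derivative is assumed. -/
theorem quadratic_lower_bound {I J : ℝ → ℝ} {k T : ℝ} (hT : 0 ≤ T) (hI : Continuous I)
    (hJ : Continuous J) (dI : ∀ t ∈ Ioo 0 T, HasDerivAt I (J t) t)
    (dJ : ∀ t ∈ Ioo 0 T, ∃ J', HasDerivAt J J' t ∧ 2 * k ≤ J') :
    I 0 + J 0 * T + k * T ^ 2 ≤ I T := by
  have hK : MonotoneOn (fun t => J t - 2 * k * t) (Icc 0 T) := by
    have hd : ∀ t ∈ Ioo 0 T, ∃ d, 0 ≤ d ∧ HasDerivAt (fun t => J t - 2 * k * t) d t := fun t ht => by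
      obtain ⟨J', h1, h2⟩ := dJ t ht
      exact ⟨_, by simpa using h2, h1.fun_sub ((hasDerivAt_id t).const_mul (2 * k))⟩
    refine monotoneOn_of_deriv_nonneg (convex_Icc _ _) (by fun_prop) ?_ ?_ <;>
      rw [interior_Icc]
    · intro t ht
      obtain ⟨d, -, h⟩ := hd t ht
      exact h.differentiableAt.differentiableWithinAt
    · intro t ht
      obtain ⟨d, h0, h⟩ := hd t ht
      rwa [h.deriv]
  have hL : MonotoneOn (fun t => I t - (J 0 * t + k * t ^ 2)) (Icc 0 T) := by
    have hd : ∀ t ∈ Ioo 0 T, HasDerivAt (fun t => I t - (J 0 * t + k * t ^ 2))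
        (J t - (J 0 + 2 * k * t)) t := fun t ht => by
      refine ((dI t ht).fun_sub (((hasDerivAt_id t).const_mul (J 0)).fun_add
        (((hasDerivAt_id t).fun_pow 2).const_mul k))).congr_deriv ?_
      simp
      ring
    refine monotoneOn_of_deriv_nonneg (convex_Icc _ _) (by fun_prop) ?_ ?_ <;>
      rw [interior_Icc]
    · exact fun t ht => (hd t ht).differentiableAt.differentiableWithinAt
    · intro t ht
      rw [(hd t ht).deriv]
      have := hK ⟨le_rfl, hT⟩ (Ioo_subset_Icc_self ht) ht.1.le
      simp only [mul_zero, sub_zero] at this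
      linarith
  have := hL ⟨le_rfl, hT⟩ ⟨hT, le_rfl⟩ hT
  norm_num at this
  linarith

theorem frobL_id (A : Space n →L[ℝ] Space n) :
    frobL A (ContinuousLinearMap.id ℝ (Space n)) = traceL A := by
  rw [frobL_apply, traceL_apply]
  simp [EuclideanSpace.inner_single_right]

theorem traceL_id : traceL (ContinuousLinearMap.id ℝ (Space n)) = n := by
  rw [traceL_apply]
  simp

/-- The virial identity. -/
theorem StrongSolution.integral_density_mul_matDeriv (S : StrongSolution a μ lam T ρ u)
    (hs : ∀ x, R < ‖x‖ → ρ t x = 0) (hu : ∀ x, R < ‖x‖ → u t x = 0) (hR : 0 ≤ R)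
    (ht : t ∈ Ioo 0 T) : ∫ x, ρ t x * ⟪matDeriv u t x, x⟫_ℝ = n * a * ∫ x, ρ t x := by
  have hρ := ContDiff.slice S.density_contDiff t
  have hv := ContDiff.slice S.velocity_contDiff t
  -- Cut-off equal to 1 on a neighbourhood of the ball, so the test field is x wherever the gas or
  -- the velocity gradient is present.
  let χ : ContDiffBump (0 : Space n) := ⟨R + 1, R + 2, by linarith, by linarith⟩
  have hχ1 : ∀ x, ‖x‖ ≤ R → (χ : Space n → ℝ) =ᶠ[𝓝 x] fun _ => 1 := fun x hx => by
    filter_upwards [(isOpen_lt continuous_norm continuous_const).mem_nhds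
      (show ‖x‖ < R + 1 by linarith)] with y hy
    exact χ.one_of_mem_closedBall (by simpa using hy.le)
  have hDu : ∀ x, R < ‖x‖ → fderiv ℝ (u t) x = 0 := fun x hx => by
    have h : u t =ᶠ[𝓝 x] fun _ => 0 := by
      filter_upwards [(isOpen_lt continuous_const continuous_norm).mem_nhds hx] with y hy
        using hu y hy
    rw [h.fderiv_eq]
    simp
  have hχd : ContDiff ℝ 1 χ := χ.contDiff
  have hdiv : ∫ x, divg (u t) x = 0 := by
    rw [← integral_divg_smul_eq_zero hχd χ.hasCompactSupport hv]
    refine integral_congr_ae (Eventually.of_forall fun x => ?_)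
    dsimp only
    rcases lt_or_ge R ‖x‖ with hx | hx
    · rw [hu x hx, divg, hDu x hx]
      simp
    · rw [(hχ1 x hx).fderiv_eq, (hχ1 x hx).eq_of_nhds]
      simp
  have hΦ : ContDiff ℝ 1 fun x : Space n => χ x • x := hχd.smul contDiff_id
  have hm := S.momentum t ht _ hΦ χ.hasCompactSupport.smul_right
  have e : ∀ x, (ρ t x • innerSL ℝ (matDeriv u t x)) (χ x • x) +
      stress a μ lam ρ u t x (fderiv ℝ (fun x : Space n => χ x • x) x) =
      ρ t x * ⟪matDeriv u t x, x⟫_ℝ + (μ + (lam + μ) * n) * divg (u t) x - n * a * ρ t x := by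
    intro x
    rcases lt_or_ge R ‖x‖ with hx | hx
    · simp [stress, divg, hs x hx, hDu x hx]
    · have h1 : (fun x : Space n => χ x • x) =ᶠ[𝓝 x] fun x => x := by
        filter_upwards [hχ1 x hx] with y hy
        rw [hy, one_smul]
      rw [h1.fderiv_eq, (hχ1 x hx).eq_of_nhds, one_smul, fderiv_fun_id, stress]
      simp only [_root_.add_apply, _root_.smul_apply, frobL_id, traceL_id, innerSL_apply_apply,
        smul_eq_mul, divg]
      ring
  simp_rw [e] at hm
  have hsc := hasCompactSupport_of_eq_zero hs
  have i1 : Integrable fun x => ρ t x * ⟪matDeriv u t x, x⟫_ℝ :=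
    (hρ.continuous.mul ((continuous_matDeriv_slice S.velocity_contDiff t).inner
      continuous_id)).integrable_of_hasCompactSupport hsc.mul_right
  have i2 : Integrable fun x => (μ + (lam + μ) * n) * divg (u t) x :=
    ((continuous_divg hv).integrable_of_hasCompactSupport
      (hasCompactSupport_of_eq_zero (R := R) fun x hx => by
        rw [divg, hDu x hx, map_zero])).const_mul _
  have i3 : Integrable fun x => n * a * ρ t x :=
    (hρ.continuous.integrable_of_hasCompactSupport hsc).const_mul _
  rw [integral_sub (i1.fun_add i2) i3, integral_add i1 i2, integral_const_mul, hdiv,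
    integral_const_mul] at hm
  linarith

/-- The second moment of a confined solution grows quadratically. -/
theorem StrongSolution.time_bound (S : StrongSolution a μ lam T ρ u) (hT : 0 < T) (hR : 0 ≤ R)
    (hs : ∀ t ∈ Icc 0 T, ∀ x, R < ‖x‖ → ρ t x = 0)
    (hu : ∀ t ∈ Ioo 0 T, ∀ x, R < ‖x‖ → u t x = 0) (hpos : ∀ x, 0 ≤ ρ 0 x) :
    n * a * (∫ x, ρ 0 x) * T ^ 2 + (∫ x, ρ 0 x * (2 * ⟪u 0 x, x⟫_ℝ)) * T ≤
      R ^ 2 * ∫ x, ρ 0 x := by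
  have h0 : (0 : ℝ) ∈ Icc 0 T := ⟨le_rfl, hT.le⟩
  have hTT : T ∈ Icc 0 T := ⟨hT.le, le_rfl⟩
  have hB := isCompact_closedBall (0 : Space n) R
  -- Integrating over a fixed ball makes the moments continuous for all times, including 0 and T,
  -- where the equations are not assumed.
  set I : ℝ → ℝ := fun t => ∫ x in Metric.closedBall 0 R, ρ t x * ‖x‖ ^ 2
  set J : ℝ → ℝ := fun t => ∫ x in Metric.closedBall 0 R, ρ t x * (2 * ⟪u t x, x⟫_ℝ)
  have gI : ContDiff ℝ 1 fun p : ℝ × Space n => ‖p.2‖ ^ 2 := contDiff_snd.norm_sq ℝ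
  have gJ : ContDiff ℝ 1 fun p : ℝ × Space n => 2 * ⟪u p.1 p.2, p.2⟫_ℝ :=
    contDiff_const.mul (S.velocity_contDiff.inner ℝ contDiff_snd)
  have cI : Continuous I := continuous_iff_continuousAt.2 fun s =>
    (hasDerivAt_setIntegral_of_contDiff (F := fun t x => ρ t x * ‖x‖ ^ 2)
      (S.density_contDiff.mul gI) hB s).continuousAt
  have cJ : Continuous J := continuous_iff_continuousAt.2 fun s =>
    (hasDerivAt_setIntegral_of_contDiff (F := fun t x => ρ t x * (2 * ⟪u t x, x⟫_ℝ))
      (S.density_contDiff.mul gJ) hB s).continuousAt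
  have hJeq : ∀ t ∈ Icc 0 T, J t = ∫ x, ρ t x * (2 * ⟪u t x, x⟫_ℝ) := fun t ht =>
    setIntegral_closedBall_eq_integral fun x hx => by rw [hs t ht x hx, zero_mul]
  have dI : ∀ t ∈ Ioo 0 T, HasDerivAt I (J t) t := fun t ht => by
    refine (S.hasDerivAt_integral_mul hs (G := fun _ x => ‖x‖ ^ 2) gI ht).congr_deriv ?_
    rw [hJeq t (Ioo_subset_Icc_self ht)]
    refine integral_congr_ae (Eventually.of_forall fun x => ?_)
    simp [real_inner_comm]
  have dJ : ∀ t ∈ Ioo 0 T, ∃ J', HasDerivAt J J' t ∧ 2 * (n * a * ∫ x, ρ 0 x) ≤ J' := by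
    intro t ht
    have ht' := Ioo_subset_Icc_self ht
    have hρ := ContDiff.slice S.density_contDiff t
    have hv := ContDiff.slice S.velocity_contDiff t
    refine ⟨_, S.hasDerivAt_integral_mul hs (G := fun t x => 2 * ⟪u t x, x⟫_ℝ) gJ ht, ?_⟩
    have e : ∀ x, ρ t x * (deriv (fun s => 2 * ⟪u s x, x⟫_ℝ) t +
        fderiv ℝ (fun x => 2 * ⟪u t x, x⟫_ℝ) x (u t x)) =
        2 * (ρ t x * ⟪matDeriv u t x, x⟫_ℝ) + 2 * (ρ t x * ‖u t x‖ ^ 2) := fun x => by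
      have d1 : deriv (fun s => 2 * ⟪u s x, x⟫_ℝ) t = 2 * ⟪deriv (fun s => u s x) t, x⟫_ℝ := by
        have := ((differentiableAt_slice S.velocity_contDiff t x).hasDerivAt.inner ℝ
          (hasDerivAt_const t x)).const_mul 2
        rw [this.deriv]
        simp
      have d2 : fderiv ℝ (fun x => 2 * ⟪u t x, x⟫_ℝ) x (u t x) =
          2 * (⟪fderiv ℝ (u t) x (u t x), x⟫_ℝ + ‖u t x‖ ^ 2) := by
        have := ((hv.differentiable one_ne_zero x).hasFDerivAt.inner ℝ
          (hasFDerivAt_id x)).const_mul 2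
        rw [← real_inner_self_eq_norm_sq, add_comm]
        simp only [id] at this
        rw [this.fderiv]
        simp
      rw [d1, d2, matDeriv, inner_add_left]
      ring
    simp_rw [e]
    have hsc := hasCompactSupport_of_eq_zero (hs t ht')
    have i1 : Integrable fun x => ρ t x * ⟪matDeriv u t x, x⟫_ℝ :=
      (hρ.continuous.mul ((continuous_matDeriv_slice S.velocity_contDiff t).inner
        continuous_id)).integrable_of_hasCompactSupport hsc.mul_right
    have i2 : Integrable fun x => ρ t x * ‖u t x‖ ^ 2 :=
      (hρ.continuous.mul (hv.continuous.norm.pow 2)).integrable_of_hasCompactSupport hsc.mul_right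
    -- The second derivative of the moment is 2naM plus twice ∫ρ|u|², and the latter is dropped by
    -- sign.
    rw [integral_add (i1.const_mul 2) (i2.const_mul 2), integral_const_mul, integral_const_mul,
      S.integral_density_mul_matDeriv (hs t ht') (hu t ht) hR ht, S.integral_density_eq hs ht']
    have : 0 ≤ ∫ x, ρ t x * ‖u t x‖ ^ 2 :=
      integral_nonneg fun x => mul_nonneg (S.density_nonneg hpos ht' x) (sq_nonneg _)
    linarith
  have key := quadratic_lower_bound hT.le cI cJ dI dJ
  rw [hJeq 0 h0] at key
  have hI0 : 0 ≤ I 0 := integral_nonneg fun x => mul_nonneg (hpos x) (sq_nonneg _)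
  have hIT : I T ≤ R ^ 2 * ∫ x, ρ 0 x := by
    rw [← S.integral_density_eq hs hTT, ← integral_const_mul]
    have hρ := ContDiff.slice S.density_contDiff T
    have hsc := hasCompactSupport_of_eq_zero (hs T hTT)
    have e1 : I T = ∫ x, ρ T x * ‖x‖ ^ 2 :=
      setIntegral_closedBall_eq_integral fun x hx => by rw [hs T hTT x hx, zero_mul]
    rw [e1]
    refine integral_mono ((hρ.continuous.mul
      (continuous_norm.pow 2)).integrable_of_hasCompactSupport hsc.mul_right)
      ((hρ.continuous.integrable_of_hasCompactSupport hsc).const_mul _) fun x => ?_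
    dsimp only
    rcases lt_or_ge R ‖x‖ with hx | hx
    · rw [hs T hTT x hx]; simp
    · rw [mul_comm]
      exact mul_le_mul_of_nonneg_right (pow_le_pow_left₀ (norm_nonneg x) hx 2)
        (S.density_nonneg hpos hTT x)
  linarith

end Virial

/-! ### Assembling the blow-up bound -/

section Blowup

variable {n : ℕ} {a μ lam T R m : ℝ} {ρ₀ : Space n → ℝ} {u₀ : Space n → Space n}
  {ρ : ℝ → Space n → ℝ} {u : ℝ → Space n → Space n}

/-- In the symmetric settings, the velocity vanishes outside any ball that contains the gas. -/
theorem StrongSolution.velocity_eq_zero_of_exterior (S : StrongSolution a μ lam T ρ u) (ha : 0 < a)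
    (hμ : 0 < μ) (hlam : 0 < lam + 2 / (n : ℝ) * μ) (hρ0 : ρ 0 =ᵐ[volume] ρ₀)
    (hu0 : u 0 =ᵐ[volume] u₀) (hsupp : ∀ x, R < ‖x‖ → ρ 0 x = 0) (hpos : ∀ x, 0 ≤ ρ 0 x)
    (hmass : 0 < ∫ x, ρ 0 x) (hcase : n = 1 ∨ (n = 2 ∧ SphericallySymmetric ρ₀ u₀)) {r : ℝ}
    (hr : 0 ≤ r) (hsr : ∀ t ∈ Icc 0 T, ∀ x, r < ‖x‖ → ρ t x = 0) :
    ∀ t ∈ Ioo 0 T, ∀ x, r < ‖x‖ → u t x = 0 := by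
  intro t ht x hx
  have ht' := Ioo_subset_Icc_self ht
  have hE := S.exteriorLame ht (hsr t ht')
  have hv := ContDiff.slice S.velocity_contDiff t
  obtain ⟨hL, hDL⟩ := S.memLp t ht'
  rcases hcase with rfl | ⟨rfl, hsym⟩
  · refine hE.eq_zero_one ?_ hr hv hL hDL x hx
    norm_num at hlam
    exact hlam.ne'
  -- For n = 2 the viscosity hypothesis reads λ + μ > 0: the sign used for uniqueness, which also
  -- gives λ + 2μ > 0 for the Lamé argument.
  · norm_num at hlam
    refine hE.eq_zero_two (by linarith) hr hv hL hDL (fun Q x => ?_) x hx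
    obtain ⟨f, w, hf, hw⟩ := hsym
    refine S.velocity_isometry Q ha hμ hlam.le hsupp hpos hmass ?_ ?_ ht x
    · exact eq_comp_isometry_of_ae Q (ContDiff.slice S.density_contDiff 0).continuous
        (ContDiff.slice S.density_contDiff 0).continuous (hρ0.trans hf) (hρ0.trans hf)
        fun x => by rw [Q.norm_map]
    · refine eq_comp_isometry_of_ae Q (ContDiff.slice S.velocity_contDiff 0).continuous
        (Q.continuous.comp (ContDiff.slice S.velocity_contDiff 0).continuous) (hu0.trans hw)
        ((hu0.trans hw).fun_comp Q) fun x => ?_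
      simp only [Function.comp_apply, Q.norm_map, map_smul]

/-- The existence time of a solution is bounded in terms of its data. -/
theorem IsSolution.time_bound (ha : 0 < a) (hμ : 0 < μ) (hlam : 0 < lam + 2 / (n : ℝ) * μ)
    (hm : 2 < m) (hR : 0 ≤ R) (hsupp : ∀ x, R < ‖x‖ → ρ₀ x = 0) (hnonneg : ∀ᵐ x, 0 ≤ ρ₀ x)
    (hnontriv : ¬ ∀ᵐ x, ρ₀ x = 0) (hcase : n = 1 ∨ (n = 2 ∧ SphericallySymmetric ρ₀ u₀))
    (hT : 0 < T) (h : IsSolution a μ lam m T ρ₀ u₀ ρ u) :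
    0 < ∫ x, ρ₀ x ∧ n * a * (∫ x, ρ₀ x) * T ^ 2 + (∫ x, ρ₀ x * (2 * ⟪u₀ x, x⟫_ℝ)) * T ≤
      R ^ 2 * ∫ x, ρ₀ x := by
  have hn : (1 : ℝ) ≤ n ∧ (n : ℝ) ≤ 2 := by
    rcases hcase with rfl | ⟨rfl, -⟩ <;> norm_num
  -- As n ≤ 2 < m, the C¹ embedding threshold n < 2(m-1) holds.
  obtain ⟨ρ', u', S, hρ0, hu0⟩ := h.exists_strongSolution (by linarith) hT
  have hc : Continuous (ρ' 0) := (ContDiff.slice S.density_contDiff 0).continuous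
  have hs0 : ∀ x, R < ‖x‖ → ρ' 0 x = 0 := by
    have h1 : EqOn (ρ' 0) (fun _ => 0) {x | R < ‖x‖} :=
      Measure.eqOn_open_of_ae_eq (μ := volume)
        ((ae_restrict_iff' (isOpen_lt continuous_const continuous_norm).measurableSet).2
          (hρ0.mono fun x hx hxR => hx.trans (hsupp x hxR)))
        (isOpen_lt continuous_const continuous_norm) hc.continuousOn continuousOn_const
    exact fun x hx => h1 hx
  have hpos : ∀ x, 0 ≤ ρ' 0 x := by
    have h1 : (fun x => max (ρ' 0 x) 0) =ᵐ[volume] ρ' 0 := by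
      filter_upwards [hρ0, hnonneg] with x h2 h3
      rw [h2]
      exact max_eq_left h3
    have h2 := ((hc.max continuous_const).ae_eq_iff_eq volume hc).1 h1
    exact fun x => by rw [← h2]; exact le_max_right _ _
  have hi : Integrable (ρ' 0) :=
    hc.integrable_of_hasCompactSupport (hasCompactSupport_of_eq_zero hs0)
  have e1 : ∫ x, ρ' 0 x = ∫ x, ρ₀ x := integral_congr_ae hρ0
  have e2 : ∫ x, ρ' 0 x * (2 * ⟪u' 0 x, x⟫_ℝ) = ∫ x, ρ₀ x * (2 * ⟪u₀ x, x⟫_ℝ) :=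
    integral_congr_ae (by filter_upwards [hρ0, hu0] with x h1 h2; rw [h1, h2])
  have hmass : 0 < ∫ x, ρ' 0 x := by
    refine (integral_nonneg hpos).lt_of_ne fun h0 => hnontriv ?_
    have h1 := (integral_eq_zero_iff_of_nonneg hpos hi).1 h0.symm
    filter_upwards [hρ0, h1] with x h2 h3
    rw [← h2, h3]; rfl
  have hN : Nonempty (Fin n) := ⟨⟨0, by exact_mod_cast (zero_lt_one.trans_le hn.1)⟩⟩
  have hnt : Nontrivial (Space n) := inferInstance
  have hext := fun r (hr : 0 ≤ r) => S.velocity_eq_zero_of_exterior ha hμ hlam hρ0 hu0 hs0 hpos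
    hmass hcase hr
  -- Exterior vanishing is available for every ball containing the gas. It first confines the gas to
  -- the initial radius `R`, and is then applied with r = R to confine the velocity.
  have hs := S.density_eq_zero_of_exterior hR hs0 hext
  have hb := S.time_bound hT hR hs (hext R hR hs) hpos
  rw [e1, e2] at hb
  exact ⟨e1 ▸ hmass, hb⟩

/-- Solutions with given data exist only up to a finite time. -/
theorem exists_blowup_time (ha : 0 < a) (hμ : 0 < μ) (hlam : 0 < lam + 2 / (n : ℝ) * μ)
    (hm : 2 < m) (hsupp : HasCompactSupport ρ₀) (hnonneg : ∀ᵐ x, 0 ≤ ρ₀ x)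
    (hnontriv : ¬ ∀ᵐ x, ρ₀ x = 0) (hcase : n = 1 ∨ (n = 2 ∧ SphericallySymmetric ρ₀ u₀)) :
    ∃ Tstar : ℝ, 0 < Tstar ∧ ∀ (T : ℝ) (ρ : ℝ → Space n → ℝ) (u : ℝ → Space n → Space n),
      0 < T → IsSolution a μ lam m T ρ₀ u₀ ρ u → T < Tstar := by
  obtain ⟨R, hR⟩ := hsupp.isCompact.isBounded.exists_norm_le
  have hsupp' : ∀ x, max R 0 < ‖x‖ → ρ₀ x = 0 := fun x hx =>
    image_eq_zero_of_notMem_tsupport fun h =>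
      absurd ((hR x h).trans (le_max_left R 0)) (not_le.2 hx)
  set M := ∫ x, ρ₀ x
  set V := ∫ x, ρ₀ x * (2 * inner ℝ (u₀ x) x)
  set k := n * a * M
  -- Beyond this time the quadratic inequality kT² + VT ≤ R²M fails. The outer absolute value keeps
  -- the bound positive before k > 0 is known: positivity of the mass is derived only once some
  -- solution is given.
  refine ⟨|(max R 0 ^ 2 * M + |V|) / k| + 1, by positivity, fun T ρ u hT h => ?_⟩
  obtain ⟨hM, hb⟩ := IsSolution.time_bound ha hμ hlam hm (le_max_right R 0) hsupp'
    hnonneg hnontriv hcase hT h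
  have hn : (0 : ℝ) < n := by
    rcases hcase with rfl | ⟨rfl, -⟩ <;> norm_num
  have hk : 0 < k := mul_pos (mul_pos hn ha) hM
  by_contra! hle
  have h1 : (max R 0 ^ 2 * M + |V|) / k ≤ T - 1 := by
    linarith [le_abs_self ((max R 0 ^ 2 * M + |V|) / k)]
  have h2 : 1 ≤ T := by linarith [abs_nonneg ((max R 0 ^ 2 * M + |V|) / k)]
  rw [div_le_iff₀ hk] at h1
  have h3 : 0 ≤ max R 0 ^ 2 * M := by positivity
  have h4 : max R 0 ^ 2 * M + k ≤ k * T + V := by linarith [neg_abs_le V]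
  have h5 := mul_le_mul_of_nonneg_right h4 hT.le
  change k * T ^ 2 + V * T ≤ max R 0 ^ 2 * M at hb
  nlinarith

end Blowup

end

end IsothermalNS

theorem theorem1p1 (n : ℕ) (a μ lam m : ℝ) (ha : 0 < a) (hμ : 0 < μ)
    (hlam : 0 < lam + 2 / (n : ℝ) * μ) (hm : 2 < m)
    (ρ₀ : IsothermalNS.Space n → ℝ) (u₀ : IsothermalNS.Space n → IsothermalNS.Space n)
    (hsupp : HasCompactSupport ρ₀) (hnonneg : ∀ᵐ x, 0 ≤ ρ₀ x) (hnontriv : ¬ ∀ᵐ x, ρ₀ x = 0)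
    (hcase : n = 1 ∨ (n = 2 ∧ IsothermalNS.SphericallySymmetric ρ₀ u₀)) :
    (∃ Tstar : ℝ, 0 < Tstar ∧
      ∀ (T : ℝ) (ρ : ℝ → IsothermalNS.Space n → ℝ)
        (u : ℝ → IsothermalNS.Space n → IsothermalNS.Space n), 0 < T →
        IsothermalNS.IsSolution a μ lam m T ρ₀ u₀ ρ u → T < Tstar) ∧
    ¬ ∃ (ρ : ℝ → IsothermalNS.Space n → ℝ)
        (u : ℝ → IsothermalNS.Space n → IsothermalNS.Space n),
        ∀ T : ℝ, 0 < T → IsothermalNS.IsSolution a μ lam m T ρ₀ u₀ ρ u := by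
  obtain ⟨Tstar, hpos, hlt⟩ :=
    IsothermalNS.exists_blowup_time ha hμ hlam hm hsupp hnonneg hnontriv hcase
  exact ⟨⟨Tstar, hpos, hlt⟩, fun ⟨ρ, u, h⟩ => lt_irrefl _ (hlt Tstar ρ u hpos (h Tstar hpos))⟩
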